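/- For a lattice $L\subset\mathbb{C}$ let $\wp(z;L)$ be the Weierstrass function, $g_2(L)=60\sum_{\omega\in L\setminus\{0\}}\omega^{-4}$, $g_3(L)=140\sum_{\omega\in L\setminus\{0\}}\omega^{-6}$, $\Delta(L)=g_2(L)^3-27g_3(L)^2$, $\sigma(z;L)=z\prod_{\omega\in L\setminus\{0\}}(1-\frac{z}{\omega})e^{\frac{z}{\omega}+\frac12(\frac{z}{\omega})^2}$ and $\zeta(z;L)=\sigma'(z;L)/\sigma(z;L)$; for $\omega\in L$ let $\eta(\omega;L)$ be the constant with $\zeta(z+\omega;L)=\zeta(z;L)+\eta(\omega;L)$. For $\tau$ in the upper half-plane $\mathfrak{H}$ put $[\tau,1]=\mathbb{Z}\tau+\mathbb{Z}$, $g_2(\tau)=g_2([\tau,1])$, $g_3(\tau)=g_3([\tau,1])$, $\Delta(\tau)=\Delta([\tau,1])$, and $\eta(\tau)=\sqrt{2\pi}\,e^{2\pi i/8}q^{1/24}\prod_{n\ge1}(1-q^n)$ with $q=e^{2\pi i\tau}$, $q^{1/24}=e^{2\pi i\tau/24}$. For $(r_1,r_2)\in\mathbb{Q}^2\setminus\mathbb{Z}^2$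 let $$\mathfrak{k}_{(r_1,r_2)}(\tau)=e^{-\frac12(r_1\eta(\tau;[\tau,1])+r_2\eta(1;[\tau,1]))(r_1\tau+r_2)}\,\sigma(r_1\tau+r_2;[\tau,1]),\qquad g_{(r_1,r_2)}(\tau)=\mathfrak{k}_{(r_1,r_2)}(\tau)\,\eta(\tau)^2$$ be the Klein form and the Siegel function, and put $$v(\tau)=\frac{g_3(\tau)}{\eta(\tau)^{12}},\qquad x_{(r_1,r_2)}(\tau)=\frac{g_2(\tau)g_3(\tau)\wp(r_1\tau+r_2;[\tau,1])}{\Delta(\tau)},\qquad y_{(r_1,r_2)}(\tau)=-\frac{g_{(2r_1,2r_2)}(\tau)}{g_{(r_1,r_2)}(\tau)^4}.$$ Let $N$ be a positive integer with $4\mid N$, let $\Gamma_{1,4}(N)=\Gamma_1(N)\cap\Gamma(4)$, where $\Gamma_1(N)=\{\left(\begin{smallmatrix}a&b\\c&d\end{smallmatrix}\right)\in\mathrm{SL}_2(\mathbb{Z}): a\equiv d\equiv1,\ c\equiv0 \pmod N\}$ and $\Gamma(4)$ is the principal congruence subgroup of level $4$, and let $X_{1,4}(N)=\Gamma_{1,4}(N)\backslash\mathfrak{H}^*$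 with $\mathfrak{H}^*=\mathfrak{H}\cup\mathbb{P}^1(\mathbb{Q})$ be the corresponding modular curve with its usual structure of a Riemann surface. The elements of $\mathbb{P}^1(\mathbb{Q})$ are the cusps. Let $S\subset\mathbb{P}^3(\mathbb{C})$ be the surface given in homogeneous coordinates $[V:X:Y:Z]$ by $$(Z^2+27V^2)V^3Y^2=4X^3Z^4-(Z^2+27V^2)V^2XZ^2-(Z^2+27V^2)V^4Z.$$ Then there is a holomorphic map $\iota:X_{1,4}(N)\to\mathbb{P}^3(\mathbb{C})$ with image contained in $S$ such that, for every $\tau\in\mathfrak{H}$, the class of $\tau$ is mapped to $$[v(\tau):x_{(0,\frac1N)}(\tau):y_{(0,\frac1N)}(\tau):1].$$ Moreover, let $M\subset X_{1,4}(N)$ be the image of the set consisting of all cusps and of all points $\alpha(\zeta_3)$, $\alpha(\zeta_4)$ with $\alpha\in\mathrm{SL}_2(\mathbb{Z})$, where $\zeta_n=e^{2\pi i/n}$. Then the restriction of $\iota$ to the open set $X_{1,4}(N)\setminus M$ is a holomorphic embedding into $\mathbb{P}^3(\mathbb{C})$, that is, an injective immersion that is a homeomorphism onto its image. -/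

import Mathlib

open scoped MatrixGroups LinearAlgebra.Projectivization Topology UpperHalfPlane

noncomputable section

namespace ModularSurface

/-! ### Lattice functions -/

/-- The pair of periods `(τ, 1)`; its lattice is `[τ, 1] = ℤ τ + ℤ`. -/
def latticeOf (τ : ℍ) : PeriodPair where
  ω₁ := (τ : ℂ)
  ω₂ := 1
  indep := by
    refine LinearIndependent.pair_iff.mpr fun s t h => ?_
    have him := congrArg Complex.im h
    have hre := congrArg Complex.re h
    simp at him hre
    rcases him with hs | hτ
    · subst hs
      simpa using hre
    · exact absurd hτ τ.im_ne_zero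

/-- The Weierstrass `σ`-function
`σ(z; L) = z ∏_{ω ∈ L ∖ {0}} (1 - z / ω) exp (z / ω + (z / ω)² / 2)`. -/
def weierstrassSigma (L : PeriodPair) (z : ℂ) : ℂ :=
  z * ∏' ω : {ω : L.lattice // ω ≠ 0},
    ((1 - z / (ω.1 : ℂ)) * Complex.exp (z / (ω.1 : ℂ) + (z / (ω.1 : ℂ)) ^ 2 / 2))

/-- The Weierstrass `ζ`-function, the logarithmic derivative of `σ`. -/
def weierstrassZeta (L : PeriodPair) (z : ℂ) : ℂ :=
  logDeriv (weierstrassSigma L) z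

/-- The quasi-period `η(ω; L)`: the constant `c` with `ζ(z + ω; L) = ζ(z; L) + c` for all
`z ∉ L`. -/
def quasiPeriod (L : PeriodPair) (ω : ℂ) : ℂ :=
  Classical.epsilon fun c : ℂ =>
    ∀ z : ℂ, z ∉ L.lattice → weierstrassZeta L (z + ω) = weierstrassZeta L z + c

/-! ### Modular forms and functions on the upper half-plane -/

/-- The Klein form `𝔨_{(r₁, r₂)}(τ)`. -/
def kleinForm (r₁ r₂ : ℚ) (τ : ℍ) : ℂ :=
  Complex.exp (-(1 / 2) *
      ((r₁ : ℂ) * quasiPeriod (latticeOf τ) (τ : ℂ) + (r₂ : ℂ) * quasiPeriod (latticeOf τ) 1) *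
      ((r₁ : ℂ) * (τ : ℂ) + (r₂ : ℂ))) *
    weierstrassSigma (latticeOf τ) ((r₁ : ℂ) * (τ : ℂ) + (r₂ : ℂ))

/-- The Dedekind `η`-function in the normalization
`η(τ) = √(2π) ζ₈ q^{1/24} ∏_{n ≥ 1} (1 - qⁿ)` with `ζ₈ = e^{2πi/8}`
(Mathlib's `ModularForm.eta` is `q^{1/24} ∏_{n ≥ 1} (1 - qⁿ)`). -/
def dedekindEta (τ : ℍ) : ℂ :=
  (Real.sqrt (2 * Real.pi) : ℂ) * Complex.exp (2 * Real.pi * Complex.I / 8) *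
    ModularForm.eta (τ : ℂ)

/-- The Siegel function `g_{(r₁, r₂)}(τ) = 𝔨_{(r₁, r₂)}(τ) η(τ)²`. -/
def siegelFunction (r₁ r₂ : ℚ) (τ : ℍ) : ℂ :=
  kleinForm r₁ r₂ τ * dedekindEta τ ^ 2

/-- `g₂(τ) = 60 ∑_{ω ∈ [τ,1] ∖ {0}} ω⁻⁴`. -/
def gTwo (τ : ℍ) : ℂ := (latticeOf τ).g₂

/-- `g₃(τ) = 140 ∑_{ω ∈ [τ,1] ∖ {0}} ω⁻⁶`. -/
def gThree (τ : ℍ) : ℂ := (latticeOf τ).g₃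

/-- `Δ(τ) = g₂(τ)³ - 27 g₃(τ)²`. -/
def discr (τ : ℍ) : ℂ := gTwo τ ^ 3 - 27 * gThree τ ^ 2

/-- The Fricke function
`f_{(r₁, r₂)}(τ) = -2⁷ 3⁵ g₂(τ) g₃(τ) ℘(r₁ τ + r₂; [τ, 1]) / Δ(τ)`. -/
def frickeFunction (r₁ r₂ : ℚ) (τ : ℍ) : ℂ :=
  -(2 ^ 7 * 3 ^ 5) *
    (gTwo τ * gThree τ * (latticeOf τ).weierstrassP ((r₁ : ℂ) * (τ : ℂ) + (r₂ : ℂ)) / discr τ)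

/-- `v(τ) = g₃(τ) / η(τ)¹²`. -/
def vFun (τ : ℍ) : ℂ := gThree τ / dedekindEta τ ^ 12

/-- `x_{(r₁, r₂)}(τ) = -f_{(r₁, r₂)}(τ) / (2⁷ 3⁵)`. -/
def xFun (r₁ r₂ : ℚ) (τ : ℍ) : ℂ := -(1 / (2 ^ 7 * 3 ^ 5)) * frickeFunction r₁ r₂ τ

/-- `y_{(r₁, r₂)}(τ) = -g_{(2r₁, 2r₂)}(τ) / g_{(r₁, r₂)}(τ)⁴`. -/
def yFun (r₁ r₂ : ℚ) (τ : ℍ) : ℂ :=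
  -(siegelFunction (2 * r₁) (2 * r₂) τ / siegelFunction r₁ r₂ τ ^ 4)

/-! ### Projective space and the surface `S` -/

/-- `ℙ³(ℂ)`, with homogeneous coordinates `[V : X : Y : Z]` indexed by `0, 1, 2, 3`. -/
abbrev P3 : Type := ℙ ℂ (Fin 4 → ℂ)

/-- The quotient topology on `ℙ³(ℂ) = (ℂ⁴ ∖ {0}) / ℂˣ`. -/
instance : TopologicalSpace P3 :=
  TopologicalSpace.coinduced
    (fun w : {w : Fin 4 → ℂ // w ≠ 0} => Projectivization.mk ℂ w.1 w.2) inferInstance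

/-- The point `[a : b : c : 1]`. -/
def affinePoint (a b c : ℂ) : P3 :=
  Projectivization.mk ℂ ![a, b, c, 1] fun h => one_ne_zero (congrFun h 3)

/-- The homogeneous equation
`(Z² + 27V²) V³ Y² = 4 X³ Z⁴ - (Z² + 27V²) V² X Z² - (Z² + 27V²) V⁴ Z`. -/
def SurfaceEquation (w : Fin 4 → ℂ) : Prop :=
  (w 3 ^ 2 + 27 * w 0 ^ 2) * w 0 ^ 3 * w 2 ^ 2 =
    4 * w 1 ^ 3 * w 3 ^ 4 - (w 3 ^ 2 + 27 * w 0 ^ 2) * w 0 ^ 2 * w 1 * w 3 ^ 2 -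
      (w 3 ^ 2 + 27 * w 0 ^ 2) * w 0 ^ 4 * w 3

/-- The surface `S ⊆ ℙ³(ℂ)`. -/
def surface : Set P3 := {p | SurfaceEquation p.rep}

/-- Membership in `S` may be tested on any homogeneous coordinates of the point. -/
theorem mk_mem_surface (w : Fin 4 → ℂ) (hw : w ≠ 0) :
    Projectivization.mk ℂ w hw ∈ surface ↔ SurfaceEquation w := by
  obtain ⟨a, ha⟩ := Projectivization.exists_smul_eq_mk_rep ℂ w hw
  have ha0 : (a : ℂ) ^ 7 ≠ 0 := pow_ne_zero _ a.ne_zero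
  have hc : ∀ i, (Projectivization.mk ℂ w hw).rep i = (a : ℂ) * w i := fun i => by
    rw [← ha]; rfl
  simp only [surface, Set.mem_ofPred_eq, SurfaceEquation, hc]
  constructor
  · intro h
    refine mul_left_cancel₀ ha0 ?_
    linear_combination h
  · intro h
    linear_combination (a : ℂ) ^ 7 * h

/-! ### Modular curves -/

/-- The extended upper half-plane `ℍ* = ℍ ∪ ℙ¹(ℚ)`, where `ℙ¹(ℚ) = ℚ ∪ {∞}`. -/
inductive ExtendedUpperHalfPlane : Type
  | ofUpper (τ : ℍ) : ExtendedUpperHalfPlane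
  | cusp (c : OnePoint ℚ) : ExtendedUpperHalfPlane

open ExtendedUpperHalfPlane

/-- `SL₂(ℤ)` acts on `ℍ*` by linear fractional transformations. -/
instance : MulAction SL(2, ℤ) ExtendedUpperHalfPlane where
  smul α p := match p with
    | ofUpper τ => ofUpper (α • τ)
    | cusp c => cusp (Matrix.SpecialLinearGroup.mapGL ℚ α • c)
  one_smul p := by
    cases p with
    | ofUpper τ => exact congrArg ofUpper (one_smul _ τ)
    | cusp c =>
      refine congrArg cusp ?_
      rw [map_one, one_smul]
  mul_smul α β p := by
    cases p with
    | ofUpper τ => exact congrArg ofUpper (mul_smul α β τ)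
    | cusp c =>
      refine congrArg cusp ?_
      rw [map_mul, mul_smul]

/-- The cusp `α(∞)`. -/
def cuspOf (α : SL(2, ℤ)) : ExtendedUpperHalfPlane :=
  α • cusp OnePoint.infty

/-- The usual topology on `ℍ*`: a set is open if its trace on `ℍ` is open and, with every cusp
`α(∞)` in it, it contains a horoball `α {Im τ > A}`. (Every cusp is `α(∞)` for some
`α ∈ SL₂(ℤ)`.) -/
instance : TopologicalSpace ExtendedUpperHalfPlane where
  IsOpen U := IsOpen (ofUpper ⁻¹' U) ∧
    ∀ α : SL(2, ℤ), cuspOf α ∈ U → ∃ A : ℝ, ∀ τ : ℍ, A < τ.im → ofUpper (α • τ) ∈ U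
  isOpen_univ := ⟨isOpen_univ, fun _ _ => ⟨0, fun _ _ => trivial⟩⟩
  isOpen_inter U V hU hV := by
    refine ⟨hU.1.inter hV.1, fun α hα => ?_⟩
    obtain ⟨A, hA⟩ := hU.2 α hα.1
    obtain ⟨B, hB⟩ := hV.2 α hα.2
    exact ⟨max A B, fun τ hτ =>
      ⟨hA τ (lt_of_le_of_lt (le_max_left _ _) hτ), hB τ (lt_of_le_of_lt (le_max_right _ _) hτ)⟩⟩
  isOpen_sUnion s hs := by
    refine ⟨?_, fun α hα => ?_⟩
    · rw [Set.preimage_sUnion]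
      exact isOpen_biUnion fun U hU => (hs U hU).1
    · obtain ⟨U, hU, hαU⟩ := hα
      obtain ⟨A, hA⟩ := (hs U hU).2 α hαU
      exact ⟨A, fun τ hτ => ⟨U, hU, hA τ hτ⟩⟩

/-- The modular curve `Γ \ ℍ*`, with the quotient topology. -/
abbrev ModularCurve (Γ : Subgroup SL(2, ℤ)) : Type :=
  MulAction.orbitRel.Quotient Γ ExtendedUpperHalfPlane

instance (Γ : Subgroup SL(2, ℤ)) : TopologicalSpace (ModularCurve Γ) :=
  inferInstanceAs (TopologicalSpace (Quotient (MulAction.orbitRel Γ ExtendedUpperHalfPlane)))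

/-- The natural map `ℍ* → Γ \ ℍ*`. -/
def proj (Γ : Subgroup SL(2, ℤ)) (p : ExtendedUpperHalfPlane) : ModularCurve Γ :=
  Quotient.mk (MulAction.orbitRel Γ ExtendedUpperHalfPlane) p

/-- The width of the cusp `α(∞)` for `Γ`: the least `h > 0` with `± α Tʰ α⁻¹ ∈ Γ`, where
`T = (1 1; 0 1)`. -/
def cuspWidth (Γ : Subgroup SL(2, ℤ)) (α : SL(2, ℤ)) : ℕ :=
  sInf {h : ℕ | 0 < h ∧
    (α * ModularGroup.T ^ h * α⁻¹ ∈ Γ ∨ -(α * ModularGroup.T ^ h * α⁻¹) ∈ Γ)}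

/-- The map `z ↦ Γ z` from (the upper half-plane in) `ℂ` to `Γ \ ℍ*`. If `±Γ / ±1` acts freely on
`ℍ`, as is the case for subgroups of `Γ(4)`, it is locally biholomorphic and its local inverses
are the charts at the points of `Γ \ ℍ`. -/
def upperParam (Γ : Subgroup SL(2, ℤ)) (z : ℂ) : ModularCurve Γ :=
  proj Γ (ofUpper (UpperHalfPlane.ofComplex z))

open Classical in
/-- The inverse of the chart `q = e^{2πiτ/h}` at the cusp `α(∞)` of width `h`: near `q = 0` it sends
`q = e^{2πiτ/h} ≠ 0` to the class of `α(τ)`, and `0` to the class of `α(∞)`. Here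
`Function.Periodic.invQParam h q = h / (2πi) · log q`. -/
def cuspParam (Γ : Subgroup SL(2, ℤ)) (α : SL(2, ℤ)) (q : ℂ) : ModularCurve Γ :=
  if q = 0 then proj Γ (cuspOf α)
  else proj Γ (ofUpper
    (α • UpperHalfPlane.ofComplex (Function.Periodic.invQParam (cuspWidth Γ α : ℝ) q)))

/-! ### Holomorphic maps and embeddings into `ℙ³(ℂ)` -/

/-- `g` is a holomorphic lift of `G` to `ℂ⁴ ∖ {0}` near `z`. -/
def IsLiftAt (g : ℂ → Fin 4 → ℂ) (G : ℂ → P3) (z : ℂ) : Prop :=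
  AnalyticAt ℂ g z ∧ ∀ᶠ w in 𝓝 z, ∃ h : g w ≠ 0, G w = Projectivization.mk ℂ (g w) h

/-- A map from (an open subset of) `ℂ` to `ℙ³(ℂ)` is holomorphic near `z`: near `z` it is
`[g₀ : g₁ : g₂ : g₃]` with holomorphic `gᵢ` without common zero. -/
def HolomorphicNear (G : ℂ → P3) (z : ℂ) : Prop :=
  ∃ g, IsLiftAt g G z

/-- The map `G` is holomorphic near `z` with nonzero differential at `z`: for a lift `g`, the kernel
of the differential of `ℂ⁴ ∖ {0} → ℙ³(ℂ)` at `g z` is the line `ℂ · g z`, so this says that `g z`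
and `g' z` are linearly independent. -/
def ImmersiveAt (G : ℂ → P3) (z : ℂ) : Prop :=
  ∃ g, IsLiftAt g G z ∧ LinearIndependent ℂ ![g z, deriv g z]

/-- Holomorphic maps `Γ \ ℍ* → ℙ³(ℂ)`: continuous maps that are holomorphic in the local coordinates
at all points, including the cusps. -/
def IsHolomorphic (Γ : Subgroup SL(2, ℤ)) (F : ModularCurve Γ → P3) : Prop :=
  Continuous F ∧
    (∀ τ : ℍ, HolomorphicNear (F ∘ upperParam Γ) (τ : ℂ)) ∧
    ∀ α : SL(2, ℤ), HolomorphicNear (F ∘ cuspParam Γ α) 0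

/-- `F` restricts to a holomorphic embedding of the open set `W`: it is a homeomorphism of `W` onto
its image (in particular injective on `W`) and an immersion at every point of `W`. -/
def IsHolomorphicEmbeddingOn (Γ : Subgroup SL(2, ℤ)) (F : ModularCurve Γ → P3)
    (W : Set (ModularCurve Γ)) : Prop :=
  IsOpen W ∧ Topology.IsEmbedding (W.domRestrict F) ∧
    (∀ τ : ℍ, proj Γ (ofUpper τ) ∈ W → ImmersiveAt (F ∘ upperParam Γ) (τ : ℂ)) ∧
    ∀ α : SL(2, ℤ), proj Γ (cuspOf α) ∈ W → ImmersiveAt (F ∘ cuspParam Γ α) 0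

/-! ### The group `Γ_{1,4}(N)` and the exceptional points -/

/-- `Γ_{1,4}(N) = Γ₁(N) ∩ Γ(4)`. -/
def Gamma14 (N : ℕ) : Subgroup SL(2, ℤ) :=
  CongruenceSubgroup.Gamma1 N ⊓ CongruenceSubgroup.Gamma 4

/-- `ζ₃ = e^{2πi/3}`. -/
def zeta3 : ℍ :=
  ⟨Complex.exp (2 * Real.pi * Complex.I / 3), by
    have h : (2 * Real.pi * Complex.I / 3 : ℂ) = ((2 * Real.pi / 3 : ℝ) : ℂ) * Complex.I := by
      push_cast; ring
    rw [h, Complex.exp_ofReal_mul_I_im]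
    apply Real.sin_pos_of_pos_of_lt_pi <;> linarith [Real.pi_pos]⟩

/-- `ζ₄ = e^{2πi/4} = i`. -/
def zeta4 : ℍ := UpperHalfPlane.I

/-- The set of cusps together with the `SL₂(ℤ)`-orbits of `ζ₃` and `ζ₄`. -/
def exceptionalPoints : Set ExtendedUpperHalfPlane :=
  Set.range cusp ∪
    {p | ∃ α : SL(2, ℤ), p = ofUpper (α • zeta3) ∨ p = ofUpper (α • zeta4)}

/-- The image `M` of the exceptional points on the modular curve of `Γ`. -/
def exceptionalLocus (Γ : Subgroup SL(2, ℤ)) : Set (ModularCurve Γ) :=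
  proj Γ '' exceptionalPoints

end ModularSurface

end

open ModularSurface

noncomputable section

namespace ModularSurface

/-! ### The Weierstrass sigma function -/

section Sigma

open Filter PeriodPair

variable (L : PeriodPair)

/-! The duplication formula ℘'(z) = -σ(2z)/σ(z)⁴ turns the Siegel quotient into y = ℘'(1/N)/η⁶
(`yFun_eq`). Since η²⁴ = Δ, one has 1 + 27v² = g₂³/Δ, and the equation of S becomes ℘'² = 4℘³ - g₂℘
- g₃ in rescaled coordinates.

Separation of points (`exists_mem_Gamma14_smul`) uses one coordinate at a time. Where g₂g₃ ≠ 0, the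
value of v fixes the ratio g₂³ : g₃², hence the lattice up to homothety, because g₂ and g₃ determine
a lattice; so τ₂ = γτ₁ with γ in SL₂(ℤ). Equality of x says ℘((cτ₁+d)/N) = ℘(1/N), which forces
(c,d) ≡ ±(0,1) mod N, and the sign can be absorbed into γ. Equality of y then says that the
multiplier of η⁶ at γ is 1, because ℘'(1/N) ≠ 0; on matrices that are upper unipotent mod 4 this
multiplier is i^b, so 4 ∣ b and γ lies in Γ_{1,4}(N). The same transformation formulas give
invariance under this group.

The map is immersive because v' = c g₂²/η¹² with c ≠ 0 (`exists_hasDerivAt_vFun`): the Serre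
derivative of E₆ has weight 8, where E₄² spans.

At a cusp one divides by x. The coordinates [v/x : 1 : y/x : 1/x] have numerators tending to 0
through powers of η, over the common denominator g₂g₃℘, which stays away from 0
(`exists_le_norm_torsionP`). They extend holomorphically over the cusp, with value [0:1:0:0].

The inverse is continuous (`eventually_proj_mem`) because v is open where g₂ ≠ 0 and Γ_{1,4}(N) has
finite index. -/

theorem norm_primaryFactor_sub_one_le {u : ℂ} (hu : ‖u‖ ≤ 1 / 2) :
    ‖(1 - u) * Complex.exp (u + u ^ 2 / 2) - 1‖ ≤ 4 * ‖u‖ ^ 3 := by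
  have h1 : 1 - u ≠ 0 := by
    intro h
    have : u = 1 := by linear_combination -h
    rw [this] at hu
    norm_num at hu
  -- The exponent of the primary factor cancels the Taylor polynomial of log(1 - u) of degree 2,
  -- leaving a cubic remainder.
  have hlog : ‖Complex.log (1 - u) + u + u ^ 2 / 2‖ ≤ 2 / 3 * ‖u‖ ^ 3 := by
    have := Complex.norm_log_sub_logTaylor_le 2 (z := -u) (by rw [norm_neg]; linarith)
    have e : Complex.logTaylor (2 + 1) (-u) = -u - u ^ 2 / 2 := by
      simp [Complex.logTaylor, Finset.sum_range_succ]; ring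
    rw [e, norm_neg] at this
    calc ‖Complex.log (1 - u) + u + u ^ 2 / 2‖
        = ‖Complex.log (1 + -u) - (-u - u ^ 2 / 2)‖ := by congr 1; ring_nf
      _ ≤ _ := this
      _ ≤ ‖u‖ ^ (2 + 1) * 2 / (2 + 1) := by
          have : (1 - ‖u‖)⁻¹ ≤ 2 := inv_le_of_inv_le₀ (by norm_num) (by linarith)
          push_cast
          gcongr
      _ = _ := by ring
  have hsmall : ‖Complex.log (1 - u) + u + u ^ 2 / 2‖ ≤ 1 := by
    refine hlog.trans ?_
    have : ‖u‖ ^ 3 ≤ (1 / 2) ^ 3 := by gcongr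
    linarith
  have e : (1 - u) * Complex.exp (u + u ^ 2 / 2)
      = Complex.exp (Complex.log (1 - u) + u + u ^ 2 / 2) := by
    rw [add_assoc, Complex.exp_add (Complex.log _), Complex.exp_log h1]
  rw [e]
  refine (Complex.norm_exp_sub_one_le hsmall).trans ?_
  have : 0 ≤ ‖u‖ ^ 3 := by positivity
  linarith

/-- The factor of the `σ`-product at `l`; it is `1` for `l = 0`. -/
def sigmaFactor (l : L.lattice) (z : ℂ) : ℂ :=
  (1 - z / (l : ℂ)) * Complex.exp (z / (l : ℂ) + (z / (l : ℂ)) ^ 2 / 2)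

/-- The product `σ(z) / z`, extended to `z = 0`. -/
def sigmaQuot (z : ℂ) : ℂ := ∏' l : L.lattice, sigmaFactor L l z

@[fun_prop]
theorem differentiable_sigmaFactor (l : L.lattice) : Differentiable ℂ (sigmaFactor L l) := by
  unfold sigmaFactor
  fun_prop

theorem weierstrassSigma_eq (z : ℂ) : weierstrassSigma L z = z * sigmaQuot L z := by
  unfold weierstrassSigma sigmaQuot
  congr 1
  refine tprod_subtype_eq_of_mulSupport_subset (f := fun l : L.lattice => sigmaFactor L l z)
    (s := {l : L.lattice | l ≠ 0}) ?_
  intro l hl h0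
  apply hl
  -- At l = 0 the convention z / 0 = 0 makes the factor 1.
  simp only [sigmaFactor, h0]
  simp

/-- The exponent 3 exceeds the rank 2 of the lattice. This series dominates both the product for σ
and the sum for its logarithmic derivative. -/
theorem summable_norm_rpow_neg_three : Summable fun l : L.lattice => ‖l‖ ^ (-3 : ℝ) :=
  ZLattice.summable_norm_rpow _ _ (by simp; norm_num)

theorem eventually_cofinite_le_norm (R : ℝ) : ∀ᶠ l : L.lattice in cofinite, R ≤ ‖l‖ := by
  refine (isCompact_iff_finite.mp (isCompact_closedBall (0 : L.lattice) R)).subset ?_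
  intro l hl
  simp only [Set.mem_compl_iff, Set.mem_ofPred_eq, not_le] at hl
  simpa using hl.le

theorem norm_sigmaFactor_sub_one_le {R : ℝ} (hR : 0 < R) {l : L.lattice} (hl : 2 * R ≤ ‖l‖) {z : ℂ}
    (hz : ‖z‖ ≤ R) : ‖sigmaFactor L l z - 1‖ ≤ 4 * R ^ 3 * ‖l‖ ^ (-3 : ℝ) := by
  have hl0 : 0 < ‖(l : ℂ)‖ := by
    change 2 * R ≤ ‖(l : ℂ)‖ at hl
    linarith
  change 2 * R ≤ ‖(l : ℂ)‖ at hl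
  change _ ≤ 4 * R ^ 3 * ‖(l : ℂ)‖ ^ (-3 : ℝ)
  have hu : ‖z / (l : ℂ)‖ ≤ R / ‖(l : ℂ)‖ := by
    rw [norm_div]; gcongr
  refine (norm_primaryFactor_sub_one_le (hu.trans ?_)).trans ?_
  · rw [div_le_div_iff₀ hl0 (by norm_num)]; linarith
  · calc 4 * ‖z / (l : ℂ)‖ ^ 3 ≤ 4 * (R / ‖(l : ℂ)‖) ^ 3 := by gcongr
      _ = _ := by
        rw [Real.rpow_neg hl0.le]
        norm_cast
        field_simp

theorem hasProdLocallyUniformlyOn_sigmaFactor :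
    HasProdLocallyUniformlyOn (sigmaFactor L) (sigmaQuot L) Set.univ := by
  refine hasProdLocallyUniformlyOn_of_forall_compact isOpen_univ fun K _ hK => ?_
  obtain ⟨R, hR, hKR⟩ : ∃ R : ℝ, 0 < R ∧ ∀ z ∈ K, ‖z‖ ≤ R := by
    obtain ⟨R, hR⟩ := hK.isBounded.exists_norm_le
    exact ⟨max R 1, by positivity, fun z hz => (hR z hz).trans (le_max_left _ _)⟩
  have := Summable.hasProdUniformlyOn_one_add (f := fun l z => sigmaFactor L l z - 1) hK
    ((summable_norm_rpow_neg_three L).mul_left (4 * R ^ 3))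
    ((eventually_cofinite_le_norm L (2 * R)).mono fun l hl z hz =>
      norm_sigmaFactor_sub_one_le L hR hl (hKR z hz))
    (fun l => ((differentiable_sigmaFactor L l).continuous.sub continuous_const).continuousOn)
  simp only [add_sub_cancel] at this
  exact this

theorem differentiable_sigmaQuot : Differentiable ℂ (sigmaQuot L) := by
  rw [← differentiableOn_univ]
  refine (hasProdLocallyUniformlyOn_sigmaFactor L).differentiableOn ?_ isOpen_univ
  refine .of_forall fun s => ?_
  exact DifferentiableOn.fun_finsetProd fun i _ => (differentiable_sigmaFactor L i).differentiableOn

theorem summable_norm_sigmaFactor_sub_one (z : ℂ) :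
    Summable fun l : L.lattice => ‖sigmaFactor L l z - 1‖ := by
  have hR : 0 < ‖z‖ + 1 := by positivity
  refine summable_of_isBigO ((summable_norm_rpow_neg_three L).mul_left (4 * (‖z‖ + 1) ^ 3)) ?_
  refine Asymptotics.IsBigO.of_bound 1 ?_
  filter_upwards [eventually_cofinite_le_norm L (2 * (‖z‖ + 1))] with l hl
  have := norm_sigmaFactor_sub_one_le L hR hl (by linarith : ‖z‖ ≤ ‖z‖ + 1)
  rw [norm_norm, one_mul, Real.norm_of_nonneg (by positivity)]
  exact this

theorem sigmaFactor_ne_zero {z : ℂ} {l : L.lattice} (h : l = 0 ∨ z ≠ l) :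
    sigmaFactor L l z ≠ 0 := by
  refine mul_ne_zero ?_ (Complex.exp_ne_zero _)
  rw [sub_ne_zero]
  intro h1
  by_cases hl : (l : ℂ) = 0
  · simp [hl] at h1
  · rcases h with h | h
    · exact hl (by simp [h])
    · exact h (by field_simp at h1; exact h1.symm)

theorem sigmaQuot_ne_zero {z : ℂ} (hz : z ∉ L.lattice ∨ z = 0) : sigmaQuot L z ≠ 0 := by
  have := tprod_one_add_ne_zero_of_summable (f := fun l : L.lattice => sigmaFactor L l z - 1)
    (fun l => ?_) (summable_norm_sigmaFactor_sub_one L z)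
  · simpa [sigmaQuot] using this
  · simp only [add_sub_cancel]
    refine sigmaFactor_ne_zero L ?_
    by_cases hl : l = 0
    · exact Or.inl hl
    · right
      rintro rfl
      rcases hz with hz | hz
      · exact hz l.2
      · exact hl (by simpa using hz)

theorem sigmaQuot_eq_zero {l : L.lattice} (hl : l ≠ 0) : sigmaQuot L l = 0 := by
  refine tprod_of_exists_eq_zero ⟨l, ?_⟩
  have : (l : ℂ) ≠ 0 := by simpa using hl
  simp [sigmaFactor, this]

theorem differentiable_weierstrassSigma : Differentiable ℂ (weierstrassSigma L) := by
  have : weierstrassSigma L = fun z => z * sigmaQuot L z := funext (weierstrassSigma_eq L)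
  rw [this]
  exact differentiable_id.mul (differentiable_sigmaQuot L)

theorem weierstrassSigma_eq_zero_iff (z : ℂ) : weierstrassSigma L z = 0 ↔ z ∈ L.lattice := by
  rw [weierstrassSigma_eq]
  constructor
  · intro h
    by_contra hz
    rcases mul_eq_zero.mp h with h | h
    · exact hz (h ▸ zero_mem _)
    · exact sigmaQuot_ne_zero L (Or.inl hz) h
  · intro hz
    by_cases h0 : z = 0
    · simp [h0]
    · have := sigmaQuot_eq_zero L (l := ⟨z, hz⟩) (by simpa [Subtype.ext_iff] using h0)
      simp only at this
      rw [this, mul_zero]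

theorem sigmaQuot_neg (z : ℂ) : sigmaQuot L (-z) = sigmaQuot L z := by
  unfold sigmaQuot
  rw [← (Equiv.neg L.lattice).tprod_eq]
  refine tprod_congr fun l => ?_
  simp [sigmaFactor]

theorem weierstrassSigma_neg (z : ℂ) : weierstrassSigma L (-z) = -weierstrassSigma L z := by
  rw [weierstrassSigma_eq, weierstrassSigma_eq, sigmaQuot_neg, neg_mul]

@[simp]
theorem sigmaQuot_zero : sigmaQuot L 0 = 1 := by simp [sigmaQuot, sigmaFactor]

theorem deriv_weierstrassSigma_zero : deriv (weierstrassSigma L) 0 = 1 := by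
  have : weierstrassSigma L = fun z => z * sigmaQuot L z := funext (weierstrassSigma_eq L)
  have h := ((hasDerivAt_id' (0 : ℂ)).fun_mul
    ((differentiable_sigmaQuot L) 0).hasDerivAt).deriv
  rw [this]
  simpa using h

/-- The summand at `l` of the logarithmic derivative of `σ(z) / z`. -/
def zetaSummand (l : L.lattice) (z : ℂ) : ℂ :=
  if (l : ℂ) = 0 then 0 else 1 / (z - l) + 1 / l + z / l ^ 2

/-- The logarithmic derivative of `σ(z) / z`. -/
def zetaExcept (z : ℂ) : ℂ := ∑' l : L.lattice, zetaSummand L l z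

/-- The three parts of a summand combine to s²/(l²(s - l)), which decays cubically as soon as ‖l‖ ≥
2‖s‖. -/
theorem hasSumLocallyUniformly_zetaSummand :
    HasSumLocallyUniformly (zetaSummand L) (zetaExcept L) := by
  refine L.hasSumLocallyUniformly_aux (u := fun r l => 2 * r ^ 2 * ‖l‖ ^ (-3 : ℝ)) _
    (fun r _ => (summable_norm_rpow_neg_three L).mul_left _) fun r hr =>
    Filter.eventually_atTop.mpr ⟨2 * r, ?_⟩
  rintro _ h s hs l rfl
  have hl0 : 0 < ‖(l : ℂ)‖ := by
    have : 0 < 2 * r := by linarith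
    exact this.trans_le h
  change _ ≤ 2 * r ^ 2 * ‖(l : ℂ)‖ ^ (-3 : ℝ)
  have hl : (l : ℂ) ≠ 0 := norm_pos_iff.mp hl0
  have hsl : s - l ≠ 0 := by
    intro e
    rw [sub_eq_zero.mp e] at hs
    change 2 * r ≤ ‖(l : ℂ)‖ at h
    linarith
  have hlow : ‖(l : ℂ)‖ / 2 ≤ ‖s - l‖ := by
    have := norm_sub_norm_le (l : ℂ) s
    rw [norm_sub_rev] at this
    change 2 * r ≤ ‖(l : ℂ)‖ at h
    linarith
  have e : zetaSummand L l s = s ^ 2 / (l ^ 2 * (s - l)) := by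
    rw [zetaSummand, if_neg hl]
    field_simp
    ring
  rw [e, norm_div, norm_mul, norm_pow, norm_pow]
  calc ‖s‖ ^ 2 / (‖(l : ℂ)‖ ^ 2 * ‖s - l‖) ≤ r ^ 2 / (‖(l : ℂ)‖ ^ 2 * (‖(l : ℂ)‖ / 2)) := by
        gcongr
    _ = _ := by
      rw [Real.rpow_neg hl0.le]
      norm_cast
      field_simp

theorem logDeriv_sigmaFactor {z : ℂ} (hz : z ∉ L.lattice) (l : L.lattice) :
    logDeriv (sigmaFactor L l) z = zetaSummand L l z := by
  have hzl : z ≠ l := fun h => hz (h ▸ l.2)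
  by_cases hl : (l : ℂ) = 0
  · have : sigmaFactor L l = fun _ => 1 := by
      funext w; simp [sigmaFactor, hl]
    rw [this, zetaSummand, if_pos hl]
    simp
  · have h1 : 1 - z / l ≠ 0 := by
      rw [sub_ne_zero]
      intro h
      apply hzl
      field_simp at h
      exact h.symm
    have hd1 : HasDerivAt (fun w : ℂ => 1 - w / l) (-(1 / l)) z := by
      simpa using ((hasDerivAt_id z).div_const (l : ℂ)).const_sub 1
    have hd2 : HasDerivAt (fun w : ℂ => w / l + (w / l) ^ 2 / 2) (1 / l + z / l ^ 2) z := by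
      have h := ((hasDerivAt_id z).div_const (l : ℂ)).add
        ((((hasDerivAt_id z).div_const (l : ℂ)).pow 2).div_const 2)
      refine h.congr_deriv ?_
      simp
      field_simp
    have hd : HasDerivAt (sigmaFactor L l) _ z := hd1.mul hd2.cexp
    rw [logDeriv_apply, hd.deriv, zetaSummand, if_neg hl, sigmaFactor]
    have hzl' : z - l ≠ 0 := sub_ne_zero.mpr hzl
    have hlz : (l : ℂ) - z ≠ 0 := sub_ne_zero.mpr hzl.symm
    have he := Complex.exp_ne_zero (z / l + (z / l) ^ 2 / 2)
    rw [div_eq_iff (mul_ne_zero h1 he)]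
    generalize Complex.exp (z / l + (z / l) ^ 2 / 2) = E
    field_simp
    ring

theorem logDeriv_weierstrassSigma {z : ℂ} (hz : z ∉ L.lattice) :
    logDeriv (weierstrassSigma L) z = 1 / z + zetaExcept L z := by
  have h0 : z ≠ 0 := fun h => hz (h ▸ zero_mem _)
  have hq : sigmaQuot L z ≠ 0 := sigmaQuot_ne_zero L (Or.inl hz)
  have e : weierstrassSigma L = fun z => z * sigmaQuot L z := funext (weierstrassSigma_eq L)
  rw [e, logDeriv_mul (f := fun z => z) z h0 hq differentiableAt_id (differentiable_sigmaQuot L z),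
    logDeriv_id']
  congr 1
  have hs := logDeriv_tprod_eq_tsum (f := sigmaFactor L) isOpen_univ (Set.mem_univ z)
    (fun l => sigmaFactor_ne_zero L (Or.inr fun h => hz (h ▸ l.2)))
    (fun l => (differentiable_sigmaFactor L l).differentiableOn)
    (by
      simp only [logDeriv_sigmaFactor L hz]
      exact ((hasSumLocallyUniformly_zetaSummand L).hasSum (x := z)).summable)
    (hasProdLocallyUniformlyOn_sigmaFactor L).multipliableLocallyUniformlyOn hq
  simp only [logDeriv_sigmaFactor L hz] at hs
  exact hs

theorem hasDerivAt_zetaSummand {l : L.lattice} {z : ℂ} (h : (l : ℂ) ≠ 0 → z ≠ l) :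
    HasDerivAt (zetaSummand L l)
      (-(if (l : ℂ) = 0 then 0 else (1 / (z - l) ^ 2 - 1 / (l : ℂ) ^ 2))) z := by
  unfold zetaSummand
  split_ifs with hl
  · simpa using hasDerivAt_const z (0 : ℂ)
  · have hzl : z - l ≠ 0 := sub_ne_zero.mpr (h hl)
    have h1 := (((((hasDerivAt_id z).sub_const (l : ℂ)).inv hzl)).add_const (1 / (l : ℂ))).add
      ((hasDerivAt_id z).div_const ((l : ℂ) ^ 2))
    simp only [one_div]
    simp only [id, one_div] at h1
    refine h1.congr_deriv ?_
    ring

/-- Locally uniform convergence allows termwise differentiation. The notation `℘[L - (0 : ℂ)]`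
stands for ℘ with the polar term 1/z² removed. -/
theorem hasDerivAt_zetaExcept {z : ℂ} (hz : z ∉ L.lattice) :
    HasDerivAt (zetaExcept L) (-℘[L - (0 : ℂ)] z) z := by
  have hopen : IsOpen ((L.lattice : Set ℂ)ᶜ) := L.isClosed_lattice.isOpen_compl
  have hne (w : ℂ) (hw : w ∈ ((L.lattice : Set ℂ)ᶜ)) (l : L.lattice) : w ≠ l := by
    rintro rfl; exact hw l.2
  have hd (s : Finset L.lattice) : DifferentiableOn ℂ (fun w => ∑ l ∈ s, zetaSummand L l w)
      ((L.lattice : Set ℂ)ᶜ) := by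
    refine .fun_sum fun l _ w hw => ?_
    exact (hasDerivAt_zetaSummand L fun _ => hne w hw l).differentiableAt.differentiableWithinAt
  have hT := (hasSumLocallyUniformly_zetaSummand L).tendstoLocallyUniformlyOn
    (s := (L.lattice : Set ℂ)ᶜ)
  have hdiff : DifferentiableOn ℂ (zetaExcept L) ((L.lattice : Set ℂ)ᶜ) :=
    hT.differentiableOn (.of_forall hd) hopen
  have h1 := (hT.deriv (.of_forall hd) hopen).tendsto_at hz
  have h2 := (L.hasSum_weierstrassPExcept 0 z).neg
  have h3 : deriv (zetaExcept L) z = -℘[L - (0 : ℂ)] z := by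
    refine tendsto_nhds_unique h1 (Tendsto.congr (fun s => ?_) h2)
    simp only [Function.comp_apply]
    rw [deriv_fun_sum fun l _ =>
      (hasDerivAt_zetaSummand L fun _ => hne z hz l).differentiableAt]
    exact Finset.sum_congr rfl fun l _ => (hasDerivAt_zetaSummand L fun _ => hne z hz l).deriv.symm
  rw [← h3]
  exact ((hdiff z hz).differentiableAt (hopen.mem_nhds hz)).hasDerivAt

theorem hasDerivAt_logDeriv_weierstrassSigma {z : ℂ} (hz : z ∉ L.lattice) :
    HasDerivAt (logDeriv (weierstrassSigma L)) (-℘[L] z) z := by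
  have h0 : z ≠ 0 := fun h => hz (h ▸ zero_mem _)
  have h1 : HasDerivAt (fun w => 1 / w + zetaExcept L w) (-℘[L] z) z := by
    have := (hasDerivAt_inv h0).add (hasDerivAt_zetaExcept L hz)
    simp only [one_div]
    refine this.congr_deriv ?_
    have e := L.weierstrassPExcept_def 0 z
    simp only [ZeroMemClass.coe_zero] at e
    rw [e]
    simp
  refine h1.congr_of_eventuallyEq ?_
  filter_upwards [L.isClosed_lattice.isOpen_compl.mem_nhds hz] with w hw
  exact logDeriv_weierstrassSigma L hw

theorem isPreconnected_compl_lattice : IsPreconnected ((L.lattice : Set ℂ)ᶜ) := by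
  have : (L.lattice : Set ℂ).Countable := countable_of_Lindelof_of_discrete (X := L.lattice)
  exact (this.isConnected_compl_of_one_lt_rank (by simp)).isPreconnected


theorem add_mem_lattice_iff {z ω : ℂ} (hω : ω ∈ L.lattice) : z + ω ∈ L.lattice ↔ z ∈ L.lattice :=
  L.lattice.toAddSubgroup.add_mem_cancel_right hω

/-- Quasi-periodicity of the `σ`-function. -/
theorem exists_weierstrassSigma_add {ω : ℂ} (hω : ω ∈ L.lattice) :
    ∃ a c : ℂ, c ≠ 0 ∧ ∀ z,
      weierstrassSigma L (z + ω) = c * Complex.exp (a * z) * weierstrassSigma L z := by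
  have hopen : IsOpen ((L.lattice : Set ℂ)ᶜ) := L.isClosed_lattice.isOpen_compl
  have hadd {z : ℂ} (hz : z ∈ (L.lattice : Set ℂ)ᶜ) : z + ω ∉ L.lattice := fun h =>
    hz ((add_mem_lattice_iff L hω).mp h)
  have hder (z : ℂ) (hz : z ∈ (L.lattice : Set ℂ)ᶜ) :
      HasDerivAt (fun w => logDeriv (weierstrassSigma L) (w + ω) - logDeriv (weierstrassSigma L) w)
        0 z := by
    have h1 := (hasDerivAt_logDeriv_weierstrassSigma L (hadd hz)).comp_add_const z ω
    have h2 := hasDerivAt_logDeriv_weierstrassSigma L hz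
    refine (h1.sub h2).congr_deriv ?_
    rw [L.weierstrassP_add_coe z ⟨ω, hω⟩, sub_self]
  -- Periodicity of ℘ makes ζ(z + ω) - ζ(z) locally constant, and the complement of a countable set
  -- in the plane is connected. Integrating the logarithmic derivative then gives the factor
  -- c·exp(az).
  obtain ⟨a, ha⟩ := hopen.exists_is_const_of_deriv_eq_zero (isPreconnected_compl_lattice L)
    (fun z hz => (hder z hz).differentiableAt.differentiableWithinAt)
    (fun z hz => (hder z hz).deriv)
  have hσ : Differentiable ℂ (weierstrassSigma L) := differentiable_weierstrassSigma L
  have hσ0 {z : ℂ} (hz : z ∉ L.lattice) : weierstrassSigma L z ≠ 0 := fun h =>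
    hz ((weierstrassSigma_eq_zero_iff L z).mp h)
  have hlog : Set.EqOn (logDeriv fun z => weierstrassSigma L (z + ω))
      (logDeriv fun z => Complex.exp (a * z) * weierstrassSigma L z) ((L.lattice : Set ℂ)ᶜ) := by
    intro z hz
    have hshift : logDeriv (fun z => weierstrassSigma L (z + ω)) z
        = logDeriv (weierstrassSigma L) (z + ω) := by
      simp only [logDeriv_apply]
      rw [deriv_comp_add_const]
    have hexp : logDeriv (fun z => Complex.exp (a * z)) z = a := by
      have : HasDerivAt (fun z => Complex.exp (a * z)) (Complex.exp (a * z) * (a * 1)) z :=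
        ((hasDerivAt_id z).const_mul a).cexp
      rw [logDeriv_apply, this.deriv]
      field_simp [Complex.exp_ne_zero]
    rw [hshift, logDeriv_mul (f := fun z => Complex.exp (a * z)) z (Complex.exp_ne_zero _) (hσ0 hz)
      (by fun_prop) (hσ z), hexp, ← ha z hz]
    ring
  obtain ⟨c, hc, hcz⟩ := (logDeriv_eqOn_iff
    ((hσ.comp (differentiable_id.add_const ω)).differentiableOn)
    (((by fun_prop : Differentiable ℂ fun z => Complex.exp (a * z)).mul hσ).differentiableOn)
    hopen (isPreconnected_compl_lattice L)
    (fun z hz => mul_ne_zero (Complex.exp_ne_zero _) (hσ0 hz)) (fun z hz => hσ0 (hadd hz))).mp hlog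
  refine ⟨a, c, hc, fun z => ?_⟩
  by_cases hz : z ∈ L.lattice
  · rw [(weierstrassSigma_eq_zero_iff L z).mpr hz,
      (weierstrassSigma_eq_zero_iff L _).mpr ((add_mem_lattice_iff L hω).mpr hz), mul_zero]
  · have := hcz hz
    simp only [Function.comp_apply, Pi.smul_apply, Pi.mul_apply, smul_eq_mul, id] at this
    rw [mul_assoc]
    exact this

/-- `σ(z + w) σ(z - w) / (σ(z)² σ(w)²) = ℘(w) - ℘(z)`, with denominators cleared. -/
theorem weierstrassSigma_add_mul_sub {z w : ℂ} (hz : z ∉ L.lattice) (hw : w ∉ L.lattice) :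
    weierstrassSigma L (z + w) * weierstrassSigma L (z - w) =
      (℘[L] w - ℘[L] z) * (weierstrassSigma L z ^ 2 * weierstrassSigma L w ^ 2) := by
  classical
  set σ := weierstrassSigma L with hσdef
  have hσ : Differentiable ℂ σ := differentiable_weierstrassSigma L
  have hσ0 {z : ℂ} (hz : z ∉ L.lattice) : σ z ≠ 0 := fun h =>
    hz ((weierstrassSigma_eq_zero_iff L z).mp h)
  -- The quotient σ(z+w)σ(z-w)/σ(z)² equals N(z)/z² near 0. As N is even, its only polar term there
  -- is N(0)/z² = -σ(w)²/z².
  let N : ℂ → ℂ := fun z => σ (z + w) * σ (z - w) / sigmaQuot L z ^ 2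
  let U : Set ℂ := ((L.lattice : Set ℂ) \ {0})ᶜ
  have hU : IsOpen U := L.isOpen_compl_lattice_sdiff
  have hU0 : U ∈ 𝓝 (0 : ℂ) := hU.mem_nhds (by simp [U])
  have hUmem {z : ℂ} (hz : z ∈ U) : z ∉ L.lattice ∨ z = 0 := by
    simp only [U, Set.mem_compl_iff, Set.mem_sdiff, SetLike.mem_coe, Set.mem_singleton_iff] at hz
    tauto
  have hN : DifferentiableOn ℂ N U := by
    refine DifferentiableOn.div ?_ ?_ fun z hz => pow_ne_zero _ (sigmaQuot_ne_zero L (hUmem hz))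
    · exact ((hσ.comp (differentiable_id.add_const w)).mul
        (hσ.comp (differentiable_id.sub_const w))).differentiableOn
    · exact ((differentiable_sigmaQuot L).pow 2).differentiableOn
  have hNneg (z : ℂ) : N (-z) = N z := by
    simp only [N, sigmaQuot_neg]
    rw [show -z + w = -(z - w) by ring, show -z - w = -(z + w) by ring, hσdef, weierstrassSigma_neg,
      weierstrassSigma_neg]
    ring
  have hN0 : N 0 = -σ w ^ 2 := by
    simp only [N, sigmaQuot_zero, zero_add, zero_sub, hσdef, weierstrassSigma_neg]
    ring
  have hN' : deriv N 0 = 0 := by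
    have h := deriv_comp_neg (f := N) 0
    have e : (fun x => N (-x)) = N := funext hNneg
    rw [e, neg_zero] at h
    exact CharZero.eq_neg_self_iff.mp h
  -- The double slope is (N(z) - N(0))/z², because N'(0) = 0. So E is the holomorphic continuation
  -- over 0 of the function h below.
  let E : ℂ → ℂ := fun z => dslope (dslope N 0) 0 z + σ w ^ 2 * ℘[L - (0 : ℂ)] z
  have hE : DifferentiableOn ℂ E U := by
    refine DifferentiableOn.add ?_ ((L.differentiableOn_weierstrassPExcept 0).const_mul _)
    rw [Complex.differentiableOn_dslope hU0, Complex.differentiableOn_dslope hU0]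
    exact hN
  let h : ℂ → ℂ := fun z => if z ∈ L.lattice then E 0 else
    σ (z + w) * σ (z - w) / σ z ^ 2 + σ w ^ 2 * ℘[L] z
  have hEh {z : ℂ} (hz : z ∈ U) : h z = E z := by
    rcases hUmem hz with hzL | rfl
    · have hz0 : z ≠ 0 := fun e => hzL (e ▸ zero_mem _)
      have hq := sigmaQuot_ne_zero L (Or.inl hzL)
      have e := L.weierstrassPExcept_def 0 z
      simp only [ZeroMemClass.coe_zero] at e
      simp only [h, if_neg hzL, E]
      rw [dslope_of_ne _ hz0, slope_def_field, dslope_of_ne _ hz0, slope_def_field, dslope_same, hN',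
        e, hN0, sub_zero, sub_zero]
      simp only [N]
      rw [hσdef, weierstrassSigma_eq L z]
      field_simp
      simp
      field_simp
      ring
    · simp [h]
  have hper (z : ℂ) (l : L.lattice) : h (z + l) = h z := by
    simp only [h, add_mem_lattice_iff L l.2]
    split_ifs with hz
    · rfl
    · obtain ⟨a, c, hc, hac⟩ := exists_weierstrassSigma_add L l.2
      have hs := hσ0 hz
      rw [L.weierstrassP_add_coe, show z + l + w = (z + w) + l by ring,
        show z + l - w = (z - w) + l by ring]
      simp only [hσdef] at hs ⊢
      rw [hac, hac, hac]
      congr 1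
      rw [mul_add, mul_sub, sub_eq_add_neg, Complex.exp_add, Complex.exp_add, Complex.exp_neg]
      have h1 := Complex.exp_ne_zero (a * z)
      have h2 := Complex.exp_ne_zero (a * w)
      field_simp
  have hdiff : Differentiable ℂ h := by
    intro z
    by_cases hz : z ∈ L.lattice
    · have h0 : DifferentiableAt ℂ h 0 := by
        refine ((hE 0 (mem_of_mem_nhds hU0)).differentiableAt hU0).congr_of_eventuallyEq ?_
        filter_upwards [hU0] with x hx using hEh hx
      have e : h = fun x => h (x - z) := by
        funext x
        have := hper (x - z) ⟨z, hz⟩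
        simpa using this
      rw [e]
      refine DifferentiableAt.comp z (g := h) (f := fun x => x - z) ?_ (by fun_prop)
      simpa using h0
    · have hopen : IsOpen ((L.lattice : Set ℂ)ᶜ) := L.isClosed_lattice.isOpen_compl
      have h1 : DifferentiableAt ℂ (fun z => σ (z + w) * σ (z - w) / σ z ^ 2 + σ w ^ 2 * ℘[L] z) z := by
        refine DifferentiableAt.add ?_ (((L.differentiableOn_weierstrassP z hz).differentiableAt
          (hopen.mem_nhds hz)).const_mul _)
        refine DifferentiableAt.div ?_ ((hσ z).pow 2) (pow_ne_zero _ (hσ0 hz))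
        exact ((hσ.comp (differentiable_id.add_const w)).mul
          (hσ.comp (differentiable_id.sub_const w))) z
      refine h1.congr_of_eventuallyEq ?_
      filter_upwards [hopen.mem_nhds hz] with x hx
      simp only [h]
      rw [if_neg (show x ∉ L.lattice from hx)]
  -- Liouville: an entire function with period lattice L is bounded, hence constant. At w the first
  -- term vanishes, since σ(0) = 0.
  have hconst : h z = h w := hdiff.apply_eq_apply_of_bounded
    (IsZLattice.isCompact_range_of_periodic L.lattice _ hdiff.continuous
      fun x y hy => hper x ⟨y, hy⟩).isBounded z w
  have hsz := hσ0 hz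
  have hσ00 : σ 0 = 0 := (weierstrassSigma_eq_zero_iff L 0).mpr (zero_mem _)
  simp only [h, if_neg hz, if_neg hw, sub_self, hσ00, mul_zero, zero_div, zero_add] at hconst
  field_simp at hconst
  linear_combination hconst

/-- `℘'(z) = -σ(2z) / σ(z)⁴`. -/
theorem derivWeierstrassP_eq_sigma {z : ℂ} (hz : z ∉ L.lattice) :
    ℘'[L] z = -(weierstrassSigma L (2 * z) / weierstrassSigma L z ^ 4) := by
  have hopen : IsOpen ((L.lattice : Set ℂ)ᶜ) := L.isClosed_lattice.isOpen_compl
  have hσ : Differentiable ℂ (weierstrassSigma L) := differentiable_weierstrassSigma L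
  have hσ0 : weierstrassSigma L z ≠ 0 := fun h => hz ((weierstrassSigma_eq_zero_iff L z).mp h)
  have hP : HasDerivAt ℘[L] (℘'[L] z) z := by
    have := ((L.differentiableOn_weierstrassP z hz).differentiableAt
      (hopen.mem_nhds hz)).hasDerivAt
    rwa [L.deriv_weierstrassP] at this
  -- The product formula for σ(x+z)σ(x-z) is differentiated at x = z. There σ(x - z) vanishes with
  -- derivative 1, so only σ(2z) survives on the left.
  have hsub : HasDerivAt (fun x => weierstrassSigma L (x - z)) 1 z := by
    have h0 : HasDerivAt (weierstrassSigma L) 1 (z - z) := by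
      rw [sub_self, ← deriv_weierstrassSigma_zero L]
      exact (hσ 0).hasDerivAt
    exact h0.comp_sub_const z z
  have hadd : HasDerivAt (fun x => weierstrassSigma L (x + z))
      (deriv (weierstrassSigma L) (z + z)) z := ((hσ (z + z)).hasDerivAt).comp_add_const z z
  have hL := hadd.fun_mul hsub
  have hR := (hP.const_sub (℘[L] z)).fun_mul
    (((hσ z).hasDerivAt.fun_pow 2).mul_const (weierstrassSigma L z ^ 2))
  have heq : (fun x => weierstrassSigma L (x + z) * weierstrassSigma L (x - z)) =ᶠ[𝓝 z]
      fun x => (℘[L] z - ℘[L] x) * (weierstrassSigma L x ^ 2 * weierstrassSigma L z ^ 2) := by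
    filter_upwards [hopen.mem_nhds hz] with x hx
    exact weierstrassSigma_add_mul_sub L hx hz
  have := (hL.congr_of_eventuallyEq heq.symm).unique hR
  have hσ00 : weierstrassSigma L 0 = 0 := (weierstrassSigma_eq_zero_iff L 0).mpr (zero_mem _)
  simp only [sub_self, hσ00, mul_zero, zero_mul, zero_add, add_zero, mul_one] at this
  rw [two_mul, this]
  field_simp

theorem weierstrassP_eq_iff {z w : ℂ} (hz : z ∉ L.lattice) (hw : w ∉ L.lattice)
    (h : ℘[L] z = ℘[L] w) : z + w ∈ L.lattice ∨ z - w ∈ L.lattice := by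
  have := weierstrassSigma_add_mul_sub L hz hw
  rw [h, sub_self, zero_mul, mul_eq_zero, weierstrassSigma_eq_zero_iff,
    weierstrassSigma_eq_zero_iff] at this
  exact this

theorem derivWeierstrassP_ne_zero {z : ℂ} (hz : 2 * z ∉ L.lattice) : ℘'[L] z ≠ 0 := by
  have hz' : z ∉ L.lattice := fun h => hz (by rw [two_mul]; exact add_mem h h)
  rw [derivWeierstrassP_eq_sigma L hz', neg_ne_zero]
  refine div_ne_zero ?_ (pow_ne_zero _ ?_) <;>
  · rw [Ne, weierstrassSigma_eq_zero_iff]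
    assumption

end Sigma

/-! ### A lattice is determined by `g₂` and `g₃` -/

section Invariants

open Filter PeriodPair

variable {L₁ L₂ : PeriodPair}

/-- An analytic solution at `0` of `z δ' A = δ B` with `A(0) = -4`, `B(0) = 12` vanishes. -/
theorem eventually_eq_zero_of_id_mul_deriv_mul_eq {δ A B : ℂ → ℂ} (hδ : AnalyticAt ℂ δ 0)
    (hA : ContinuousAt A 0) (hB : ContinuousAt B 0) (hA0 : A 0 = -4) (hB0 : B 0 = 12)
    (h : ∀ᶠ z in 𝓝[≠] 0, z * deriv δ z * A z = δ z * B z) : ∀ᶠ z in 𝓝 0, δ z = 0 := by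
  by_contra hne
  obtain ⟨n, u, hu, hu0, hδu⟩ := hδ.exists_eventuallyEq_pow_smul_nonzero_iff.mpr hne
  simp only [sub_zero, smul_eq_mul] at hδu
  have hder : ∀ᶠ z in 𝓝 (0 : ℂ), z * deriv δ z = z ^ n * (n * u z + z * deriv u z) := by
    filter_upwards [hδu.eventually_nhds, hu.eventually_analyticAt] with z hz huz
    rw [Filter.EventuallyEq.deriv_eq hz]
    have h1 := ((hasDerivAt_id' z).fun_pow n).fun_mul huz.differentiableAt.hasDerivAt
    rw [h1.deriv]
    rcases n with _ | n
    · simp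
    · simp only [Nat.add_sub_cancel]
      ring
  have hG : ContinuousAt (fun z => (n * u z + z * deriv u z) * A z - u z * B z) 0 := by
    have h1 := hu.continuousAt
    have h2 := hu.deriv.continuousAt
    fun_prop
  have hG0 : ∀ᶠ z in 𝓝[≠] (0 : ℂ), (n * u z + z * deriv u z) * A z - u z * B z = 0 := by
    filter_upwards [h, hder.filter_mono nhdsWithin_le_nhds, hδu.filter_mono nhdsWithin_le_nhds,
      self_mem_nhdsWithin] with z h1 h2 h3 hz
    have hz' : z ^ n ≠ 0 := pow_ne_zero _ hz
    refine mul_left_cancel₀ hz' ?_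
    rw [h2, h3] at h1
    linear_combination h1
  have hlim := tendsto_nhds_unique (hG.tendsto.mono_left nhdsWithin_le_nhds)
    (tendsto_const_nhds.congr' (hG0.mono fun z hz => hz.symm))
  simp only [zero_mul, add_zero, hA0, hB0] at hlim
  -- For δ = zⁿu with u(0) ≠ 0, comparing leading coefficients gives -4n = 12, impossible for n ≥ 0.
  have : ((n : ℂ) + 3) * u 0 = 0 := by linear_combination (-1 / 4) * hlim
  rcases mul_eq_zero.mp this with h' | h'
  · have : ((n + 3 : ℕ) : ℂ) = 0 := by exact_mod_cast h'
    rw [Nat.cast_eq_zero] at this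
    omega
  · exact hu0 h'

/-- Subtracting the two differential equations, δ = ℘₁ - ℘₂ satisfies δ'(℘₁' + ℘₂') = δ(4(℘₁² + ℘₁℘₂
+ ℘₂²) - g₂). The double poles cancel in δ, and multiplying by z⁴ removes the remaining ones; the
leading coefficients -4 and 12 come from -2/z³ and 1/z². -/
theorem weierstrassP_eventuallyEq (h2 : L₁.g₂ = L₂.g₂) (h3 : L₁.g₃ = L₂.g₃) :
    ∀ᶠ z in 𝓝[≠] (0 : ℂ), ℘[L₁] z = ℘[L₂] z := by
  have hex (L : PeriodPair) {z : ℂ} : ℘[L] z = ℘[L - (0 : ℂ)] z + 1 / z ^ 2 := by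
    have e := L.weierstrassPExcept_def 0 z
    simp only [ZeroMemClass.coe_zero] at e
    rw [e]
    simp
  have hex' (L : PeriodPair) {z : ℂ} : ℘'[L] z = ℘'[L - (0 : ℂ)] z - 2 / z ^ 3 := by
    have e := L.derivWeierstrassPExcept_def 0 z
    simp only [ZeroMemClass.coe_zero, sub_zero] at e
    rw [e]
    ring
  have hmem (L : PeriodPair) : ∀ᶠ z in 𝓝[≠] (0 : ℂ), z ∉ L.lattice := by
    filter_upwards [(L.compl_lattice_sdiff_singleton_mem_nhds 0 |> mem_nhdsWithin_of_mem_nhds),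
      self_mem_nhdsWithin] with z hz hz0
    simp only [Set.mem_compl_iff, Set.mem_sdiff, SetLike.mem_coe, Set.mem_singleton_iff] at hz hz0
    tauto
  have han (L : PeriodPair) := L.analyticAt_weierstrassPExcept 0
  have hc (L : PeriodPair) := (han L).continuousAt
  have hc' (L : PeriodPair) := (L.analyticAt_derivWeierstrassPExcept 0).continuousAt
  have hc1 := hc L₁
  have hc2 := hc L₂
  have hc1' := hc' L₁
  have hc2' := hc' L₂
  have hδ := eventually_eq_zero_of_id_mul_deriv_mul_eq (δ := ℘[L₁ - (0 : ℂ)] - ℘[L₂ - (0 : ℂ)])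
    (A := fun z => z ^ 3 * (℘'[L₁ - (0 : ℂ)] z + ℘'[L₂ - (0 : ℂ)] z) - 4)
    (B := fun z => 4 * ((z ^ 2 * ℘[L₁ - (0 : ℂ)] z + 1) ^ 2 +
      (z ^ 2 * ℘[L₁ - (0 : ℂ)] z + 1) * (z ^ 2 * ℘[L₂ - (0 : ℂ)] z + 1) +
      (z ^ 2 * ℘[L₂ - (0 : ℂ)] z + 1) ^ 2) - L₁.g₂ * z ^ 4)
    ((han L₁).sub (han L₂)) (by fun_prop) (by fun_prop) (by norm_num) (by norm_num) ?_
  · filter_upwards [hδ.filter_mono nhdsWithin_le_nhds] with z hz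
    rw [hex, hex, sub_eq_zero.mp hz]
  · filter_upwards [hmem L₁, hmem L₂, self_mem_nhdsWithin,
      (han L₁).eventually_analyticAt.filter_mono nhdsWithin_le_nhds,
      (han L₂).eventually_analyticAt.filter_mono nhdsWithin_le_nhds] with z hz1 hz2 hz0 ha1 ha2
    have hz0 : z ≠ 0 := hz0
    have e1 := L₁.derivWeierstrassP_sq z hz1
    have e2 := L₂.derivWeierstrassP_sq z hz2
    rw [hex, hex'] at e1 e2
    rw [← h2, ← h3] at e2
    rw [deriv_sub ha1.differentiableAt ha2.differentiableAt,
      L₁.eqOn_deriv_weierstrassPExcept_derivWeierstrassPExcept 0 (by simp [hz1]),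
      L₂.eqOn_deriv_weierstrassPExcept_derivWeierstrassPExcept 0 (by simp [hz2])]
    simp only [Pi.sub_apply]
    field_simp at e1 e2 ⊢
    have hz3 : z ^ 3 ≠ 0 := pow_ne_zero _ hz0
    have hz4 : z ^ 2 ≠ 0 := pow_ne_zero _ hz0
    refine mul_left_cancel₀ hz4 ?_
    linear_combination e1 - e2

/-- The identity theorem spreads the local equality of the ℘-functions over the connected complement
of both lattices. A point of L₁ outside L₂ would then be a double pole of one function and a regular
point of the other. -/
theorem lattice_le_of_invariants_eq (h2 : L₁.g₂ = L₂.g₂) (h3 : L₁.g₃ = L₂.g₃) :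
    L₁.lattice ≤ L₂.lattice := by
  intro l hl1
  by_contra hl2
  let U : Set ℂ := ((L₁.lattice : Set ℂ) ∪ L₂.lattice)ᶜ
  have hU : IsPreconnected U := by
    have c1 : (L₁.lattice : Set ℂ).Countable := countable_of_Lindelof_of_discrete (X := L₁.lattice)
    have c2 : (L₂.lattice : Set ℂ).Countable := countable_of_Lindelof_of_discrete (X := L₂.lattice)
    exact ((c1.union c2).isConnected_compl_of_one_lt_rank (by simp)).isPreconnected
  have hU1 : U ⊆ (L₁.lattice : Set ℂ)ᶜ := Set.compl_subset_compl.mpr Set.subset_union_left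
  have hU2 : U ⊆ (L₂.lattice : Set ℂ)ᶜ := Set.compl_subset_compl.mpr Set.subset_union_right
  have hUopen : IsOpen U := (L₁.isClosed_lattice.union L₂.isClosed_lattice).isOpen_compl
  have hUnhds (x : ℂ) : ∀ᶠ z in 𝓝[≠] x, z ∈ U := by
    filter_upwards [mem_nhdsWithin_of_mem_nhds (L₁.compl_lattice_sdiff_singleton_mem_nhds x),
      mem_nhdsWithin_of_mem_nhds (L₂.compl_lattice_sdiff_singleton_mem_nhds x),
      self_mem_nhdsWithin] with z h1 h2 hz
    simp only [Set.mem_compl_iff, Set.mem_sdiff, SetLike.mem_coe, Set.mem_singleton_iff, U,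
      Set.mem_union] at h1 h2 hz ⊢
    tauto
  obtain ⟨z₀, hz₀U, hz₀⟩ := ((hUnhds 0).and
    ((eventually_eventually_nhdsWithin.mpr (weierstrassP_eventuallyEq h2 h3)).and
      self_mem_nhdsWithin)).exists
  rw [(isOpen_compl_singleton (x := (0 : ℂ))).nhdsWithin_eq hz₀.2] at hz₀
  have heq : Set.EqOn ℘[L₁] ℘[L₂] U :=
    (L₁.analyticOnNhd_weierstrassP.mono hU1).eqOn_of_preconnected_of_eventuallyEq
      (L₂.analyticOnNhd_weierstrassP.mono hU2) hU hz₀U hz₀.1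
  have hord : meromorphicOrderAt ℘[L₁] l = meromorphicOrderAt ℘[L₂] l :=
    meromorphicOrderAt_congr ((hUnhds l).mono fun z hz => heq hz)
  rw [L₁.order_weierstrassP l hl1] at hord
  have := (L₂.analyticOnNhd_weierstrassP l hl2).meromorphicOrderAt_nonneg
  rw [← hord] at this
  exact absurd this (by decide)

theorem lattice_eq_of_invariants_eq (h2 : L₁.g₂ = L₂.g₂) (h3 : L₁.g₃ = L₂.g₃) :
    L₁.lattice = L₂.lattice :=
  le_antisymm (lattice_le_of_invariants_eq h2 h3) (lattice_le_of_invariants_eq h2.symm h3.symm)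

end Invariants

/-! ### Homotheties of lattices -/

section Homothety

open PeriodPair

variable {L₁ L₂ : PeriodPair} {c : ℂ}

/-- The homothety `l ↦ c l` from `L₁` onto `L₂`. -/
def latticeEquivOfHomothety (hc : c ≠ 0) (h : ∀ z, c * z ∈ L₂.lattice ↔ z ∈ L₁.lattice) :
    L₁.lattice ≃ L₂.lattice where
  toFun l := ⟨c * l, (h l).mpr l.2⟩
  invFun l := ⟨c⁻¹ * l, (h _).mp (by rw [mul_inv_cancel_left₀ hc]; exact l.2)⟩
  left_inv l := Subtype.ext (inv_mul_cancel_left₀ hc _)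
  right_inv l := Subtype.ext (mul_inv_cancel_left₀ hc _)

theorem latticeEquivOfHomothety_coe (hc : c ≠ 0) (h : ∀ z, c * z ∈ L₂.lattice ↔ z ∈ L₁.lattice)
    (l : L₁.lattice) : (latticeEquivOfHomothety hc h l : ℂ) = c * l := rfl

theorem G_of_homothety (hc : c ≠ 0) (h : ∀ z, c * z ∈ L₂.lattice ↔ z ∈ L₁.lattice) (n : ℕ) :
    L₁.G n = c ^ n * L₂.G n := by
  unfold PeriodPair.G
  rw [← (latticeEquivOfHomothety hc h).tsum_eq, ← tsum_mul_left]
  refine tsum_congr fun l => ?_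
  rw [latticeEquivOfHomothety_coe, mul_pow, mul_inv, mul_inv_cancel_left₀ (pow_ne_zero _ hc)]

theorem g₂_of_homothety (hc : c ≠ 0) (h : ∀ z, c * z ∈ L₂.lattice ↔ z ∈ L₁.lattice) :
    L₁.g₂ = c ^ 4 * L₂.g₂ := by
  rw [g₂, g₂, G_of_homothety hc h]; ring

theorem g₃_of_homothety (hc : c ≠ 0) (h : ∀ z, c * z ∈ L₂.lattice ↔ z ∈ L₁.lattice) :
    L₁.g₃ = c ^ 6 * L₂.g₃ := by
  rw [g₃, g₃, G_of_homothety hc h]; ring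

theorem weierstrassP_of_homothety (hc : c ≠ 0) (h : ∀ z, c * z ∈ L₂.lattice ↔ z ∈ L₁.lattice)
    (z : ℂ) : ℘[L₁] z = c ^ 2 * ℘[L₂] (c * z) := by
  unfold weierstrassP
  rw [← (latticeEquivOfHomothety hc h).tsum_eq, ← tsum_mul_left]
  refine tsum_congr fun l => ?_
  rw [latticeEquivOfHomothety_coe, ← mul_sub, mul_pow, mul_pow]
  field_simp

theorem derivWeierstrassP_of_homothety (hc : c ≠ 0)
    (h : ∀ z, c * z ∈ L₂.lattice ↔ z ∈ L₁.lattice) (z : ℂ) :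
    ℘'[L₁] z = c ^ 3 * ℘'[L₂] (c * z) := by
  unfold derivWeierstrassP
  rw [← (latticeEquivOfHomothety hc h).tsum_eq, mul_neg, ← tsum_mul_left]
  congr 1
  refine tsum_congr fun l => ?_
  rw [latticeEquivOfHomothety_coe, ← mul_sub, mul_pow]
  field_simp

/-- The lattice `c L`. -/
def scaledLattice (L : PeriodPair) (c : ℂ) (hc : c ≠ 0) : PeriodPair where
  ω₁ := c * L.ω₁
  ω₂ := c * L.ω₂
  indep := by
    have := L.indep
    rw [LinearIndependent.pair_iff] at this ⊢
    intro s t hst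
    refine this s t (mul_left_cancel₀ hc ?_)
    rw [mul_zero, ← hst]
    simp only [Complex.real_smul]
    ring

theorem mem_scaledLattice (L : PeriodPair) (hc : c ≠ 0) (z : ℂ) :
    c * z ∈ (scaledLattice L c hc).lattice ↔ z ∈ L.lattice := by
  simp only [mem_lattice, scaledLattice]
  refine exists_congr fun m => exists_congr fun n => ?_
  rw [← mul_right_inj' hc (c := z)]
  constructor <;> intro h <;> linear_combination h

/-- Lattices whose invariants are related as those of homothetic lattices are homothetic. -/
theorem homothety_of_invariants (hc : c ≠ 0) (h2 : L₁.g₂ = c ^ 4 * L₂.g₂)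
    (h3 : L₁.g₃ = c ^ 6 * L₂.g₃) (z : ℂ) : c * z ∈ L₂.lattice ↔ z ∈ L₁.lattice := by
  have hs := mem_scaledLattice L₁ hc
  have e2 := g₂_of_homothety hc hs
  have e3 := g₃_of_homothety hc hs
  rw [← lattice_eq_of_invariants_eq (L₁ := scaledLattice L₁ c hc) (L₂ := L₂)
    (mul_left_cancel₀ (pow_ne_zero 4 hc) (e2.symm.trans h2))
    (mul_left_cancel₀ (pow_ne_zero 6 hc) (e3.symm.trans h3))]
  exact hs z

end Homothety

/-! ### The lattices `[τ, 1]` -/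

section LatticeOf

open PeriodPair

theorem mem_latticeOf {τ : ℍ} {z : ℂ} :
    z ∈ (latticeOf τ).lattice ↔ ∃ m n : ℤ, (m : ℂ) * τ + n = z := by
  simp [mem_lattice, latticeOf]

/-- The automorphy factor `c τ + d`. -/
def autFactor (γ : SL(2, ℤ)) (τ : ℍ) : ℂ := (γ 1 0 : ℂ) * τ + (γ 1 1 : ℂ)

theorem autFactor_eq_denom (γ : SL(2, ℤ)) (τ : ℍ) : autFactor γ τ = UpperHalfPlane.denom γ τ := by
  simp [autFactor, ModularGroup.denom_apply]

theorem autFactor_ne_zero (γ : SL(2, ℤ)) (τ : ℍ) : autFactor γ τ ≠ 0 := by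
  rw [autFactor_eq_denom]
  exact UpperHalfPlane.denom_ne_zero _ _

theorem coe_smul_eq (γ : SL(2, ℤ)) (τ : ℍ) :
    ((γ • τ : ℍ) : ℂ) = ((γ 0 0 : ℂ) * τ + (γ 0 1 : ℂ)) / autFactor γ τ := by
  rw [UpperHalfPlane.coe_specialLinearGroup_apply]
  simp [autFactor]

theorem det_eq_one (γ : SL(2, ℤ)) : γ 0 0 * γ 1 1 - γ 0 1 * γ 1 0 = 1 := by
  rw [← Matrix.det_fin_two]
  exact γ.det_coe

theorem autFactor_mul (γ δ : SL(2, ℤ)) (τ : ℍ) :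
    autFactor (γ * δ) τ = autFactor γ (δ • τ) * autFactor δ τ := by
  have h := autFactor_ne_zero δ τ
  rw [autFactor, autFactor, coe_smul_eq]
  simp only [Matrix.SpecialLinearGroup.coe_mul, Matrix.mul_apply, Fin.sum_univ_two]
  rw [add_mul, mul_assoc, div_mul_cancel₀ _ h, autFactor]
  push_cast
  ring

theorem mem_latticeOf_smul (γ : SL(2, ℤ)) (τ : ℍ) (z : ℂ) :
    autFactor γ τ * z ∈ (latticeOf τ).lattice ↔ z ∈ (latticeOf (γ • τ)).lattice := by
  have h := autFactor_ne_zero γ τ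
  have hdet : (γ 0 0 : ℂ) * γ 1 1 - γ 0 1 * γ 1 0 = 1 := by exact_mod_cast det_eq_one γ
  rw [mem_latticeOf, mem_latticeOf]
  constructor
  · rintro ⟨m, n, hmn⟩
    refine ⟨m * γ 1 1 - n * γ 1 0, n * γ 0 0 - m * γ 0 1, mul_left_cancel₀ h ?_⟩
    rw [← hmn, coe_smul_eq, mul_add, mul_left_comm, mul_div_cancel₀ _ h, autFactor]
    push_cast
    linear_combination (m * (τ : ℂ) + n) * hdet
  · rintro ⟨m, n, rfl⟩
    refine ⟨m * γ 0 0 + n * γ 1 0, m * γ 0 1 + n * γ 1 1, ?_⟩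
    rw [coe_smul_eq, mul_add, mul_left_comm, mul_div_cancel₀ _ h, autFactor]
    push_cast
    ring

theorem gTwo_smul (γ : SL(2, ℤ)) (τ : ℍ) : gTwo (γ • τ) = autFactor γ τ ^ 4 * gTwo τ :=
  g₂_of_homothety (autFactor_ne_zero γ τ) (mem_latticeOf_smul γ τ)

theorem gThree_smul (γ : SL(2, ℤ)) (τ : ℍ) : gThree (γ • τ) = autFactor γ τ ^ 6 * gThree τ :=
  g₃_of_homothety (autFactor_ne_zero γ τ) (mem_latticeOf_smul γ τ)

theorem discr_smul (γ : SL(2, ℤ)) (τ : ℍ) : discr (γ • τ) = autFactor γ τ ^ 12 * discr τ := by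
  rw [discr, discr, gTwo_smul, gThree_smul]
  ring

theorem weierstrassP_latticeOf_smul (γ : SL(2, ℤ)) (τ : ℍ) (z : ℂ) :
    ℘[latticeOf (γ • τ)] z = autFactor γ τ ^ 2 * ℘[latticeOf τ] (autFactor γ τ * z) :=
  weierstrassP_of_homothety (autFactor_ne_zero γ τ) (mem_latticeOf_smul γ τ) z

theorem derivWeierstrassP_latticeOf_smul (γ : SL(2, ℤ)) (τ : ℍ) (z : ℂ) :
    ℘'[latticeOf (γ • τ)] z = autFactor γ τ ^ 3 * ℘'[latticeOf τ] (autFactor γ τ * z) :=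
  derivWeierstrassP_of_homothety (autFactor_ne_zero γ τ) (mem_latticeOf_smul γ τ) z

/-- The usual formula for the imaginary part, for an integer matrix of unknown determinant; it will
be used to show that a change of basis has determinant 1. -/
theorem im_mul_normSq_of_eq {τ₁ τ₂ : ℍ} {a b c d : ℤ}
    (h : (τ₂ : ℂ) * ((c : ℂ) * τ₁ + d) = (a : ℂ) * τ₁ + b) :
    τ₂.im * Complex.normSq ((c : ℂ) * τ₁ + d) = (a * d - b * c) * τ₁.im := by
  have h' : (τ₂ : ℂ) * Complex.normSq ((c : ℂ) * τ₁ + d) =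
      ((a : ℂ) * τ₁ + b) * (starRingEnd ℂ) ((c : ℂ) * τ₁ + d) := by
    rw [Complex.normSq_eq_conj_mul_self, ← h]; ring
  have := congrArg Complex.im h'
  simp at this
  linear_combination this

/-- Homothetic lattices `[τ₁, 1]`, `[τ₂, 1]` have equivalent moduli. -/
theorem exists_smul_eq_of_homothety {τ₁ τ₂ : ℍ} {k : ℂ}
    (h : ∀ z, k * z ∈ (latticeOf τ₂).lattice ↔ z ∈ (latticeOf τ₁).lattice) :
    ∃ γ : SL(2, ℤ), τ₂ = γ • τ₁ ∧ k * autFactor γ τ₁ = 1 := by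
  -- With k = 0 every z would lie in [τ₁, 1], in particular half a period.
  have hk : k ≠ 0 := by
    rintro rfl
    have h1 := (h ((latticeOf τ₁).ω₁ / 2)).mp (by rw [zero_mul]; exact zero_mem _)
    exact (latticeOf τ₁).ω₁_div_two_notMem_lattice h1
  have hτ : k⁻¹ * τ₂ ∈ (latticeOf τ₁).lattice := by
    rw [← h, mul_inv_cancel_left₀ hk, mem_latticeOf]
    exact ⟨1, 0, by simp⟩
  have h1 : k⁻¹ * 1 ∈ (latticeOf τ₁).lattice := by
    rw [← h, mul_inv_cancel_left₀ hk, mem_latticeOf]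
    exact ⟨0, 1, by simp⟩
  have hτ' : k * τ₁ ∈ (latticeOf τ₂).lattice := by
    rw [h, mem_latticeOf]
    exact ⟨1, 0, by simp⟩
  have h1' : k * 1 ∈ (latticeOf τ₂).lattice := by
    rw [h, mem_latticeOf]
    exact ⟨0, 1, by simp⟩
  rw [mem_latticeOf] at hτ h1 hτ' h1'
  obtain ⟨a, b, hab⟩ := hτ
  obtain ⟨c, d, hcd⟩ := h1
  obtain ⟨a', b', hab'⟩ := hτ'
  obtain ⟨c', d', hcd'⟩ := h1'
  rw [mul_one] at hcd hcd'
  have e1 := im_mul_normSq_of_eq (τ₁ := τ₁) (τ₂ := τ₂) (a := a) (b := b) (c := c) (d := d)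
    (by rw [hcd, hab, mul_comm])
  have e2 := im_mul_normSq_of_eq (τ₁ := τ₂) (τ₂ := τ₁) (a := a') (b := b') (c := c') (d := d')
    (by rw [hcd', hab', mul_comm])
  rw [hcd] at e1
  rw [hcd'] at e2
  have hn : Complex.normSq k⁻¹ * Complex.normSq k = 1 := by
    rw [← Complex.normSq_mul, inv_mul_cancel₀ hk, Complex.normSq_one]
  have hp1 := τ₁.im_pos
  have hp2 := τ₂.im_pos
  have hkpos : 0 < Complex.normSq k⁻¹ := Complex.normSq_pos.mpr (inv_ne_zero hk)
  -- The two base changes scale the imaginary part by inverse amounts, so their determinants are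
  -- integers with product 1. Positivity of both imaginary parts excludes -1.
  have hdd : ((a * d - b * c) * (a' * d' - b' * c') : ℝ) = 1 := by
    have hne : τ₁.im * τ₂.im ≠ 0 := (mul_pos hp1 hp2).ne'
    refine mul_left_cancel₀ hne ?_
    linear_combination (τ₁.im * τ₂.im) * hn - (a' * d' - b' * c') * τ₂.im * e1
      - (τ₂.im * Complex.normSq k⁻¹) * e2
  have hddZ : (a * d - b * c) * (a' * d' - b' * c') = 1 := by exact_mod_cast hdd
  have hposR : (0 : ℝ) < (a * d - b * c) := by
    have : 0 < τ₂.im * Complex.normSq k⁻¹ := mul_pos hp2 hkpos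
    rw [e1] at this
    exact pos_of_mul_pos_left this hp1.le
  have hpos : 0 < a * d - b * c := by exact_mod_cast hposR
  have hdet : a * d - b * c = 1 := by
    rcases Int.eq_one_or_neg_one_of_mul_eq_one hddZ with h | h
    · exact h
    · omega
  let γ : SL(2, ℤ) := ⟨!![a, b; c, d], by rw [Matrix.det_fin_two_of]; exact hdet⟩
  have haut : autFactor γ τ₁ = k⁻¹ := by
    simpa [autFactor, γ] using hcd
  refine ⟨γ, ?_, by rw [haut, mul_inv_cancel₀ hk]⟩
  ext1
  rw [coe_smul_eq, haut]
  have : ((γ 0 0 : ℂ) * τ₁ + (γ 0 1 : ℂ)) = k⁻¹ * τ₂ := by simpa [γ] using hab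
  rw [this, mul_div_cancel_left₀ _ (inv_ne_zero hk)]

end LatticeOf

/-! ### Level-one Eisenstein series, the discriminant and the eta multiplier. -/

section ModularForms

open Complex Filter ModularForm EisensteinSeries

open UpperHalfPlane hiding I

open scoped Real Manifold

/-! ### Eisenstein series -/

theorem G_latticeOf {k : ℕ} (hk : 3 ≤ k) (τ : ℍ) :
    (latticeOf τ).G k = 2 * riemannZeta k * E hk τ := by
  have hE : E hk τ = (1 / 2 : ℂ) * eisensteinSeries (N := 1) 0 k τ := rfl
  rw [hE, show 2 * riemannZeta k * (1 / 2 * eisensteinSeries (N := 1) 0 k τ) =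
    riemannZeta k * eisensteinSeries (N := 1) 0 k τ by ring,
    ← tsum_eisSummand_eq_riemannZeta_mul_eisensteinSeries hk τ, PeriodPair.G,
    ← (latticeOf τ).latticeEquivProd.symm.toEquiv.tsum_eq, ← (finTwoArrowEquiv ℤ).tsum_eq]
  refine tsum_congr fun v => ?_
  have h := (latticeOf τ).latticeEquiv_symm_apply (finTwoArrowEquiv ℤ v)
  simp only [LinearEquiv.coe_toEquiv, h, eisSummand]
  simp [latticeOf, zpow_neg]

theorem gTwo_eq (τ : ℍ) : gTwo τ = 4 * π ^ 4 / 3 * E₄ τ := by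
  rw [gTwo, PeriodPair.g₂, G_latticeOf (k := 4) (by norm_num)]
  have h : riemannZeta (4 : ℕ) = π ^ 4 / 90 := by
    simpa using riemannZeta_four
  rw [h]
  ring

theorem riemannZeta_six : riemannZeta 6 = π ^ 6 / 945 := by
  have h := riemannZeta_two_mul_nat (k := 3) (by norm_num)
  norm_num at h
  rw [h, bernoulli_eq_bernoulli'_of_ne_one (by norm_num)]
  have : bernoulli' 6 = 1 / 42 := by
    rw [bernoulli'_def]
    norm_num [Finset.sum_range_succ, Nat.choose, bernoulli'_eq_zero_of_odd]
  rw [this]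
  norm_num [Nat.factorial]
  ring

theorem gThree_eq (τ : ℍ) : gThree τ = 8 * π ^ 6 / 27 * E₆ τ := by
  rw [gThree, PeriodPair.g₃, G_latticeOf (k := 6) (by norm_num)]
  have h : riemannZeta (6 : ℕ) = π ^ 6 / 945 := by
    simpa using riemannZeta_six
  rw [h]
  ring

theorem dedekindEta_ne_zero (τ : ℍ) : dedekindEta τ ≠ 0 := by
  refine mul_ne_zero (mul_ne_zero ?_ (exp_ne_zero _)) (eta_ne_zero τ.2)
  exact_mod_cast (Real.sqrt_pos.mpr Real.two_pi_pos).ne'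

theorem dedekindEta_pow (τ : ℍ) : dedekindEta τ ^ 24 = (2 * π) ^ 12 * discriminant τ := by
  have h1 : ((Real.sqrt (2 * π) : ℝ) : ℂ) ^ 24 = (2 * π) ^ 12 := by
    rw [show 24 = 2 * 12 by norm_num, pow_mul]
    norm_cast
    rw [Real.sq_sqrt Real.two_pi_pos.le]
  have h2 : exp (2 * π * I / 8) ^ 24 = 1 := by
    rw [← exp_nat_mul]
    convert exp_int_mul_two_pi_mul_I 3 using 2
    push_cast
    ring
  rw [dedekindEta, mul_pow, mul_pow, h1, h2, discriminant]
  ring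

theorem discr_eq (τ : ℍ) : discr τ = (2 * π) ^ 12 * discriminant τ := by
  rw [discr, gTwo_eq, gThree_eq, discriminant_eq_E₄_cube_sub_E₆_sq]
  ring

theorem dedekindEta_pow_eq_discr (τ : ℍ) : dedekindEta τ ^ 24 = discr τ := by
  rw [dedekindEta_pow, discr_eq]

theorem discr_ne_zero (τ : ℍ) : discr τ ≠ 0 := by
  rw [← dedekindEta_pow_eq_discr]
  exact pow_ne_zero _ (dedekindEta_ne_zero τ)

theorem tendsto_E {k : ℕ} (hk : 3 ≤ k) (hk2 : Even k) : Tendsto (E hk) atImInfty (𝓝 1) := by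
  have h1 : (1 : ℝ) ∈ (𝒮ℒ : Subgroup (GL (Fin 2) ℝ)).strictPeriods := by simp
  have hA := ModularFormClass.analyticAt_cuspFunction_zero (E hk) one_pos h1
  have h0 : cuspFunction 1 (E hk) 0 = 1 := by
    rw [← E_qExpansion_coeff_zero hk hk2, qExpansion_coeff]
    simp
  have h := hA.continuousAt.tendsto.comp (qParam_tendsto_atImInfty one_pos)
  rw [h0] at h
  refine h.congr fun τ => ?_
  simpa using SlashInvariantFormClass.eq_cuspFunction (E hk) τ h1 one_ne_zero

theorem tendsto_gTwo : Tendsto gTwo atImInfty (𝓝 (4 * π ^ 4 / 3)) := by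
  simpa [funext gTwo_eq] using (tendsto_E (k := 4) (by norm_num) ⟨2, rfl⟩).const_mul (4 * (π : ℂ) ^ 4 / 3)

theorem tendsto_gThree : Tendsto gThree atImInfty (𝓝 (8 * π ^ 6 / 27)) := by
  simpa [funext gThree_eq] using
    (tendsto_E (k := 6) (by norm_num) ⟨3, rfl⟩).const_mul (8 * (π : ℂ) ^ 6 / 27)

theorem tendsto_discr : Tendsto discr atImInfty (𝓝 0) := by
  have h : Tendsto discriminant atImInfty (𝓝 0) := discriminant_isZeroAtImInfty
  simpa [funext discr_eq] using h.const_mul ((2 * (π : ℂ)) ^ 12)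

/-- The decay is inherited from Δ = η²⁴ by taking 24th roots of absolute values. -/
theorem tendsto_dedekindEta : Tendsto dedekindEta atImInfty (𝓝 0) := by
  have h : Tendsto (fun τ => dedekindEta τ ^ 24) atImInfty (𝓝 0) := by
    simpa [dedekindEta_pow_eq_discr] using tendsto_discr
  rw [tendsto_zero_iff_norm_tendsto_zero] at h ⊢
  simp only [norm_pow] at h
  have h' := h.rpow_const (p := (1 / 24 : ℝ)) (by norm_num)
  rw [Real.zero_rpow (by norm_num)] at h'
  refine h'.congr fun τ => ?_
  rw [← Real.rpow_natCast, ← Real.rpow_mul (norm_nonneg _)]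
  norm_num

/-! ### Differentiability -/

theorem mdifferentiable_gTwo : MDiff gTwo := by
  have h : gTwo = (fun τ => 4 * π ^ 4 / 3 * E₄ τ) := funext gTwo_eq
  rw [h]
  exact mdifferentiable_const.mul (ModularFormClass.holo E₄)

theorem mdifferentiable_gThree : MDiff gThree := by
  have h : gThree = (fun τ => 8 * π ^ 6 / 27 * E₆ τ) := funext gThree_eq
  rw [h]
  exact mdifferentiable_const.mul (ModularFormClass.holo E₆)

theorem mdifferentiable_dedekindEta : MDiff dedekindEta := by
  rw [UpperHalfPlane.mdifferentiable_iff]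
  refine DifferentiableOn.congr (f := fun z => (Real.sqrt (2 * π) : ℂ) * exp (2 * π * I / 8) *
    ModularForm.eta z) (fun z hz => ?_) fun z hz => ?_
  · exact ((differentiableAt_eta_of_mem_upperHalfPlaneSet hz).const_mul _).differentiableWithinAt
  · simp [dedekindEta, ofComplex_apply_of_im_pos hz]

/-! ### The multiplier of the sixth power of the eta function -/

/-- The exponent of the multiplier of `η⁶`, as a function of a matrix modulo `4`. -/
def etaExponent (a b c d : ZMod 4) : ZMod 4 :=
  (1 - c ^ 2) * (b * d + 3 * (c - 1) * d + c + 3) + c * (a + d - 3)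

/-- A finite check over SL₂(ℤ/4). Left multiplication by T and by S both raise the exponent by 1,
which pins down the multiplier since T and S generate. -/
theorem etaExponent_T : ∀ a b c d : ZMod 4, a * d - b * c = 1 →
    etaExponent (a + c) (b + d) c d = etaExponent a b c d + 1 := by
  decide

theorem etaExponent_S : ∀ a b c d : ZMod 4, a * d - b * c = 1 →
    etaExponent (-c) (-d) a b = etaExponent a b c d + 1 := by
  decide

/-- The multiplier of `η⁶`. -/
def etaChar (γ : SL(2, ℤ)) : ℂ := I ^ (etaExponent (γ 0 0) (γ 0 1) (γ 1 0) (γ 1 1)).val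

theorem I_pow_val_add_one (x : ZMod 4) : I ^ (x + 1).val = I * I ^ x.val := by
  have h : (x + 1).val = x.val + 1 ∨ ((x + 1).val = 0 ∧ x.val = 3) := by
    revert x; decide
  rcases h with h | ⟨h, h'⟩
  · rw [h, pow_succ']
  · rw [h, h', ← pow_succ', I_pow_four, pow_zero]

theorem etaChar_ne_zero (γ : SL(2, ℤ)) : etaChar γ ≠ 0 := pow_ne_zero _ I_ne_zero

theorem det_zmod_four (γ : SL(2, ℤ)) :
    (γ 0 0 : ZMod 4) * (γ 1 1 : ℤ) - (γ 0 1 : ℤ) * (γ 1 0 : ℤ) = 1 := by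
  have h := det_eq_one γ
  exact_mod_cast congrArg (Int.cast : ℤ → ZMod 4) h

theorem etaChar_T_mul (γ : SL(2, ℤ)) : etaChar (ModularGroup.T * γ) = I * etaChar γ := by
  rw [etaChar, etaChar, ← I_pow_val_add_one, ← etaExponent_T _ _ _ _ (det_zmod_four γ)]
  simp [Matrix.SpecialLinearGroup.coe_mul, ModularGroup.coe_T, Matrix.mul_apply, Fin.sum_univ_two]

theorem etaChar_S_mul (γ : SL(2, ℤ)) : etaChar (ModularGroup.S * γ) = I * etaChar γ := by
  rw [etaChar, etaChar, ← I_pow_val_add_one, ← etaExponent_S _ _ _ _ (det_zmod_four γ)]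
  simp [Matrix.SpecialLinearGroup.coe_mul, ModularGroup.coe_S, Matrix.mul_apply, Fin.sum_univ_two]

theorem etaChar_one : etaChar 1 = 1 := by
  have : etaExponent 1 0 0 1 = 0 := by decide
  simp [etaChar, this]

theorem dedekindEta_pow_six_T (τ : ℍ) :
    dedekindEta (ModularGroup.T • τ) ^ 6 = I * dedekindEta τ ^ 6 := by
  have h : ((ModularGroup.T • τ : ℍ) : ℂ) = τ + 1 := by
    rw [modular_T_smul]; simp [add_comm]
  have h' : ModularForm.eta (τ + 1) = exp (2 * π * I / 24) * ModularForm.eta τ := by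
    rw [ModularForm.eta, ModularForm.eta, ← mul_assoc]
    congr 1
    · rw [Function.Periodic.qParam, Function.Periodic.qParam, ← exp_add]
      congr 1
      push_cast
      ring
    · refine tprod_congr fun n => ?_
      rw [eta_q_eq_pow, eta_q_eq_pow, mul_add, exp_add, mul_one, exp_two_pi_mul_I, mul_one]
  have h6 : exp (2 * π * I / 24) ^ 6 = I := by
    rw [← exp_nat_mul]
    convert exp_pi_div_two_mul_I using 2
    push_cast
    ring
  rw [dedekindEta, dedekindEta, h, h', mul_pow, mul_pow, mul_pow, h6]
  ring

theorem dedekindEta_pow_six_S (τ : ℍ) :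
    dedekindEta (ModularGroup.S • τ) ^ 6 = I * (τ : ℂ) ^ 3 * dedekindEta τ ^ 6 := by
  have h6 {z : ℂ} (hz : z ≠ 0) : Complex.sqrt z ^ 6 = z ^ 3 := by
    rw [sqrt_eq_exp hz, ← exp_nat_mul]
    ring_nf
    rw [show log z * 3 = (3 : ℕ) * log z by push_cast; ring, exp_nat_mul, exp_log hz]
  have h := eta_comp_eq_csqrt_I_inv τ.2
  have h' : ((ModularGroup.S • τ : ℍ) : ℂ) = -1 / τ := by
    rw [modular_S_smul]; simp [neg_div, inv_neg]
  have hI : (I ^ 3)⁻¹ = I := by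
    rw [I_pow_three]; simp
  simp only [Function.comp_apply, Pi.smul_apply, Pi.mul_apply, smul_eq_mul] at h
  rw [dedekindEta, dedekindEta, h', h]
  simp only [mul_pow, inv_pow, h6 I_ne_zero, h6 τ.ne_zero, hI]
  ring

theorem autFactor_T (τ : ℍ) : autFactor ModularGroup.T τ = 1 := by
  simp [autFactor, ModularGroup.T]

theorem autFactor_S (τ : ℍ) : autFactor ModularGroup.S τ = τ := by
  simp [autFactor, ModularGroup.S]

theorem dedekindEta_pow_six_generator {s : SL(2, ℤ)}
    (hs : s ∈ ({ModularGroup.S, ModularGroup.T} : Set SL(2, ℤ))) (τ : ℍ) :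
    dedekindEta (s • τ) ^ 6 = I * autFactor s τ ^ 3 * dedekindEta τ ^ 6 := by
  rcases hs with rfl | rfl
  · rw [dedekindEta_pow_six_S, autFactor_S]
  · rw [dedekindEta_pow_six_T, autFactor_T]; ring

theorem etaChar_generator_mul {s : SL(2, ℤ)}
    (hs : s ∈ ({ModularGroup.S, ModularGroup.T} : Set SL(2, ℤ))) (γ : SL(2, ℤ)) :
    etaChar (s * γ) = I * etaChar γ := by
  rcases hs with rfl | rfl
  · exact etaChar_S_mul γ
  · exact etaChar_T_mul γ

/-- Induction on a word in S and T: the factor (cτ+d)³ is a cocycle, and each generator contributes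
the same constant `I` to both sides. -/
theorem dedekindEta_pow_six_smul (γ : SL(2, ℤ)) (τ : ℍ) :
    dedekindEta (γ • τ) ^ 6 = etaChar γ * autFactor γ τ ^ 3 * dedekindEta τ ^ 6 := by
  have hγ : γ ∈ Subgroup.closure {ModularGroup.S, ModularGroup.T} := by
    simp [SpecialLinearGroup.SL2Z_generators]
  induction hγ using Subgroup.closure_induction_left with
  | one => simp [etaChar_one, autFactor]
  | mul_left s hs γ hγ ih =>
    rw [mul_smul, dedekindEta_pow_six_generator hs, ih, etaChar_generator_mul hs, autFactor_mul]
    ring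
  | inv_mul_cancel s hs γ hγ ih =>
    have h1 := dedekindEta_pow_six_generator hs ((s⁻¹ * γ) • τ)
    have h2 := etaChar_generator_mul hs (s⁻¹ * γ)
    have h3 := autFactor_mul s (s⁻¹ * γ) τ
    rw [← mul_smul] at h1
    rw [mul_inv_cancel_left] at h1 h2 h3
    have h0 := autFactor_ne_zero s ((s⁻¹ * γ) • τ)
    rw [ih, h2, h3] at h1
    have : I * autFactor s ((s⁻¹ * γ) • τ) ^ 3 ≠ 0 := mul_ne_zero I_ne_zero (pow_ne_zero _ h0)
    refine mul_left_cancel₀ this ?_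
    linear_combination -h1

/-- On such matrices the multiplier detects exactly the upper right entry mod 4. This is how the
coordinate y sees the level-4 condition. -/
theorem etaChar_of_upper {γ : SL(2, ℤ)} (h0 : (γ 0 0 : ZMod 4) = 1) (h1 : (γ 1 0 : ZMod 4) = 0)
    (h2 : (γ 1 1 : ZMod 4) = 1) : etaChar γ = I ^ (γ 0 1 : ZMod 4).val := by
  rw [etaChar, h0, h1, h2]
  congr 2
  generalize (γ 0 1 : ZMod 4) = x
  revert x
  decide

theorem etaChar_of_mem_Gamma {γ : SL(2, ℤ)} (h : γ ∈ CongruenceSubgroup.Gamma 4) :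
    etaChar γ = 1 := by
  rw [CongruenceSubgroup.Gamma_mem] at h
  obtain ⟨h1, h2, h3, h4⟩ := h
  rw [etaChar_of_upper h1 h3 h4, h2]
  simp

theorem I_pow_val_eq_one {x : ZMod 4} (h : I ^ x.val = 1) : x = 0 := by
  have : x.val = 0 ∨ x.val = 1 ∨ x.val = 2 ∨ x.val = 3 := by
    clear h; revert x; decide
  rcases this with h' | h' | h' | h' <;> rw [h'] at h
  · exact (ZMod.val_eq_zero x).mp h'
  · simp [Complex.ext_iff] at h
  · norm_num at h
  · rw [I_pow_three] at h; simp [Complex.ext_iff] at h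

end ModularForms

/-! ### The derivative of v via the Serre derivative of E₆. -/

section Derivative

open Complex Filter ModularForm EisensteinSeries Derivative

open UpperHalfPlane hiding I

open scoped Real Manifold

/-- Cauchy's estimate on a disc of radius 1. -/
theorem isBoundedAtImInfty_normalizedDeriv {F : ℍ → ℂ} (hF : MDiff F)
    (hb : IsBoundedAtImInfty F) : IsBoundedAtImInfty (normalizedDerivOfComplex F) := by
  rw [isBoundedAtImInfty_iff] at hb ⊢
  obtain ⟨M, A, h⟩ := hb
  rw [UpperHalfPlane.mdifferentiable_iff] at hF
  -- From this height on, the closed unit disc around z lies in the upper half-plane and in the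
  -- region where F is bounded by M.
  refine ⟨‖(2 * π * I : ℂ)⁻¹‖ * M, max A 0 + 2, fun z hz => ?_⟩
  have him : ∀ w ∈ Metric.closedBall (z : ℂ) 1, max A 0 + 1 ≤ w.im := fun w hw => by
    have h1 : |(w - z).im| ≤ 1 := (abs_im_le_norm _).trans (by simpa [Complex.dist_eq] using hw)
    have h2 := (abs_le.mp h1).1
    simp only [sub_im, coe_im] at h2
    linarith
  rw [normalizedDerivOfComplex, norm_mul]
  refine mul_le_mul_of_nonneg_left ?_ (norm_nonneg _)
  rw [← div_one M]
  refine norm_deriv_le_of_forall_mem_sphere_norm_le one_pos ?_ fun w hw => ?_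
  · refine (hF.mono fun w hw => ?_).diffContOnCl_ball (U := Metric.closedBall (z : ℂ) 1) subset_rfl
    exact lt_of_lt_of_le (by positivity) (him w hw)
  · have hw' := him w (Metric.sphere_subset_closedBall hw)
    have hpos : 0 < w.im := lt_of_lt_of_le (by positivity) hw'
    rw [Function.comp_apply, ofComplex_apply_of_im_pos hpos]
    refine h _ ?_
    change A ≤ w.im
    linarith [le_max_left A 0]

/-- The Serre derivative of `E₆`, a modular form of weight `8`. -/
def serreDerivESix : ModularForm 𝒮ℒ 8 where
  toFun := serreDerivative 6 E₆
  slash_action_eq' A hA := by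
    obtain ⟨γ, rfl⟩ := hA
    have hF : MDiff (E₆ : ℍ → ℂ) := ModularFormClass.holo E₆
    have h6 : (E₆ : ℍ → ℂ) ∣[(6 : ℤ)] γ = E₆ := E₆.slash_action_eq' _ ⟨γ, rfl⟩
    exact_mod_cast serreDerivative_slash_invariant (k := 6) hF h6
  holo' := serreDerivative_mdifferentiable _ (ModularFormClass.holo E₆)
  bdd_at_cusps' {c} hc := by
    rw [Subgroup.IsArithmetic.isCusp_iff_isCusp_SL2Z] at hc
    rw [OnePoint.isBoundedAt_iff_forall_SL2Z hc]
    intro γ _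
    have hF : MDiff (E₆ : ℍ → ℂ) := ModularFormClass.holo E₆
    have h6 : (E₆ : ℍ → ℂ) ∣[(6 : ℤ)] γ = E₆ := E₆.slash_action_eq' _ ⟨γ, rfl⟩
    have h8 : serreDerivative 6 E₆ ∣[(8 : ℤ)] γ = serreDerivative 6 E₆ := by
      exact_mod_cast serreDerivative_slash_invariant (k := 6) hF h6
    rw [h8]
    have hb : IsBoundedAtImInfty (E₆ : ℍ → ℂ) := ModularFormClass.bdd_at_infty E₆
    refine Asymptotics.IsBigO.sub (isBoundedAtImInfty_normalizedDeriv hF hb) ?_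
    exact (((const_boundedAtFilter atImInfty (6 : ℂ)).mul
      (const_boundedAtFilter atImInfty (12⁻¹ : ℂ))).mul isBoundedAtImInfty_E2).mul hb

/-- The space of level-one forms of weight 8 is one-dimensional, hence spanned by E₄². -/
theorem exists_serreDerivative_ESix :
    ∃ c : ℂ, ∀ τ : ℍ, serreDerivative 6 E₆ τ = c * E₄ τ ^ 2 := by
  have hr : Module.finrank ℂ (ModularForm 𝒮ℒ (8 : ℕ)) = 1 := by
    have h := dimension_level_one 8 ⟨4, rfl⟩
    rw [Module.finrank, h]
    simp [Nat.ModEq]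
  let f : ModularForm 𝒮ℒ (8 : ℕ) := ModularForm.mcast (by decide) (E₄.pow 2)
  have hf : ∀ τ, f τ = E₄ τ ^ 2 := fun τ => by
    rw [ModularForm.mcast_apply, ModularForm.coe_pow, Pi.pow_apply]
  have hf0 : f ≠ 0 := by
    intro h
    obtain ⟨τ, hτ⟩ := ((tendsto_E (k := 4) (by norm_num) ⟨2, rfl⟩).eventually_ne
      one_ne_zero).exists
    have := hf τ
    rw [h] at this
    exact hτ (by simpa using this.symm)
  obtain ⟨c, hc⟩ := (finrank_eq_one_iff_of_nonzero' f hf0).mp hr serreDerivESix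
  refine ⟨c, fun τ => ?_⟩
  rw [← hf]
  exact (DFunLike.congr_fun hc τ).symm

/-- The quotient E₆/η¹² has weight 0, so the E₂-term in the derivative of E₆ cancels against the one
from the logarithmic derivative of η¹². -/
theorem hasDerivAt_vFun {c : ℂ} (hc : ∀ τ : ℍ, serreDerivative 6 E₆ τ = c * E₄ τ ^ 2) (τ : ℍ) :
    HasDerivAt (vFun ∘ ofComplex)
      (16 * π ^ 7 * I / 27 * c * E₄ τ ^ 2 / dedekindEta τ ^ 12) τ := by
  have hE : HasDerivAt (E₆ ∘ ofComplex) (2 * π * I * (c * E₄ τ ^ 2 + 6 * 12⁻¹ * E2 τ * E₆ τ))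
      τ := by
    have h1 := (mdifferentiableAt_iff.mp (ModularFormClass.holo E₆ τ)).hasDerivAt
    convert! h1 using 1
    rw [← hc τ, serreDerivative_apply, normalizedDerivOfComplex]
    field_simp [Real.pi_ne_zero, I_ne_zero]
    ring
  have hη : HasDerivAt ModularForm.eta (π * I / 12 * E2 τ * ModularForm.eta τ) τ := by
    have h1 := (differentiableAt_eta_of_mem_upperHalfPlaneSet τ.2).hasDerivAt
    have h2 := logDeriv_eta_eq_E2 τ
    rw [logDeriv_apply, div_eq_iff (eta_ne_zero τ.2)] at h2
    rwa [h2] at h1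
  have hη' : HasDerivAt (dedekindEta ∘ ofComplex) (π * I / 12 * E2 τ * dedekindEta τ) τ := by
    have h1 := hη.const_mul ((Real.sqrt (2 * π) : ℂ) * exp (2 * π * I / 8))
    rw [dedekindEta]
    convert! h1.congr_of_eventuallyEq ?_ using 1
    · ring
    · filter_upwards [isOpen_upperHalfPlaneSet.mem_nhds τ.2] with z hz
      simp [dedekindEta, ofComplex_apply_of_im_pos hz]
  have h12 := (hη'.pow 12)
  have hv := ((hE.const_mul (8 * (π : ℂ) ^ 6 / 27)).div h12
    (by simpa using pow_ne_zero 12 (dedekindEta_ne_zero τ)))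
  have h0 := dedekindEta_ne_zero τ
  convert! hv using 1
  · funext z
    simp [vFun, gThree_eq]
  · simp only [Pi.pow_apply, Function.comp_apply, ofComplex_apply]
    field_simp
    ring

/-- If c were 0, then v would be a constant a and g₃ = aη¹² would tend to 0 at infinity, whereas its
limit is 8π⁶/27. -/
theorem exists_hasDerivAt_vFun : ∃ c : ℂ, c ≠ 0 ∧ ∀ τ : ℍ, HasDerivAt (vFun ∘ ofComplex)
    (c * gTwo τ ^ 2 / dedekindEta τ ^ 12) τ := by
  obtain ⟨c, hc⟩ := exists_serreDerivative_ESix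
  have hπ : (π : ℂ) ≠ 0 := mod_cast Real.pi_ne_zero
  have hc0 : c ≠ 0 := by
    rintro rfl
    have hd : ∀ τ : ℍ, HasDerivAt (vFun ∘ ofComplex) 0 τ := fun τ => by
      simpa using hasDerivAt_vFun hc τ
    have hconst : ∃ a, ∀ z ∈ upperHalfPlaneSet, (vFun ∘ ofComplex) z = a := by
      refine isOpen_upperHalfPlaneSet.exists_is_const_of_deriv_eq_zero
        (convex_halfSpace_im_gt 0).isPreconnected
        (fun z hz => (hd ⟨z, hz⟩).differentiableAt.differentiableWithinAt)
        (fun z hz => (hd ⟨z, hz⟩).deriv)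
    obtain ⟨a, ha⟩ := hconst
    have h3 : ∀ τ, gThree τ = a * dedekindEta τ ^ 12 := fun τ => by
      have h := ha τ τ.2
      rw [Function.comp_apply, ofComplex_apply, vFun,
        div_eq_iff (pow_ne_zero 12 (dedekindEta_ne_zero τ))] at h
      exact h
    have h4 : Tendsto gThree atImInfty (𝓝 0) := by
      simpa [funext h3] using (tendsto_dedekindEta.pow 12).const_mul a
    have h5 := tendsto_nhds_unique tendsto_gThree h4
    simp [hπ] at h5
  refine ⟨16 * π ^ 7 * I / 27 * c * (3 / (4 * π ^ 4)) ^ 2, ?_, fun τ => ?_⟩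
  · simp [hc0, hπ]
  · convert hasDerivAt_vFun hc τ using 1
    rw [gTwo_eq]
    field_simp

end Derivative

section Torsion

open Filter EisensteinSeries PeriodPair

open UpperHalfPlane hiding I

open scoped Real Manifold

/-! ### Torsion values of the Weierstrass functions -/

/-- The point `(a₀ τ + a₁) / N`. -/
def torsionPoint (N : ℕ) (a : Fin 2 → ℤ) (τ : ℂ) : ℂ := (a 0 * τ + a 1) / N

/-- `℘((a₀ τ + a₁) / N; [τ, 1])`. -/
def torsionP (N : ℕ) (a : Fin 2 → ℤ) (τ : ℍ) : ℂ := ℘[latticeOf τ] (torsionPoint N a τ)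

/-- `℘'((a₀ τ + a₁) / N; [τ, 1])`. -/
def torsionDerivP (N : ℕ) (a : Fin 2 → ℤ) (τ : ℍ) : ℂ := ℘'[latticeOf τ] (torsionPoint N a τ)

theorem tsum_lattice_latticeOf (τ : ℍ) (f : ℂ → ℂ) :
    ∑' l : (latticeOf τ).lattice, f l = ∑' v : Fin 2 → ℤ, f (v 0 * τ + v 1) := by
  rw [← (latticeOf τ).latticeEquivProd.symm.toEquiv.tsum_eq, ← (finTwoArrowEquiv ℤ).tsum_eq]
  refine tsum_congr fun v => ?_
  have h := (latticeOf τ).latticeEquiv_symm_apply (finTwoArrowEquiv ℤ v)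
  simp only [LinearEquiv.coe_toEquiv, h]
  simp [latticeOf]

theorem torsionPoint_sub {N : ℕ} (hN : N ≠ 0) (a v : Fin 2 → ℤ) (τ : ℂ) :
    torsionPoint N (a - N • v) τ = torsionPoint N a τ - (v 0 * τ + v 1) := by
  have h : ∀ i, (a - N • v) i = a i - N * v i := fun i => by simp
  have hN' : (N : ℂ) ≠ 0 := mod_cast hN
  simp only [torsionPoint, h]
  push_cast
  field_simp
  ring

theorem torsionP_eq_tsum {N : ℕ} (hN : N ≠ 0) (a : Fin 2 → ℤ) (τ : ℍ) :
    torsionP N a τ = ∑' v : Fin 2 → ℤ,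
      (1 / torsionPoint N (a - N • v) τ ^ 2 - 1 / (v 0 * τ + v 1 : ℂ) ^ 2) := by
  simp only [torsionPoint_sub hN]
  exact tsum_lattice_latticeOf τ fun l => 1 / (torsionPoint N a τ - l) ^ 2 - 1 / l ^ 2

theorem torsionDerivP_eq_tsum {N : ℕ} (hN : N ≠ 0) (a : Fin 2 → ℤ) (τ : ℍ) :
    torsionDerivP N a τ = -∑' v : Fin 2 → ℤ, 2 / torsionPoint N (a - N • v) τ ^ 3 := by
  simp only [torsionPoint_sub hN]
  rw [torsionDerivP, derivWeierstrassP]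
  exact congrArg _ (tsum_lattice_latticeOf τ fun l => 2 / (torsionPoint N a τ - l) ^ 3)

theorem torsionPoint_mem_lattice {N : ℕ} (hN : N ≠ 0) {a : Fin 2 → ℤ} {τ : ℍ} :
    torsionPoint N a τ ∈ (latticeOf τ).lattice ↔ ∃ v : Fin 2 → ℤ, a = N • v := by
  have hN' : (N : ℂ) ≠ 0 := mod_cast hN
  rw [mem_latticeOf]
  constructor
  · rintro ⟨m, n, h⟩
    refine ⟨![m, n], ?_⟩
    rw [torsionPoint, eq_div_iff hN'] at h
    have h0 : ((a 0 - N * m : ℤ) : ℂ) * τ + ((a 1 - N * n : ℤ) : ℂ) = 0 := by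
      push_cast; linear_combination -h
    have h1 : a 0 - N * m = 0 := by
      have := congrArg Complex.im h0
      simpa [-Int.cast_sub, -Int.cast_mul, τ.im_ne_zero] using this
    rw [h1] at h0
    have h2 : a 1 - N * n = 0 := by
      rw [Int.cast_zero, zero_mul, zero_add] at h0
      exact_mod_cast h0
    ext i
    fin_cases i
    · simp; linarith
    · simp; linarith
  · rintro ⟨v, rfl⟩
    refine ⟨v 0, v 1, ?_⟩
    simp [torsionPoint]
    field_simp

theorem torsionPoint_ne_zero {N : ℕ} (hN : N ≠ 0) {a : Fin 2 → ℤ} (ha : a ≠ 0) (τ : ℍ) :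
    torsionPoint N a τ ≠ 0 := by
  have hN' : (N : ℂ) ≠ 0 := mod_cast hN
  refine div_ne_zero (fun h => ?_) hN'
  have := (EisensteinSeries.r_mul_max_le τ ha)
  rw [h, norm_zero] at this
  exact absurd this (not_le.mpr (mul_pos (r_pos τ) (norm_pos_iff.mpr ha)))

theorem le_norm_of_mem_verticalStrip {A B : ℝ} (hB : 0 < B) {τ : ℍ} (hτ : τ ∈ verticalStrip A B)
    (x : Fin 2 → ℤ) : r ⟨⟨A, B⟩, hB⟩ * ‖x‖ ≤ ‖(x 0 * τ + x 1 : ℂ)‖ := by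
  rcases eq_or_ne x 0 with rfl | hx
  · simp
  · exact (mul_le_mul_of_nonneg_right (r_lower_bound_on_verticalStrip τ hB hτ)
      (norm_nonneg x)).trans (r_mul_max_le τ hx)

theorem one_le_norm_of_ne_zero {x : Fin 2 → ℤ} (hx : x ≠ 0) : 1 ≤ ‖x‖ := by
  rw [norm_eq_max_natAbs]
  have : x 0 ≠ 0 ∨ x 1 ≠ 0 := by
    by_contra! h
    exact hx (by ext i; fin_cases i <;> simp [h.1, h.2])
  have : 1 ≤ max (x 0).natAbs (x 1).natAbs := by omega
  exact_mod_cast this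

theorem summable_norm_neg_three : Summable fun x : Fin 2 → ℤ => (‖x‖ ^ 3)⁻¹ := by
  refine (summable_one_div_norm_rpow (k := 3) (by norm_num)).congr fun x => ?_
  rw [Real.rpow_neg (norm_nonneg _)]
  norm_cast

theorem injective_sub_smul {N : ℕ} (hN : N ≠ 0) (a : Fin 2 → ℤ) :
    Function.Injective fun v : Fin 2 → ℤ => a - N • v := by
  intro v w h
  have h' : (N : ℤ) • v = (N : ℤ) • w := by simpa using h
  exact smul_right_injective _ (by exact_mod_cast hN) h'

theorem le_norm_torsionPoint {N : ℕ} {A B : ℝ} (hB : 0 < B) {τ : ℍ}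
    (hτ : τ ∈ verticalStrip A B) (x : Fin 2 → ℤ) :
    r ⟨⟨A, B⟩, hB⟩ / N * ‖x‖ ≤ ‖torsionPoint N x τ‖ := by
  rw [torsionPoint, norm_div, Complex.norm_natCast, div_mul_eq_mul_div]
  exact div_le_div_of_nonneg_right (le_norm_of_mem_verticalStrip hB hτ x) (Nat.cast_nonneg N)

theorem norm_derivTerm_le {N : ℕ} (hN : N ≠ 0) {A B : ℝ} (hB : 0 < B) {τ : ℍ}
    (hτ : τ ∈ verticalStrip A B) (x : Fin 2 → ℤ) :
    ‖2 / torsionPoint N x τ ^ 3‖ ≤ 2 * ((r ⟨⟨A, B⟩, hB⟩ / N) ^ 3)⁻¹ * (‖x‖ ^ 3)⁻¹ := by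
  rcases eq_or_ne x 0 with rfl | hx
  · simp [torsionPoint]
  have hN' : (0 : ℝ) < N := mod_cast Nat.pos_of_ne_zero hN
  have h1 := le_norm_torsionPoint (N := N) hB hτ x
  have h0 : 0 < r ⟨⟨A, B⟩, hB⟩ / N * ‖x‖ :=
    mul_pos (div_pos (r_pos _) hN') (norm_pos_iff.mpr hx)
  rw [norm_div, norm_pow, Complex.norm_ofNat, mul_assoc, ← mul_inv, ← mul_pow, div_eq_mul_inv]
  gcongr

/-- Here the lattice varies with τ, so holomorphy of ℘' in z does not suffice; the series is treated
directly as a function of τ, dominated on vertical strips. -/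
theorem mdifferentiable_torsionDerivP {N : ℕ} (hN : N ≠ 0) {a : Fin 2 → ℤ}
    (ha : ∀ v : Fin 2 → ℤ, a ≠ N • v) : MDiff (torsionDerivP N a) := by
  rw [UpperHalfPlane.mdifferentiable_iff]
  intro z hz
  set U : Set ℂ := {w | |w.re| < |z.re| + 1 ∧ z.im / 2 < w.im} with hU
  have hz' : 0 < z.im := hz
  have hUo : IsOpen U := (isOpen_lt (f := fun w : ℂ => |w.re|)
    (g := fun _ => |z.re| + 1) (by fun_prop) (by fun_prop)).inter
    (isOpen_lt (f := fun _ => z.im / 2) (g := fun w : ℂ => w.im) (by fun_prop) (by fun_prop))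
  have hzU : z ∈ U := ⟨by linarith, by linarith⟩
  have hpos : ∀ w ∈ U, 0 < w.im := fun w hw => lt_trans (by linarith) hw.2
  have hB : 0 < z.im / 2 := by linarith
  have hstrip : ∀ w (hw : w ∈ U), (⟨w, hpos w hw⟩ : ℍ) ∈ verticalStrip (|z.re| + 1) (z.im / 2) :=
    fun w hw => ⟨hw.1.le, hw.2.le⟩
  have key : DifferentiableOn ℂ
      (fun w => ∑' v : Fin 2 → ℤ, 2 / torsionPoint N (a - N • v) w ^ 3) U := by
    refine Complex.differentiableOn_tsum_of_summable_norm
      (((summable_norm_neg_three.comp_injective (injective_sub_smul hN a)).mul_left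
        (2 * ((r ⟨⟨|z.re| + 1, z.im / 2⟩, hB⟩ / N) ^ 3)⁻¹))) (fun v w hw => ?_) hUo
      fun v w hw => norm_derivTerm_le hN hB (hstrip w hw) (a - N • v)
    have h0 : torsionPoint N (a - N • v) w ≠ 0 :=
      torsionPoint_ne_zero hN (sub_ne_zero.mpr (ha v)) ⟨w, hpos w hw⟩
    have h1 : DifferentiableAt ℂ (torsionPoint N (a - N • v)) w := by
      unfold torsionPoint; fun_prop
    exact ((differentiableAt_const _).div (h1.pow 3) (pow_ne_zero 3 h0)).differentiableWithinAt
  refine ((key.neg.differentiableAt (hUo.mem_nhds hzU)).congr_of_eventuallyEq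
    ?_).differentiableWithinAt
  filter_upwards [hUo.mem_nhds hzU] with w hw
  simp only [Function.comp_apply, ofComplex_apply_of_im_pos (hpos w hw), torsionDerivP_eq_tsum hN]
  rfl

/-- The integer vector a - Nv is nonzero, so its norm is at least 1 and can absorb ‖a‖. -/
theorem norm_le_mul_norm_sub {N : ℕ} (hN : N ≠ 0) {a v : Fin 2 → ℤ} (ha : a ≠ N • v) :
    ‖v‖ ≤ (1 + ‖a‖) * ‖a - N • v‖ := by
  have h1 : 1 ≤ ‖a - N • v‖ := one_le_norm_of_ne_zero (sub_ne_zero.mpr ha)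
  have hN' : (1 : ℝ) ≤ N := mod_cast Nat.pos_of_ne_zero hN
  have h2 : (N : ℝ) * ‖v‖ ≤ ‖a‖ + ‖a - N • v‖ := by
    have h3 : ‖N • v‖ = (N : ℝ) * ‖v‖ := by
      have : N • v = (N : ℤ) • v := by simp
      rw [this, norm_smul]
      simp
    rw [← h3]
    have : N • v = a - (a - N • v) := by abel
    calc ‖N • v‖ = ‖a - (a - N • v)‖ := by rw [← this]
      _ ≤ _ := norm_sub_le _ _
  nlinarith [norm_nonneg a, norm_nonneg v]

theorem norm_term_le {N : ℕ} (hN : N ≠ 0) {a : Fin 2 → ℤ}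
    (ha : ∀ v : Fin 2 → ℤ, a ≠ N • v) {A B : ℝ} (hB : 0 < B) {τ : ℍ}
    (hτ : τ ∈ verticalStrip A B) {Z : ℝ} (hZ : ‖torsionPoint N a τ‖ ≤ Z) {v : Fin 2 → ℤ}
    (hv : v ≠ 0) :
    ‖1 / torsionPoint N (a - N • v) τ ^ 2 - 1 / (v 0 * τ + v 1 : ℂ) ^ 2‖ ≤
      Z * (((r ⟨⟨A, B⟩, hB⟩ / N / (1 + ‖a‖)) ^ 2 * r ⟨⟨A, B⟩, hB⟩)⁻¹ +
        ((r ⟨⟨A, B⟩, hB⟩ / N / (1 + ‖a‖)) * r ⟨⟨A, B⟩, hB⟩ ^ 2)⁻¹) * (‖v‖ ^ 3)⁻¹ := by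
  have hr := r_pos ⟨⟨A, B⟩, hB⟩
  set R := r ⟨⟨A, B⟩, hB⟩
  have hN' : (0 : ℝ) < N := mod_cast Nat.pos_of_ne_zero hN
  have hK : 0 < 1 + ‖a‖ := by positivity
  set s := R / N / (1 + ‖a‖) with hs
  have hs0 : 0 < s := by positivity
  have hn : 0 < ‖v‖ := norm_pos_iff.mpr hv
  have hp : s * ‖v‖ ≤ ‖torsionPoint N (a - N • v) τ‖ := by
    refine le_trans ?_ (le_norm_torsionPoint hB hτ _)
    rw [hs, div_mul_eq_mul_div, div_le_iff₀ hK, mul_assoc]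
    refine mul_le_mul_of_nonneg_left ?_ (by positivity)
    rw [mul_comm]
    exact norm_le_mul_norm_sub hN (ha v)
  have hw := le_norm_of_mem_verticalStrip hB hτ v
  have hz : torsionPoint N a τ = torsionPoint N (a - N • v) τ + (v 0 * τ + v 1) := by
    rw [torsionPoint_sub hN]; ring
  rw [hz] at hZ
  set p := torsionPoint N (a - N • v) τ
  set w : ℂ := v 0 * τ + v 1
  have hp0 : 0 < ‖p‖ := lt_of_lt_of_le (by positivity) hp
  have hw0 : 0 < ‖w‖ := lt_of_lt_of_le (by positivity) hw
  have hpne : p ≠ 0 := norm_pos_iff.mp hp0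
  have hwne : w ≠ 0 := norm_pos_iff.mp hw0
  -- The sum p + w is the fixed torsion point, bounded by Z; what remains decays cubically in v.
  have e : 1 / p ^ 2 - 1 / w ^ 2 = (p + w) * (1 / (p ^ 2 * w) - 1 / (p * w ^ 2)) := by
    field_simp
    ring
  rw [e, norm_mul, mul_assoc]
  have hZ0 : 0 ≤ Z := (norm_nonneg _).trans hZ
  refine mul_le_mul hZ ?_ (norm_nonneg _) hZ0
  refine (norm_sub_le _ _).trans ?_
  rw [add_mul, ← mul_inv, ← mul_inv, norm_div, norm_div, norm_one, norm_mul, norm_mul, norm_pow,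
    norm_pow, one_div, one_div]
  refine add_le_add ?_ ?_
  · rw [show s ^ 2 * R * ‖v‖ ^ 3 = (s * ‖v‖) ^ 2 * (R * ‖v‖) by ring]
    gcongr
  · rw [show s * R ^ 2 * ‖v‖ ^ 3 = (s * ‖v‖) * (R * ‖v‖) ^ 2 by ring]
    gcongr

theorem mdifferentiable_torsionP {N : ℕ} (hN : N ≠ 0) {a : Fin 2 → ℤ}
    (ha : ∀ v : Fin 2 → ℤ, a ≠ N • v) : MDiff (torsionP N a) := by
  rw [UpperHalfPlane.mdifferentiable_iff]
  intro z hz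
  have hcont : Continuous (torsionPoint N a) := by unfold torsionPoint; fun_prop
  set U : Set ℂ := {w | (|w.re| < |z.re| + 1 ∧ z.im / 2 < w.im) ∧
    ‖torsionPoint N a w‖ < ‖torsionPoint N a z‖ + 1} with hU
  have hz' : 0 < z.im := hz
  have hUo : IsOpen U := ((isOpen_lt (f := fun w : ℂ => |w.re|)
    (g := fun _ => |z.re| + 1) (by fun_prop) (by fun_prop)).inter
    (isOpen_lt (f := fun _ => z.im / 2) (g := fun w : ℂ => w.im) (by fun_prop)
      (by fun_prop))).inter (isOpen_lt (f := fun w => ‖torsionPoint N a w‖)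
        (g := fun _ => ‖torsionPoint N a z‖ + 1) (by fun_prop) (by fun_prop))
  have hzU : z ∈ U := ⟨⟨by linarith, by linarith⟩, by linarith⟩
  have hpos : ∀ w ∈ U, 0 < w.im := fun w hw => lt_trans (by linarith) hw.1.2
  have hB : 0 < z.im / 2 := by linarith
  have hstrip : ∀ w (hw : w ∈ U), (⟨w, hpos w hw⟩ : ℍ) ∈ verticalStrip (|z.re| + 1) (z.im / 2) :=
    fun w hw => ⟨hw.1.1.le, hw.1.2.le⟩
  set R := r ⟨⟨|z.re| + 1, z.im / 2⟩, hB⟩ with hR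
  set C := (‖torsionPoint N a z‖ + 1) * (((R / N / (1 + ‖a‖)) ^ 2 * R)⁻¹ +
        ((R / N / (1 + ‖a‖)) * R ^ 2)⁻¹) with hC
  -- A separate bound for the term v = 0, where the majorant (‖v‖³)⁻¹ reads 0.
  set D := ((R / N * ‖a‖) ^ 2)⁻¹ with hD
  have ha0 : a ≠ 0 := by simpa using ha 0
  have key : DifferentiableOn ℂ (fun w => ∑' v : Fin 2 → ℤ,
      (1 / torsionPoint N (a - N • v) w ^ 2 - 1 / (v 0 * w + v 1 : ℂ) ^ 2)) U := by
    refine Complex.differentiableOn_tsum_of_summable_norm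
      (u := fun v => C * (‖v‖ ^ 3)⁻¹ + if v = 0 then D else 0)
      ((summable_norm_neg_three.mul_left C).add (hasSum_ite_eq 0 D).summable)
      (fun v w hw => ?_) hUo fun v w hw => ?_
    · have h0 : torsionPoint N (a - N • v) w ≠ 0 :=
        torsionPoint_ne_zero hN (sub_ne_zero.mpr (ha v)) ⟨w, hpos w hw⟩
      have h1 : DifferentiableAt ℂ (torsionPoint N (a - N • v)) w := by
        unfold torsionPoint; fun_prop
      have h2 : DifferentiableAt ℂ (fun w : ℂ => 1 / (v 0 * w + v 1 : ℂ) ^ 2) w := by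
        rcases eq_or_ne v 0 with rfl | hv
        · simp
        · have h3 : (v 0 * w + v 1 : ℂ) ≠ 0 := by
            have := torsionPoint_ne_zero one_ne_zero hv ⟨w, hpos w hw⟩
            simpa [torsionPoint] using this
          exact (differentiableAt_const _).div (by fun_prop) (pow_ne_zero 2 h3)
      exact (((differentiableAt_const _).div (h1.pow 2) (pow_ne_zero 2 h0)).sub
        h2).differentiableWithinAt
    · rcases eq_or_ne v 0 with rfl | hv
      · have h1 := le_norm_torsionPoint (N := N) hB (hstrip w hw) a
        have hN' : (0 : ℝ) < N := mod_cast Nat.pos_of_ne_zero hN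
        have h0 : 0 < R / N * ‖a‖ :=
          mul_pos (div_pos (r_pos _) hN') (norm_pos_iff.mpr ha0)
        simp only [smul_zero, sub_zero, Pi.zero_apply, Int.cast_zero, zero_mul, add_zero,
          if_true, norm_zero]
        norm_num
        rw [hD]
        gcongr
      · simp only [hv, if_false, add_zero]
        exact norm_term_le hN ha hB (hstrip w hw) hw.2.le hv
  refine ((key.differentiableAt (hUo.mem_nhds hzU)).congr_of_eventuallyEq
    ?_).differentiableWithinAt
  filter_upwards [hUo.mem_nhds hzU] with w hw
  simp only [Function.comp_apply, ofComplex_apply_of_im_pos (hpos w hw), torsionP_eq_tsum hN]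

/-! ### Behaviour at infinity -/

theorem mem_latticeOf_vadd (n : ℤ) (τ : ℍ) (z : ℂ) :
    1 * z ∈ (latticeOf τ).lattice ↔ z ∈ (latticeOf ((n : ℝ) +ᵥ τ)).lattice := by
  rw [mem_latticeOf, mem_latticeOf, one_mul]
  constructor
  · rintro ⟨p, q, rfl⟩
    exact ⟨p, q - p * n, by push_cast [coe_vadd]; ring⟩
  · rintro ⟨p, q, rfl⟩
    exact ⟨p, q + p * n, by push_cast [coe_vadd]; ring⟩

theorem torsionPoint_vadd {N : ℕ} (hN : N ≠ 0) (a : Fin 2 → ℤ) (k : ℤ) (τ : ℍ) :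
    torsionPoint N a (((N * k : ℤ) : ℝ) +ᵥ τ : ℍ) = torsionPoint N a τ + (a 0 * k : ℤ) := by
  simp only [torsionPoint, coe_vadd]
  push_cast
  field_simp
  ring

theorem int_mem_latticeOf (τ : ℍ) (n : ℤ) : (n : ℂ) ∈ (latticeOf τ).lattice :=
  mem_latticeOf.mpr ⟨0, n, by simp⟩

theorem torsionDerivP_vadd {N : ℕ} (hN : N ≠ 0) (a : Fin 2 → ℤ) (k : ℤ) (τ : ℍ) :
    torsionDerivP N a (((N * k : ℤ) : ℝ) +ᵥ τ) = torsionDerivP N a τ := by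
  rw [torsionDerivP, derivWeierstrassP_of_homothety one_ne_zero (mem_latticeOf_vadd (N * k) τ),
    torsionPoint_vadd hN, one_pow, one_mul, one_mul]
  exact (latticeOf τ).derivWeierstrassP_add_coe _ ⟨_, int_mem_latticeOf τ _⟩

theorem exists_vadd_mem_strip {N : ℕ} (hN : N ≠ 0) (τ : ℍ) :
    ∃ k : ℤ, |(((N * k : ℤ) : ℝ) +ᵥ τ : ℍ).re| ≤ N := by
  have hN' : (0 : ℝ) < N := mod_cast Nat.pos_of_ne_zero hN
  refine ⟨-⌊τ.re / N⌋, ?_⟩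
  have h1 := Int.floor_le (τ.re / N)
  have h2 := Int.lt_floor_add_one (τ.re / N)
  rw [le_div_iff₀ hN'] at h1
  rw [div_lt_iff₀ hN'] at h2
  rw [vadd_re, abs_le]
  push_cast
  constructor <;> nlinarith

/-- Dominated convergence: terms in which τ occurs die out, and the others are real constants. That
the limit is real matters in `exists_le_norm_torsionP`. -/
theorem tendsto_torsionDerivP_strip {N : ℕ} (hN : N ≠ 0) (a : Fin 2 → ℤ) :
    ∃ l : ℝ, Tendsto (torsionDerivP N a) (atImInfty ⊓ 𝓟 {τ | |τ.re| ≤ N}) (𝓝 l) := by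
  let g : (Fin 2 → ℤ) → ℝ := fun v =>
    if (a - N • v) 0 = 0 then 2 / (((a - N • v) 1 : ℝ) / N) ^ 3 else 0
  refine ⟨-∑' v, g v, ?_⟩
  have hN' : (N : ℂ) ≠ 0 := mod_cast hN
  have hfun : torsionDerivP N a = fun τ : ℍ =>
      -∑' v : Fin 2 → ℤ, 2 / torsionPoint N (a - N • v) τ ^ 3 :=
    funext (torsionDerivP_eq_tsum hN a)
  rw [hfun]
  push_cast
  refine Tendsto.neg (tendsto_tsum_of_dominated_convergence
    ((summable_norm_neg_three.comp_injective (injective_sub_smul hN a)).mul_left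
        (2 * ((r ⟨⟨N, 1⟩, one_pos⟩ / N) ^ 3)⁻¹)) (fun v => ?_) ?_)
  · by_cases h : (a - N • v) 0 = 0
    · simp only [g, h, if_true, torsionPoint]
      push_cast
      simp only [zero_mul, zero_add]
      exact tendsto_const_nhds
    · simp only [g, h, if_false]
      have h1 : Tendsto (fun τ : ℍ => ‖torsionPoint N (a - N • v) τ‖) atImInfty atTop := by
        have h2 : Tendsto (fun τ : ℍ => |((a - N • v) 0 : ℝ)| / N * τ.im) atImInfty atTop := by
          refine Tendsto.const_mul_atTop ?_ tendsto_comap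
          have : (0 : ℝ) < N := mod_cast Nat.pos_of_ne_zero hN
          have : ((a - N • v) 0 : ℝ) ≠ 0 := mod_cast h
          positivity
        refine tendsto_atTop_mono (fun τ => ?_) h2
        have h3 := Complex.abs_im_le_norm (torsionPoint N (a - N • v) τ)
        have h4 : (torsionPoint N (a - N • v) τ).im = ((a - N • v) 0 : ℝ) * τ.im / N := by
          rw [torsionPoint, Complex.div_natCast_im, Complex.add_im, Complex.mul_im,
            Complex.intCast_im, Complex.intCast_re, Complex.intCast_im, coe_im]
          ring
        rw [h4, abs_div, abs_mul, Nat.abs_cast, abs_of_pos τ.im_pos] at h3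
        rw [div_mul_eq_mul_div]
        exact h3
      have h4 : Tendsto (fun τ : ℍ => torsionPoint N (a - N • v) τ) atImInfty (Bornology.cobounded ℂ) :=
        tendsto_norm_atTop_iff_cobounded.mp h1
      have h5 := ((tendsto_inv₀_cobounded.comp h4).pow 3).const_mul 2
      simp only [Complex.ofReal_zero]
      refine (Tendsto.mono_left ?_ inf_le_left)
      simpa [Function.comp_def, div_eq_mul_inv] using h5
  · have h1 : ∀ᶠ τ : ℍ in atImInfty, 1 ≤ τ.im := tendsto_comap.eventually (eventually_ge_atTop 1)
    filter_upwards [h1.filter_mono inf_le_left, mem_inf_of_right (mem_principal_self _)]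
      with τ hτ hτ' v
    exact norm_derivTerm_le hN one_pos (τ := τ) ⟨hτ', hτ⟩ (a - N • v)

/-- Translating τ by multiples of N does not change the value and brings τ into the strip. -/
theorem tendsto_torsionDerivP {N : ℕ} (hN : N ≠ 0) (a : Fin 2 → ℤ) :
    ∃ l : ℝ, Tendsto (torsionDerivP N a) atImInfty (𝓝 l) := by
  obtain ⟨l, hl⟩ := tendsto_torsionDerivP_strip hN a
  refine ⟨l, ?_⟩
  choose k hk using exists_vadd_mem_strip hN
  have h1 : Tendsto (fun τ => ((N * k τ : ℤ) : ℝ) +ᵥ τ) atImInfty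
      (atImInfty ⊓ 𝓟 {τ | |τ.re| ≤ N}) := by
    refine tendsto_inf.mpr ⟨tendsto_comap_iff.mpr ?_, tendsto_principal.mpr (.of_forall hk)⟩
    have h : Tendsto UpperHalfPlane.im atImInfty atTop := tendsto_comap
    exact h.congr fun τ => by simp [vadd_im]
  exact (hl.comp h1).congr fun τ => torsionDerivP_vadd hN a _ τ

/-- Write the Weierstrass equation as ℘'² + g₃ = ℘(4℘² - g₂). The left side tends to l² + 8π⁶/27,
which is positive because l is real, while g₂ stays bounded; hence ℘ cannot become small. No limit
of ℘ itself is needed. -/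
theorem exists_le_norm_torsionP {N : ℕ} (hN : N ≠ 0) {a : Fin 2 → ℤ}
    (ha : ∀ v : Fin 2 → ℤ, a ≠ N • v) :
    ∃ δ > 0, ∀ᶠ τ in atImInfty, δ ≤ ‖torsionP N a τ‖ := by
  obtain ⟨l, hl⟩ := tendsto_torsionDerivP hN a
  have h1 := (hl.pow 2).add tendsto_gThree
  set M : ℂ := (l : ℂ) ^ 2 + 8 * π ^ 6 / 27 with hM
  have hM0 : 0 < ‖M‖ := by
    have : M = ((l ^ 2 + 8 * π ^ 6 / 27 : ℝ) : ℂ) := by push_cast; rfl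
    rw [this, norm_pos_iff]
    have h := Real.pi_pos
    exact_mod_cast (by positivity : l ^ 2 + 8 * π ^ 6 / 27 ≠ 0)
  have h2 : ∀ᶠ τ in atImInfty, ‖M‖ / 2 < ‖torsionDerivP N a τ ^ 2 + gThree τ‖ :=
    h1.norm.eventually (lt_mem_nhds (half_lt_self hM0))
  have h3 : ∃ C > 0, ∀ᶠ τ in atImInfty, ‖gTwo τ‖ < C :=
    ⟨‖(4 * π ^ 4 / 3 : ℂ)‖ + 1, by positivity, tendsto_gTwo.norm.eventually
      (gt_mem_nhds (by linarith))⟩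
  obtain ⟨C, hC0, hC⟩ := h3
  refine ⟨min 1 (‖M‖ / 2 / (4 + C)), by positivity, ?_⟩
  filter_upwards [h2, hC] with τ hτ hCτ
  by_contra! hlt
  have hz : torsionPoint N a τ ∉ (latticeOf τ).lattice := by
    rw [torsionPoint_mem_lattice hN]; simpa using ha
  have hrel := (latticeOf τ).derivWeierstrassP_sq _ hz
  change torsionDerivP N a τ ^ 2 = 4 * torsionP N a τ ^ 3 - gTwo τ * torsionP N a τ - gThree τ
    at hrel
  rw [hrel, sub_add_cancel] at hτ
  have hx1 : ‖torsionP N a τ‖ < 1 := hlt.trans_le (min_le_left _ _)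
  have hx2 : ‖torsionP N a τ‖ < ‖M‖ / 2 / (4 + C) := hlt.trans_le (min_le_right _ _)
  rw [lt_div_iff₀ (by positivity)] at hx2
  have h5 : ‖4 * torsionP N a τ ^ 3 - gTwo τ * torsionP N a τ‖ ≤
      4 * ‖torsionP N a τ‖ + C * ‖torsionP N a τ‖ := by
    refine (norm_sub_le _ _).trans (add_le_add ?_ ?_)
    · rw [norm_mul, norm_pow, Complex.norm_ofNat]
      have := pow_le_of_le_one (norm_nonneg (torsionP N a τ)) hx1.le (n := 3) (by norm_num)
      linarith
    · rw [norm_mul]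
      exact mul_le_mul_of_nonneg_right hCτ.le (norm_nonneg _)
  linarith

end Torsion

section Coordinates

open PeriodPair

/-! ### The coordinate functions -/

/-- The bottom row of a matrix. -/
def bottomRow (γ : SL(2, ℤ)) : Fin 2 → ℤ := ![γ 1 0, γ 1 1]

/-- The point `1 / N` as a torsion point. -/
def unitRow : Fin 2 → ℤ := ![0, 1]

theorem torsionPoint_unitRow (N : ℕ) (τ : ℂ) : torsionPoint N unitRow τ = 1 / N := by
  simp [torsionPoint, unitRow]

/-- Rescaling [γτ, 1] back to [τ, 1] carries 1/N to (cτ+d)/N, so γ acts on the torsion values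
through its bottom row. -/
theorem autFactor_mul_inv (N : ℕ) (γ : SL(2, ℤ)) (τ : ℍ) :
    autFactor γ τ * torsionPoint N unitRow ((γ • τ : ℍ) : ℂ) =
      torsionPoint N (bottomRow γ) τ := by
  rw [torsionPoint_unitRow]
  simp [torsionPoint, bottomRow, autFactor]
  ring

theorem torsionP_smul (N : ℕ) (γ : SL(2, ℤ)) (τ : ℍ) :
    torsionP N unitRow (γ • τ) = autFactor γ τ ^ 2 * torsionP N (bottomRow γ) τ := by
  rw [torsionP, weierstrassP_latticeOf_smul, autFactor_mul_inv, torsionP]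

theorem torsionDerivP_smul (N : ℕ) (γ : SL(2, ℤ)) (τ : ℍ) :
    torsionDerivP N unitRow (γ • τ) = autFactor γ τ ^ 3 * torsionDerivP N (bottomRow γ) τ := by
  rw [torsionDerivP, derivWeierstrassP_latticeOf_smul, autFactor_mul_inv, torsionDerivP]

theorem bottomRow_ne {N : ℕ} (hN : 2 ≤ N) (γ : SL(2, ℤ)) (v : Fin 2 → ℤ) :
    bottomRow γ ≠ N • v := by
  intro h
  have h0 := congrFun h 0
  have h1 := congrFun h 1
  simp [bottomRow] at h0 h1
  have hdet := det_eq_one γ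
  rw [h0, h1] at hdet
  have hd : (N : ℤ) ∣ 1 := ⟨γ 0 0 * v 1 - γ 0 1 * v 0, by linear_combination -hdet⟩
  have := Int.le_of_dvd one_pos hd
  omega

theorem bottomRow_one : bottomRow 1 = unitRow := by
  simp [bottomRow, unitRow]

theorem unitRow_ne {N : ℕ} (hN : 2 ≤ N) (v : Fin 2 → ℤ) : unitRow ≠ N • v := by
  rw [← bottomRow_one]
  exact bottomRow_ne hN 1 v

theorem xFun_eq (N : ℕ) (τ : ℍ) :
    xFun 0 (1 / (N : ℚ)) τ = gTwo τ * gThree τ / discr τ * torsionP N unitRow τ := by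
  rw [xFun, frickeFunction, torsionP, torsionPoint_unitRow]
  push_cast
  rw [zero_mul, zero_add]
  ring

/-- The exponent in the Klein form is quadratic in (r₁, r₂), so doubling the index raises the
exponential to its fourth power and it cancels. The quasi-periods therefore never have to be
evaluated, and the duplication formula for σ finishes. -/
theorem yFun_eq {N : ℕ} (hN : 2 ≤ N) (τ : ℍ) :
    yFun 0 (1 / (N : ℚ)) τ = torsionDerivP N unitRow τ / dedekindEta τ ^ 6 := by
  have hmem : torsionPoint N unitRow τ ∉ (latticeOf τ).lattice := by
    rw [torsionPoint_mem_lattice (by omega)]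
    simpa using unitRow_ne hN
  have hσ : weierstrassSigma (latticeOf τ) (torsionPoint N unitRow τ) ≠ 0 := by
    rwa [Ne, weierstrassSigma_eq_zero_iff]
  have hη := dedekindEta_ne_zero τ
  rw [torsionDerivP, derivWeierstrassP_eq_sigma _ hmem, yFun, siegelFunction, siegelFunction,
    kleinForm, kleinForm]
  push_cast
  rw [torsionPoint_unitRow] at hσ ⊢
  simp only [zero_mul, mul_zero, zero_add]
  set q := quasiPeriod (latticeOf τ) 1
  have hexp : Complex.exp (-(1 / 2) * (2 * (1 / (N : ℂ)) * q) * (2 * (1 / (N : ℂ)))) =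
      Complex.exp (-(1 / 2) * (1 / (N : ℂ) * q) * (1 / (N : ℂ))) ^ 4 := by
    rw [← Complex.exp_nat_mul]
    congr 1
    push_cast
    ring
  rw [hexp]
  have he := Complex.exp_ne_zero (-(1 / 2) * (1 / (N : ℂ) * q) * (1 / (N : ℂ)))
  generalize Complex.exp (-(1 / 2) * (1 / (N : ℂ) * q) * (1 / (N : ℂ))) = e at he
  field_simp

theorem vFun_smul (γ : SL(2, ℤ)) (τ : ℍ) : vFun (γ • τ) = vFun τ / etaChar γ ^ 2 := by
  have hj := autFactor_ne_zero γ τ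
  have hη := dedekindEta_ne_zero τ
  have hχ := etaChar_ne_zero γ
  have h : dedekindEta (γ • τ) ^ 12 = (dedekindEta (γ • τ) ^ 6) ^ 2 := by ring
  rw [vFun, vFun, h, dedekindEta_pow_six_smul, gThree_smul]
  field_simp

theorem xFun_smul (N : ℕ) (γ : SL(2, ℤ)) (τ : ℍ) : xFun 0 (1 / (N : ℚ)) (γ • τ) =
    gTwo τ * gThree τ / discr τ * torsionP N (bottomRow γ) τ := by
  have hj := autFactor_ne_zero γ τ
  have hΔ := discr_ne_zero τ
  rw [xFun_eq, gTwo_smul, gThree_smul, discr_smul, torsionP_smul]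
  field_simp

theorem yFun_smul {N : ℕ} (hN : 2 ≤ N) (γ : SL(2, ℤ)) (τ : ℍ) : yFun 0 (1 / (N : ℚ)) (γ • τ) =
    torsionDerivP N (bottomRow γ) τ / (etaChar γ * dedekindEta τ ^ 6) := by
  have hj := autFactor_ne_zero γ τ
  have hη := dedekindEta_ne_zero τ
  have hχ := etaChar_ne_zero γ
  rw [yFun_eq hN, dedekindEta_pow_six_smul, torsionDerivP_smul]
  field_simp

theorem torsionPoint_mul_mem {N : ℕ} (hN : N ≠ 0) (v : Fin 2 → ℤ) (τ : ℍ) :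
    torsionPoint N (N • v) τ ∈ (latticeOf τ).lattice :=
  (torsionPoint_mem_lattice hN).mpr ⟨v, rfl⟩

theorem torsionPoint_add (N : ℕ) (a b : Fin 2 → ℤ) (τ : ℂ) :
    torsionPoint N (a + b) τ = torsionPoint N a τ + torsionPoint N b τ := by
  simp [torsionPoint]
  ring

theorem torsionPoint_neg (N : ℕ) (a : Fin 2 → ℤ) (τ : ℂ) :
    torsionPoint N (-a) τ = -torsionPoint N a τ := by
  simp [torsionPoint]
  ring

theorem torsionP_add_smul {N : ℕ} (hN : N ≠ 0) (a v : Fin 2 → ℤ) (τ : ℍ) :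
    torsionP N (a + N • v) τ = torsionP N a τ := by
  rw [torsionP, torsionPoint_add]
  exact (latticeOf τ).weierstrassP_add_coe _ ⟨_, torsionPoint_mul_mem hN v τ⟩

theorem torsionDerivP_add_smul {N : ℕ} (hN : N ≠ 0) (a v : Fin 2 → ℤ) (τ : ℍ) :
    torsionDerivP N (a + N • v) τ = torsionDerivP N a τ := by
  rw [torsionDerivP, torsionPoint_add]
  exact (latticeOf τ).derivWeierstrassP_add_coe _ ⟨_, torsionPoint_mul_mem hN v τ⟩

theorem surfaceEquation_coordinates {N : ℕ} (hN : 2 ≤ N) (τ : ℍ) : SurfaceEquation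
    ![vFun τ, xFun 0 (1 / (N : ℚ)) τ, yFun 0 (1 / (N : ℚ)) τ, 1] := by
  have hη := dedekindEta_ne_zero τ
  have hmem : torsionPoint N unitRow τ ∉ (latticeOf τ).lattice := by
    rw [torsionPoint_mem_lattice (by omega)]
    simpa using unitRow_ne hN
  have hrel := (latticeOf τ).derivWeierstrassP_sq _ hmem
  change torsionDerivP N unitRow τ ^ 2 = 4 * torsionP N unitRow τ ^ 3 -
    gTwo τ * torsionP N unitRow τ - gThree τ at hrel
  have hΔ : dedekindEta τ ^ 24 = gTwo τ ^ 3 - 27 * gThree τ ^ 2 := dedekindEta_pow_eq_discr τ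
  -- This is Δ + 27g₃² = g₂³ divided by Δ = η²⁴.
  have hZ : 1 ^ 2 + 27 * vFun τ ^ 2 = gTwo τ ^ 3 / dedekindEta τ ^ 24 := by
    rw [vFun]
    field_simp
    linear_combination hΔ
  simp only [SurfaceEquation, Matrix.cons_val]
  rw [hZ, xFun_eq, yFun_eq hN, ← dedekindEta_pow_eq_discr, vFun]
  field_simp
  rw [hrel]
  ring

/-! ### The zeros of `g₂` and `g₃` -/

/-- S fixes i, and weight 6 contributes the factor i⁶ = -1. -/
theorem gThree_zeta4 : gThree zeta4 = 0 := by
  have h : ModularGroup.S • zeta4 = zeta4 := by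
    ext1
    rw [coe_smul_eq, autFactor_S]
    simp [zeta4, ModularGroup.S]
  have h1 := gThree_smul ModularGroup.S zeta4
  rw [h, autFactor_S] at h1
  have h2 : ((zeta4 : ℍ) : ℂ) ^ 6 = -1 := by
    have : ((zeta4 : ℍ) : ℂ) = Complex.I := rfl
    rw [this, show 6 = 2 * 3 by norm_num, pow_mul, Complex.I_sq]
    norm_num
  rw [h2] at h1
  linear_combination h1 / 2

theorem zeta3_sq : ((zeta3 : ℍ) : ℂ) ^ 2 + zeta3 + 1 = 0 := by
  have h3 : ((zeta3 : ℍ) : ℂ) ^ 3 = 1 := by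
    change Complex.exp (2 * Real.pi * Complex.I / 3) ^ 3 = 1
    rw [← Complex.exp_nat_mul]
    convert Complex.exp_two_pi_mul_I using 2
    push_cast
    ring
  have h1 : ((zeta3 : ℍ) : ℂ) - 1 ≠ 0 := by
    intro h
    have := congrArg Complex.im h
    simp at this
    exact zeta3.im_ne_zero this
  refine mul_left_cancel₀ h1 ?_
  linear_combination h3

/-- An elliptic matrix fixes ζ₃, and its weight-4 factor (ζ₃ + 1)⁴ = -ζ₃ - 1 is not 1. -/
theorem gTwo_zeta3 : gTwo zeta3 = 0 := by
  have hz := zeta3_sq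
  set γ : SL(2, ℤ) := ⟨!![0, -1; 1, 1], by simp⟩
  have hj : autFactor γ zeta3 = zeta3 + 1 := by simp [autFactor, γ]
  have hj0 := autFactor_ne_zero γ zeta3
  have h : γ • zeta3 = zeta3 := by
    ext1
    rw [coe_smul_eq, div_eq_iff hj0, hj]
    simp [γ]
    linear_combination -hz
  have h1 := gTwo_smul γ zeta3
  rw [h, hj] at h1
  have h4 : ((zeta3 : ℍ) + 1 : ℂ) ^ 4 = -zeta3 - 1 := by
    linear_combination (((zeta3 : ℍ) : ℂ) ^ 2 + 3 * zeta3 + 2) * hz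
  rw [h4] at h1
  have h2 : (zeta3 : ℂ) + 2 ≠ 0 := by
    intro h
    have := congrArg Complex.im h
    simp at this
    exact zeta3.im_ne_zero this
  refine (mul_eq_zero.mp (?_ : ((zeta3 : ℍ) + 2 : ℂ) * gTwo zeta3 = 0)).resolve_left h2
  linear_combination h1

theorem exists_smul_of_invariants {τ₁ τ₂ : ℍ} {c : ℂ} (hc : c ≠ 0)
    (h2 : gTwo τ₁ = c ^ 4 * gTwo τ₂) (h3 : gThree τ₁ = c ^ 6 * gThree τ₂) :
    ∃ γ : SL(2, ℤ), τ₂ = γ • τ₁ := by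
  obtain ⟨γ, hγ, -⟩ := exists_smul_eq_of_homothety (homothety_of_invariants hc h2 h3)
  exact ⟨γ, hγ⟩

/-- When g₂ vanishes at both points only g₃ has to be matched, and a sixth root provides the
homothety. -/
theorem gTwo_eq_zero_iff (τ : ℍ) : gTwo τ = 0 ↔ ∃ γ : SL(2, ℤ), τ = γ • zeta3 := by
  constructor
  · intro h
    have h3 : gThree τ ≠ 0 := by
      intro h3; exact discr_ne_zero τ (by simp [discr, h, h3])
    have h3' : gThree zeta3 ≠ 0 := by
      intro h3; exact discr_ne_zero zeta3 (by simp [discr, gTwo_zeta3, h3])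
    obtain ⟨c, hc⟩ := IsAlgClosed.exists_pow_nat_eq (gThree zeta3 / gThree τ) (n := 6) (by norm_num)
    refine exists_smul_of_invariants (c := c) ?_ (by rw [h, gTwo_zeta3, mul_zero]) ?_
    · rintro rfl
      exact div_ne_zero h3' h3 (by simpa using hc.symm)
    · rw [hc, div_mul_cancel₀ _ h3]
  · rintro ⟨γ, rfl⟩
    rw [gTwo_smul, gTwo_zeta3, mul_zero]

theorem gThree_eq_zero_iff (τ : ℍ) : gThree τ = 0 ↔ ∃ γ : SL(2, ℤ), τ = γ • zeta4 := by
  constructor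
  · intro h
    have h2 : gTwo τ ≠ 0 := by
      intro h2; exact discr_ne_zero τ (by simp [discr, h, h2])
    have h2' : gTwo zeta4 ≠ 0 := by
      intro h2; exact discr_ne_zero zeta4 (by simp [discr, gThree_zeta4, h2])
    obtain ⟨c, hc⟩ := IsAlgClosed.exists_pow_nat_eq (gTwo zeta4 / gTwo τ) (n := 4) (by norm_num)
    refine exists_smul_of_invariants (c := c) ?_ ?_ (by rw [h, gThree_zeta4, mul_zero])
    · rintro rfl
      exact div_ne_zero h2' h2 (by simpa using hc.symm)
    · rw [hc, div_mul_cancel₀ _ h2]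
  · rintro ⟨γ, rfl⟩
    rw [gThree_smul, gThree_zeta4, mul_zero]

theorem ofUpper_mem_exceptionalPoints_iff (τ : ℍ) :
    ExtendedUpperHalfPlane.ofUpper τ ∈ exceptionalPoints ↔ gTwo τ * gThree τ = 0 := by
  rw [mul_eq_zero, gTwo_eq_zero_iff, gThree_eq_zero_iff]
  simp [exceptionalPoints, exists_or]

/-! ### Separation of points -/

theorem exists_smul_of_vFun_eq {τ₁ τ₂ : ℍ} (h₁ : gTwo τ₁ * gThree τ₁ ≠ 0)
    (h₂ : gTwo τ₂ * gThree τ₂ ≠ 0) (hv : vFun τ₁ = vFun τ₂) : ∃ γ : SL(2, ℤ), τ₂ = γ • τ₁ := by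
  obtain ⟨h21, h31⟩ := mul_ne_zero_iff.mp h₁
  obtain ⟨h22, h32⟩ := mul_ne_zero_iff.mp h₂
  have hsq (τ : ℍ) : vFun τ ^ 2 * discr τ = gThree τ ^ 2 := by
    have := dedekindEta_ne_zero τ
    rw [vFun, ← dedekindEta_pow_eq_discr]
    field_simp
  have hcross : gThree τ₁ ^ 2 * gTwo τ₂ ^ 3 = gThree τ₂ ^ 2 * gTwo τ₁ ^ 3 := by
    have e1 := hsq τ₁
    have e2 := hsq τ₂
    rw [← hv] at e2
    rw [discr] at e1 e2
    linear_combination (gTwo τ₁ ^ 3 - 27 * gThree τ₁ ^ 2) * e2 -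
      (gTwo τ₂ ^ 3 - 27 * gThree τ₂ ^ 2) * e1
  -- A homothety by u multiplies g₃/g₂ by u², which dictates u up to sign; `hcross` makes the fourth
  -- and sixth powers fit.
  obtain ⟨u, hu⟩ := IsAlgClosed.exists_pow_nat_eq
    (gThree τ₁ * gTwo τ₂ / (gTwo τ₁ * gThree τ₂)) (n := 2) (by norm_num)
  refine exists_smul_of_invariants (c := u) ?_ ?_ ?_
  · rintro rfl
    refine div_ne_zero (mul_ne_zero h31 h22) (mul_ne_zero h21 h32) (by simpa using hu.symm)
  · rw [show u ^ 4 = (u ^ 2) ^ 2 by ring, hu]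
    field_simp
    linear_combination -hcross
  · rw [show u ^ 6 = (u ^ 2) ^ 3 by ring, hu]
    field_simp
    linear_combination -hcross

theorem bottomRow_neg (γ : SL(2, ℤ)) : bottomRow (-γ) = -bottomRow γ := by
  ext i; fin_cases i <;> simp [bottomRow]

theorem exists_mem_Gamma14_smul {N : ℕ} (hN : 0 < N) (h4 : 4 ∣ N) {τ₁ τ₂ : ℍ}
    (h₁ : gTwo τ₁ * gThree τ₁ ≠ 0) (h₂ : gTwo τ₂ * gThree τ₂ ≠ 0) (hv : vFun τ₁ = vFun τ₂)
    (hx : xFun 0 (1 / (N : ℚ)) τ₁ = xFun 0 (1 / (N : ℚ)) τ₂)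
    (hy : yFun 0 (1 / (N : ℚ)) τ₁ = yFun 0 (1 / (N : ℚ)) τ₂) :
    ∃ γ ∈ Gamma14 N, τ₂ = γ • τ₁ := by
  have hN4 : 4 ≤ N := Nat.le_of_dvd hN h4
  have hN0 : N ≠ 0 := hN.ne'
  obtain ⟨γ', hγ'⟩ := exists_smul_of_vFun_eq h₁ h₂ hv
  have hnotmem (τ : ℍ) (γ : SL(2, ℤ)) :
      torsionPoint N (bottomRow γ) τ ∉ (latticeOf τ).lattice := by
    rw [torsionPoint_mem_lattice hN0]
    simpa using bottomRow_ne (by omega) γ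
  have hP : torsionP N (bottomRow γ') τ₁ = torsionP N unitRow τ₁ := by
    rw [hγ', xFun_smul, xFun_eq] at hx
    exact (mul_left_cancel₀ (div_ne_zero h₁ (discr_ne_zero τ₁)) hx).symm
  -- The function ℘ determines the torsion point only up to sign; -γ acts on τ like γ and removes
  -- the ambiguity.
  obtain ⟨γ, hγ, v, hrow⟩ : ∃ γ : SL(2, ℤ), τ₂ = γ • τ₁ ∧ ∃ v, bottomRow γ = unitRow + N • v := by
    have hu := hnotmem τ₁ 1
    rw [bottomRow_one] at hu
    rcases weierstrassP_eq_iff (latticeOf τ₁) (hnotmem τ₁ γ') hu hP with h | h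
    · rw [← torsionPoint_add, torsionPoint_mem_lattice hN0] at h
      obtain ⟨v, hv⟩ := h
      refine ⟨-γ', by rw [ModularGroup.SL_neg_smul, hγ'], -v, ?_⟩
      rw [bottomRow_neg, smul_neg, ← hv]
      abel
    · rw [sub_eq_add_neg, ← torsionPoint_neg, ← torsionPoint_add, torsionPoint_mem_lattice hN0] at h
      obtain ⟨v, hv⟩ := h
      exact ⟨γ', hγ', v, by rw [← hv]; abel⟩
  have hχ : etaChar γ = 1 := by
    -- Since N ≥ 4, the point 2/N is not a period. Hence ℘'(1/N) ≠ 0 and can be cancelled from the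
    -- equality of y-values.
    have h2 : 2 * torsionPoint N unitRow τ₁ ∉ (latticeOf τ₁).lattice := by
      have : 2 * torsionPoint N unitRow τ₁ = torsionPoint N (unitRow + unitRow) τ₁ := by
        rw [torsionPoint_add]; ring
      rw [this, torsionPoint_mem_lattice hN0]
      rintro ⟨v, hv⟩
      have := congrFun hv 1
      simp [unitRow] at this
      have h := Int.le_of_dvd (by norm_num) ⟨v 1, this⟩
      omega
    have hD : torsionDerivP N unitRow τ₁ ≠ 0 := derivWeierstrassP_ne_zero _ h2
    have hη := dedekindEta_ne_zero τ₁
    have hχ0 := etaChar_ne_zero γ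
    rw [hγ, yFun_smul (by omega), yFun_eq (by omega), hrow, torsionDerivP_add_smul hN0] at hy
    field_simp at hy
    exact hy
  have hc : γ 1 0 = N * v 0 := by simpa [bottomRow, unitRow] using congrFun hrow 0
  have hd : γ 1 1 = 1 + N * v 1 := by simpa [bottomRow, unitRow] using congrFun hrow 1
  have hdet := det_eq_one γ
  have hmod (M : ℕ) (hM : M ∣ N) : (γ 0 0 : ZMod M) = 1 ∧ (γ 1 0 : ZMod M) = 0 ∧
      (γ 1 1 : ZMod M) = 1 := by
    have hNM : (N : ZMod M) = 0 := (ZMod.natCast_eq_zero_iff N M).mpr hM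
    have hc' : (γ 1 0 : ZMod M) = 0 := by rw [hc]; push_cast; rw [hNM, zero_mul]
    have hd' : (γ 1 1 : ZMod M) = 1 := by rw [hd]; push_cast; rw [hNM, zero_mul, add_zero]
    refine ⟨?_, hc', hd'⟩
    have := congrArg (Int.cast : ℤ → ZMod M) hdet
    push_cast at this
    rw [hc', hd'] at this
    simpa using this
  refine ⟨γ, ⟨?_, ?_⟩, hγ⟩
  · obtain ⟨h1, h2, h3⟩ := hmod N dvd_rfl
    exact (CongruenceSubgroup.Gamma1_mem N γ).mpr ⟨h1, h3, h2⟩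
  · obtain ⟨h1, h2, h3⟩ := hmod 4 h4
    rw [etaChar_of_upper h1 h2 h3] at hχ
    exact CongruenceSubgroup.Gamma_mem.mpr ⟨h1, I_pow_val_eq_one hχ, h2, h3⟩

/-! ### Invariance -/

theorem exists_bottomRow_eq {N : ℕ} {γ : SL(2, ℤ)} (hγ : γ ∈ CongruenceSubgroup.Gamma1 N)
    (δ : SL(2, ℤ)) : ∃ v, bottomRow (γ * δ) = bottomRow δ + N • v := by
  obtain ⟨-, h1, h0⟩ := (CongruenceSubgroup.Gamma1_mem N γ).mp hγ
  obtain ⟨m, hm⟩ := (ZMod.intCast_zmod_eq_zero_iff_dvd (γ 1 0) N).mp h0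
  obtain ⟨n, hn⟩ := (ZMod.intCast_zmod_eq_zero_iff_dvd (γ 1 1 - 1) N).mp
    (by push_cast; rw [h1, sub_self])
  refine ⟨![m * δ 0 0 + n * δ 1 0, m * δ 0 1 + n * δ 1 1], ?_⟩
  have hn' : γ 1 1 = 1 + N * n := by linarith
  ext i
  fin_cases i <;>
  · simp [bottomRow, Matrix.SpecialLinearGroup.coe_mul, Matrix.mul_apply, Fin.sum_univ_two, hm, hn']
    ring

theorem coordinates_smul {N : ℕ} (hN : 2 ≤ N) {γ : SL(2, ℤ)} (hγ : γ ∈ Gamma14 N) (τ : ℍ) :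
    vFun (γ • τ) = vFun τ ∧ xFun 0 (1 / (N : ℚ)) (γ • τ) = xFun 0 (1 / (N : ℚ)) τ ∧
      yFun 0 (1 / (N : ℚ)) (γ • τ) = yFun 0 (1 / (N : ℚ)) τ := by
  obtain ⟨v, hv⟩ := exists_bottomRow_eq hγ.1 1
  rw [mul_one, bottomRow_one] at hv
  refine ⟨?_, ?_, ?_⟩
  · rw [vFun_smul, etaChar_of_mem_Gamma hγ.2, one_pow, div_one]
  · rw [xFun_smul, hv, torsionP_add_smul (by omega), xFun_eq]
  · rw [yFun_smul hN, hv, torsionDerivP_add_smul (by omega), etaChar_of_mem_Gamma hγ.2, one_mul,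
      yFun_eq hN]

end Coordinates

section ProjectiveSpace

open Filter

/-! ### Affine charts of projective space -/

theorem continuous_projectivization_mk :
    Continuous fun w : {w : Fin 4 → ℂ // w ≠ 0} => (Projectivization.mk ℂ w.1 w.2 : P3) :=
  continuous_coinduced_rng

/-- The point `[a : 1 : b : c]`. -/
def cuspPoint (a b c : ℂ) : P3 :=
  Projectivization.mk ℂ ![a, 1, b, c] fun h => one_ne_zero (congrFun h 1)

theorem continuous_affinePoint :
    Continuous fun p : ℂ × ℂ × ℂ => affinePoint p.1 p.2.1 p.2.2 := by
  refine continuous_projectivization_mk.comp (Continuous.subtype_mk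
    (f := fun p : ℂ × ℂ × ℂ => ![p.1, p.2.1, p.2.2, 1]) ?_
    fun p h => one_ne_zero (congrFun h 3))
  refine continuous_pi fun i => ?_
  fin_cases i <;> simp <;> fun_prop

theorem continuous_cuspPoint :
    Continuous fun p : ℂ × ℂ × ℂ => cuspPoint p.1 p.2.1 p.2.2 := by
  refine continuous_projectivization_mk.comp (Continuous.subtype_mk
    (f := fun p : ℂ × ℂ × ℂ => ![p.1, 1, p.2.1, p.2.2]) ?_
    fun p h => one_ne_zero (congrFun h 1))
  refine continuous_pi fun i => ?_
  fin_cases i <;> simp <;> fun_prop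

theorem affinePoint_eq_cuspPoint {v x y : ℂ} (hx : x ≠ 0) :
    affinePoint v x y = cuspPoint (v / x) (y / x) (1 / x) := by
  refine (Projectivization.mk_eq_mk_iff' ℂ _ _ _ _).mpr ⟨x, ?_⟩
  ext i
  fin_cases i <;> simp <;> field_simp

/-- The affine chart carries the induced topology; this lets continuity of the inverse be checked in
the coordinates (v, x, y). -/
theorem comap_affinePoint_nhds_le (p : ℂ × ℂ × ℂ) :
    comap (fun p : ℂ × ℂ × ℂ => affinePoint p.1 p.2.1 p.2.2)
      (𝓝 (affinePoint p.1 p.2.1 p.2.2)) ≤ 𝓝 p := by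
  intro V hV
  obtain ⟨V', hV', hV'o, hpV'⟩ := mem_nhds_iff.mp hV
  let φ : (Fin 4 → ℂ) → ℂ × ℂ × ℂ := fun w => (w 0 / w 3, w 1 / w 3, w 2 / w 3)
  have hφ : ContinuousOn φ {w | w 3 ≠ 0} := by
    refine ContinuousOn.prodMk ?_ (ContinuousOn.prodMk ?_ ?_) <;>
    exact ContinuousOn.div (by fun_prop) (by fun_prop) fun w hw => hw
  have hopen : IsOpen ({w : Fin 4 → ℂ | w 3 ≠ 0} ∩ φ ⁻¹' V') :=
    hφ.isOpen_inter_preimage (isOpen_ne_fun (by fun_prop) (by fun_prop)) hV'o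
  -- The representative is an arbitrary choice, but both conditions are invariant under scaling.
  let O : Set P3 := {P | P.rep 3 ≠ 0 ∧ φ P.rep ∈ V'}
  have hO (w : Fin 4 → ℂ) (hw : w ≠ 0) :
      Projectivization.mk ℂ w hw ∈ O ↔ w ∈ {w : Fin 4 → ℂ | w 3 ≠ 0} ∩ φ ⁻¹' V' := by
    obtain ⟨a, ha⟩ := Projectivization.exists_smul_eq_mk_rep ℂ w hw
    have hc : ∀ i, (Projectivization.mk ℂ w hw).rep i = (a : ℂ) * w i := fun i => by
      rw [← ha]; rfl
    have ha0 : (a : ℂ) ≠ 0 := a.ne_zero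
    simp only [O, φ, Set.mem_ofPred_eq, hc, mul_div_mul_left _ _ ha0, Set.mem_inter_iff,
      Set.mem_preimage, mul_ne_zero_iff, ha0, ne_eq, not_false_eq_true, true_and]
  have hOo : IsOpen O := by
    rw [isOpen_coinduced]
    have : (fun w : {w : Fin 4 → ℂ // w ≠ 0} => (Projectivization.mk ℂ w.1 w.2 : P3)) ⁻¹' O =
        Subtype.val ⁻¹' ({w : Fin 4 → ℂ | w 3 ≠ 0} ∩ φ ⁻¹' V') := by
      ext w
      exact hO w.1 w.2
    rw [this]
    exact hopen.preimage continuous_subtype_val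
  have hmem (q : ℂ × ℂ × ℂ) : affinePoint q.1 q.2.1 q.2.2 ∈ O ↔ q ∈ V' := by
    rw [affinePoint, hO]
    simp [φ]
  exact mem_comap.mpr ⟨O, hOo.mem_nhds ((hmem p).mpr hpV'), fun q hq => hV' ((hmem q).mp hq)⟩

end ProjectiveSpace

section Holomorphy

open Filter

open UpperHalfPlane hiding I

open scoped Manifold

/-! ### Holomorphy of the coordinate functions -/

theorem analyticAt_of_mdifferentiable {f : ℍ → ℂ} (hf : MDiff f) (τ : ℍ) :
    AnalyticAt ℂ (f ∘ ofComplex) τ :=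
  (UpperHalfPlane.mdifferentiable_iff.mp hf).analyticAt (isOpen_upperHalfPlaneSet.mem_nhds τ.2)

theorem mdifferentiable_of_differentiableAt {f : ℍ → ℂ}
    (hf : ∀ τ : ℍ, DifferentiableAt ℂ (f ∘ ofComplex) τ) : MDiff f := by
  intro τ
  exact mdifferentiableAt_iff.mpr (hf τ)

theorem differentiableAt_of_mdifferentiable {f : ℍ → ℂ} (hf : MDiff f) (τ : ℍ) :
    DifferentiableAt ℂ (f ∘ ofComplex) τ :=
  mdifferentiableAt_iff.mp (hf τ)

theorem mdifferentiable_vFun : MDiff vFun := by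
  refine mdifferentiable_of_differentiableAt fun τ => ?_
  have h1 := differentiableAt_of_mdifferentiable mdifferentiable_gThree τ
  have h2 := differentiableAt_of_mdifferentiable mdifferentiable_dedekindEta τ
  exact h1.div (h2.pow 12) (pow_ne_zero 12 (dedekindEta_ne_zero _))

theorem mdifferentiable_discr : MDiff discr := by
  refine mdifferentiable_of_differentiableAt fun τ => ?_
  have h1 := differentiableAt_of_mdifferentiable mdifferentiable_gTwo τ
  have h2 := differentiableAt_of_mdifferentiable mdifferentiable_gThree τ
  exact (h1.pow 3).sub ((h2.pow 2).const_mul 27)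

theorem mdifferentiable_xFun {N : ℕ} (hN : 2 ≤ N) : MDiff (xFun 0 (1 / (N : ℚ))) := by
  refine mdifferentiable_of_differentiableAt fun τ => ?_
  rw [show xFun 0 (1 / (N : ℚ)) = _ from funext (xFun_eq N)]
  have h1 := differentiableAt_of_mdifferentiable mdifferentiable_gTwo τ
  have h2 := differentiableAt_of_mdifferentiable mdifferentiable_gThree τ
  have h3 := differentiableAt_of_mdifferentiable mdifferentiable_discr τ
  have h4 := differentiableAt_of_mdifferentiable
    (mdifferentiable_torsionP (by omega) (unitRow_ne hN)) τ
  exact ((h1.mul h2).div h3 (discr_ne_zero _)).mul h4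

theorem mdifferentiable_yFun {N : ℕ} (hN : 2 ≤ N) : MDiff (yFun 0 (1 / (N : ℚ))) := by
  refine mdifferentiable_of_differentiableAt fun τ => ?_
  rw [show yFun 0 (1 / (N : ℚ)) = _ from funext (yFun_eq hN)]
  have h1 := differentiableAt_of_mdifferentiable mdifferentiable_dedekindEta τ
  have h2 := differentiableAt_of_mdifferentiable
    (mdifferentiable_torsionDerivP (by omega) (unitRow_ne hN)) τ
  exact h2.div (h1.pow 6) (pow_ne_zero 6 (dedekindEta_ne_zero _))

/-- The affine coordinates `(v, x, y)`. -/
def coordinates (N : ℕ) (τ : ℍ) : ℂ × ℂ × ℂ :=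
  (vFun τ, xFun 0 (1 / (N : ℚ)) τ, yFun 0 (1 / (N : ℚ)) τ)

theorem continuous_coordinates {N : ℕ} (hN : 2 ≤ N) : Continuous (coordinates N) :=
  mdifferentiable_vFun.continuous.prodMk
    ((mdifferentiable_xFun hN).continuous.prodMk (mdifferentiable_yFun hN).continuous)

theorem coordinates_smul_of_mem {N : ℕ} (hN : 2 ≤ N) {γ : SL(2, ℤ)} (hγ : γ ∈ Gamma14 N) (τ : ℍ) :
    coordinates N (γ • τ) = coordinates N τ := by
  obtain ⟨h1, h2, h3⟩ := coordinates_smul hN hγ τ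
  rw [coordinates, coordinates, h1, h2, h3]

theorem map_vFun_nhds {τ : ℍ} (hτ : gTwo τ ≠ 0) : map vFun (𝓝 τ) = 𝓝 (vFun τ) := by
  obtain ⟨c, hc, hd⟩ := exists_hasDerivAt_vFun
  have h1 : HasStrictDerivAt (vFun ∘ ofComplex) (c * gTwo τ ^ 2 / dedekindEta τ ^ 12) τ := by
    have := (analyticAt_of_mdifferentiable mdifferentiable_vFun τ).hasStrictDerivAt
    rwa [(hd τ).deriv] at this
  have h2 := h1.map_nhds_eq (div_ne_zero (mul_ne_zero hc (pow_ne_zero 2 hτ))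
    (pow_ne_zero 12 (dedekindEta_ne_zero τ)))
  rw [← isOpenEmbedding_coe.map_nhds_eq, Filter.map_map] at h2
  simpa [Function.comp_def] using h2

/-- The homogeneous coordinates `(v, x, y, 1)` as functions on `ℂ`. -/
def affineLift (N : ℕ) (z : ℂ) : Fin 4 → ℂ :=
  ![vFun (ofComplex z), xFun 0 (1 / (N : ℚ)) (ofComplex z), yFun 0 (1 / (N : ℚ)) (ofComplex z), 1]

theorem analyticAt_affineLift {N : ℕ} (hN : 2 ≤ N) (τ : ℍ) : AnalyticAt ℂ (affineLift N) τ := by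
  refine analyticAt_pi_iff (f := fun i z => affineLift N z i) |>.mpr fun i => ?_
  fin_cases i
  · exact analyticAt_of_mdifferentiable mdifferentiable_vFun τ
  · exact analyticAt_of_mdifferentiable (mdifferentiable_xFun hN) τ
  · exact analyticAt_of_mdifferentiable (mdifferentiable_yFun hN) τ
  · exact analyticAt_const

/-- The last homogeneous coordinate is the constant 1, so independence reduces to v' ≠ 0. -/
theorem linearIndependent_affineLift {N : ℕ} (hN : 2 ≤ N) {τ : ℍ} (hτ : gTwo τ ≠ 0) :
    LinearIndependent ℂ ![affineLift N τ, deriv (affineLift N) τ] := by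
  obtain ⟨c, hc, hd⟩ := exists_hasDerivAt_vFun
  have hdiff := (analyticAt_affineLift hN τ).differentiableAt
  have hderiv : deriv (affineLift N) τ = fun i => deriv (fun z => affineLift N z i) τ :=
    deriv_pi fun i => differentiableAt_pi.mp hdiff i
  have h3 : deriv (affineLift N) τ 3 = 0 := by
    rw [hderiv]
    exact deriv_const _ _
  have h0 : deriv (affineLift N) τ 0 = c * gTwo τ ^ 2 / dedekindEta τ ^ 12 := by
    rw [hderiv]
    exact (hd τ).deriv
  refine LinearIndependent.pair_iff.mpr fun s t h => ?_
  have e3 := congrFun h 3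
  have e0 := congrFun h 0
  simp only [Pi.add_apply, Pi.smul_apply, smul_eq_mul, h3, h0, Pi.zero_apply, mul_zero,
    add_zero] at e3 e0
  have hs : s = 0 := by simpa [affineLift] using e3
  rw [hs, zero_mul, zero_add] at e0
  exact ⟨hs, (mul_eq_zero.mp e0).resolve_right (div_ne_zero (mul_ne_zero hc (pow_ne_zero 2 hτ))
    (pow_ne_zero 12 (dedekindEta_ne_zero τ)))⟩

end Holomorphy

section Cusps

open Filter Function

open UpperHalfPlane hiding I

open scoped Manifold

/-! ### Behaviour at the cusps -/

theorem Gamma_le_Gamma14 {N : ℕ} (h4 : 4 ∣ N) : CongruenceSubgroup.Gamma N ≤ Gamma14 N := by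
  intro γ hγ
  have h (M : ℕ) (hM : M ∣ N) : (γ 0 0 : ZMod M) = 1 ∧ (γ 0 1 : ZMod M) = 0 ∧
      (γ 1 0 : ZMod M) = 0 ∧ (γ 1 1 : ZMod M) = 1 := by
    obtain ⟨h1, h2, h3, h4⟩ := CongruenceSubgroup.Gamma_mem.mp hγ
    have key (z w : ℤ) (hz : (z : ZMod N) = w) : (z : ZMod M) = w := by
      rw [ZMod.intCast_eq_intCast_iff_dvd_sub] at hz ⊢
      exact (Int.natCast_dvd_natCast.mpr hM).trans hz
    refine ⟨?_, ?_, ?_, ?_⟩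
    · simpa using key _ 1 (by simpa using h1)
    · simpa using key _ 0 (by simpa using h2)
    · simpa using key _ 0 (by simpa using h3)
    · simpa using key _ 1 (by simpa using h4)
  refine ⟨(CongruenceSubgroup.Gamma1_mem N γ).mpr ?_, CongruenceSubgroup.Gamma_mem.mpr (h 4 h4)⟩
  obtain ⟨h1, -, h3, h4⟩ := h N dvd_rfl
  exact ⟨h1, h4, h3⟩

/-- The infimum is attained because the set contains N: T^N lies in the normal subgroup Γ(N), which
is contained in Γ_{1,4}(N). -/
theorem cuspWidth_spec {N : ℕ} (hN : 0 < N) (h4 : 4 ∣ N) (α : SL(2, ℤ)) :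
    0 < cuspWidth (Gamma14 N) α ∧
      (α * ModularGroup.T ^ cuspWidth (Gamma14 N) α * α⁻¹ ∈ Gamma14 N ∨
        -(α * ModularGroup.T ^ cuspWidth (Gamma14 N) α * α⁻¹) ∈ Gamma14 N) := by
  refine Nat.sInf_mem (s := {h : ℕ | 0 < h ∧ (α * ModularGroup.T ^ h * α⁻¹ ∈ Gamma14 N ∨
    -(α * ModularGroup.T ^ h * α⁻¹) ∈ Gamma14 N)}) ⟨N, hN, Or.inl (Gamma_le_Gamma14 h4 ?_)⟩
  refine (CongruenceSubgroup.Gamma_normal (N := N)).conj_mem _ ?_ α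
  rw [CongruenceSubgroup.Gamma_mem]
  have := ModularGroup.coe_T_zpow N
  rw [zpow_natCast] at this
  simp [this]

theorem coordinates_smul_vadd {N : ℕ} (hN : 0 < N) (h4 : 4 ∣ N) (α : SL(2, ℤ)) (τ : ℍ) :
    coordinates N (α • ((cuspWidth (Gamma14 N) α : ℝ) +ᵥ τ)) = coordinates N (α • τ) := by
  have hN2 : 2 ≤ N := by have := Nat.le_of_dvd hN h4; omega
  set h := cuspWidth (Gamma14 N) α
  have h1 : α • ((h : ℝ) +ᵥ τ) = (α * ModularGroup.T ^ h * α⁻¹) • α • τ := by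
    have := modular_T_zpow_smul τ h
    rw [zpow_natCast, Int.cast_natCast] at this
    rw [← this, ← mul_smul, ← mul_smul, inv_mul_cancel_right]
  rw [h1]
  rcases (cuspWidth_spec hN h4 α).2 with hm | hm
  · exact coordinates_smul_of_mem hN2 hm _
  · rw [← ModularGroup.SL_neg_smul]
    exact coordinates_smul_of_mem hN2 hm _

theorem periodic_comp_ofComplex_of_vadd {f : ℍ → ℂ} {h : ℝ} (hf : ∀ τ : ℍ, f (h +ᵥ τ) = f τ) :
    Periodic (f ∘ ofComplex) h := by
  intro w
  by_cases hw : 0 < w.im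
  · have hw' : 0 < (w + h).im := by simpa using hw
    rw [Function.comp_apply, Function.comp_apply, ofComplex_apply_of_im_pos hw,
      ofComplex_apply_of_im_pos hw', ← hf ⟨w, hw⟩]
    congr 1
    ext1
    simp [add_comm]
  -- Outside the upper half-plane `ofComplex` takes one default value, so periodicity holds there as
  -- well.
  · have hw' : ¬ 0 < (w + h).im := by simpa using hw
    rw [Function.comp_apply, Function.comp_apply, ofComplex_apply_of_im_nonpos (not_lt.mp hw),
      ofComplex_apply_of_im_nonpos (not_lt.mp hw')]

/-- The denominator `g₂ g₃ ℘` in the local description of the coordinates at the cusp `α(∞)`. -/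
def cuspDenominator (N : ℕ) (α : SL(2, ℤ)) (τ : ℍ) : ℂ :=
  gTwo τ * gThree τ * torsionP N (bottomRow α) τ

theorem mdifferentiable_cuspDenominator {N : ℕ} (hN : 2 ≤ N) (α : SL(2, ℤ)) :
    MDiff (cuspDenominator N α) :=
  (mdifferentiable_gTwo.mul mdifferentiable_gThree).mul
    (mdifferentiable_torsionP (by omega) (bottomRow_ne hN α))

theorem exists_le_norm_cuspDenominator {N : ℕ} (hN : 2 ≤ N) (α : SL(2, ℤ)) :
    ∃ δ > 0, ∀ᶠ τ in atImInfty, δ ≤ ‖cuspDenominator N α τ‖ := by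
  obtain ⟨δ, hδ, h⟩ := exists_le_norm_torsionP (N := N) (by omega) (bottomRow_ne hN α)
  have hlim := (tendsto_gTwo.mul tendsto_gThree).norm
  have hπ : (Real.pi : ℂ) ≠ 0 := mod_cast Real.pi_ne_zero
  set M := ‖(4 * Real.pi ^ 4 / 3 * (8 * Real.pi ^ 6 / 27) : ℂ)‖
  have hM : 0 < M := norm_pos_iff.mpr (by simp [hπ])
  refine ⟨M / 2 * δ, by positivity, ?_⟩
  filter_upwards [h, hlim.eventually (lt_mem_nhds (half_lt_self hM))] with τ h1 h2
  rw [cuspDenominator, norm_mul]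
  exact mul_le_mul h2.le h1 hδ.le (norm_nonneg _)

theorem eventually_cuspDenominator_ne_zero {N : ℕ} (hN : 2 ≤ N) (α : SL(2, ℤ)) :
    ∀ᶠ τ in atImInfty, cuspDenominator N α τ ≠ 0 := by
  obtain ⟨δ, hδ, h⟩ := exists_le_norm_cuspDenominator hN α
  filter_upwards [h] with τ hτ
  exact norm_pos_iff.mp (hδ.trans_le hτ)

theorem tendsto_div_cuspDenominator {N : ℕ} (hN : 2 ≤ N) (α : SL(2, ℤ)) {f : ℍ → ℂ}
    (hf : Tendsto f atImInfty (𝓝 0)) :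
    Tendsto (fun τ => f τ / cuspDenominator N α τ) atImInfty (𝓝 0) := by
  obtain ⟨δ, hδ, h⟩ := exists_le_norm_cuspDenominator hN α
  rw [tendsto_zero_iff_norm_tendsto_zero] at hf
  refine squeeze_zero_norm' ?_ (by simpa using hf.div_const δ)
  filter_upwards [h] with τ hτ
  rw [norm_div]
  exact div_le_div_of_nonneg_left (norm_nonneg _) hδ hτ

/-- Removable singularity in q: the quotient is holomorphic high up and tends to 0. Periodicity is
asked of the quotient alone, since that is what invariance of the coordinates supplies. -/
theorem analyticAt_cuspFunction_div {N : ℕ} (hN : 2 ≤ N) (α : SL(2, ℤ)) {f : ℍ → ℂ}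
    (hf : MDiff f) (hf0 : Tendsto f atImInfty (𝓝 0)) {h : ℝ} (hh : 0 < h)
    (hper : ∀ τ : ℍ, f (h +ᵥ τ) / cuspDenominator N α (h +ᵥ τ) = f τ / cuspDenominator N α τ) :
    AnalyticAt ℂ (Periodic.cuspFunction h ((fun τ => f τ / cuspDenominator N α τ) ∘ ofComplex)) 0 ∧
      Periodic.cuspFunction h ((fun τ => f τ / cuspDenominator N α τ) ∘ ofComplex) 0 = 0 := by
  set g : ℍ → ℂ := fun τ => f τ / cuspDenominator N α τ
  have hP : Periodic (g ∘ ofComplex) h := periodic_comp_ofComplex_of_vadd hper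
  have hz : ZeroAtFilter (comap Complex.im atTop) (g ∘ ofComplex) :=
    (tendsto_div_cuspDenominator hN α hf0).comp tendsto_comap_im_ofComplex
  have hd : ∀ᶠ z in comap Complex.im atTop, DifferentiableAt ℂ (g ∘ ofComplex) z := by
    filter_upwards [tendsto_comap_im_ofComplex.eventually (eventually_cuspDenominator_ne_zero hN α),
      tendsto_comap.eventually (eventually_gt_atTop (0 : ℝ))] with z hz1 hz2
    exact (differentiableAt_of_mdifferentiable hf ⟨z, hz2⟩).div
      (differentiableAt_of_mdifferentiable (mdifferentiable_cuspDenominator hN α) ⟨z, hz2⟩) hz1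
  refine ⟨Complex.analyticAt_iff_eventually_differentiableAt.mpr ?_,
    Periodic.cuspFunction_zero_of_zero_at_inf hh hz⟩
  have h0 := Periodic.differentiableAt_cuspFunction_zero hh hP hd hz.boundedAtFilter
  have h1 := eventually_nhdsWithin_iff.mp
    (Periodic.eventually_differentiableAt_cuspFunction_nhds_ne_zero hh hP hd)
  filter_upwards [h1] with q hq
  rcases eq_or_ne q 0 with rfl | hq0
  · exact h0
  · exact hq hq0

/-- The numerator of `v / x` at the cusp `α(∞)`. -/
def cuspNumV (α : SL(2, ℤ)) (τ : ℍ) : ℂ := gThree τ * dedekindEta τ ^ 12 / etaChar α ^ 2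

/-- The numerator of `y / x` at the cusp `α(∞)`. -/
def cuspNumY (N : ℕ) (α : SL(2, ℤ)) (τ : ℍ) : ℂ :=
  torsionDerivP N (bottomRow α) τ * dedekindEta τ ^ 18 / etaChar α

theorem xFun_smul_eq (N : ℕ) (α : SL(2, ℤ)) (τ : ℍ) :
    xFun 0 (1 / (N : ℚ)) (α • τ) = cuspDenominator N α τ / discr τ := by
  rw [xFun_smul, cuspDenominator]
  ring

theorem vFun_div_xFun (N : ℕ) (α : SL(2, ℤ)) (τ : ℍ) :
    vFun (α • τ) / xFun 0 (1 / (N : ℚ)) (α • τ) = cuspNumV α τ / cuspDenominator N α τ := by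
  have h := dedekindEta_ne_zero τ
  have hχ := etaChar_ne_zero α
  rw [xFun_smul_eq, vFun_smul, vFun, cuspNumV, ← dedekindEta_pow_eq_discr, div_div_eq_mul_div]
  congr 1
  field_simp

theorem yFun_div_xFun {N : ℕ} (hN : 2 ≤ N) (α : SL(2, ℤ)) (τ : ℍ) :
    yFun 0 (1 / (N : ℚ)) (α • τ) / xFun 0 (1 / (N : ℚ)) (α • τ) =
      cuspNumY N α τ / cuspDenominator N α τ := by
  have h := dedekindEta_ne_zero τ
  have hχ := etaChar_ne_zero α
  rw [xFun_smul_eq, yFun_smul hN, cuspNumY, ← dedekindEta_pow_eq_discr, div_div_eq_mul_div]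
  congr 1
  field_simp

theorem one_div_xFun (N : ℕ) (α : SL(2, ℤ)) (τ : ℍ) :
    1 / xFun 0 (1 / (N : ℚ)) (α • τ) = discr τ / cuspDenominator N α τ := by
  rw [xFun_smul_eq, one_div_div]

theorem mdifferentiable_cuspNumV (α : SL(2, ℤ)) : MDiff (cuspNumV α) := by
  refine mdifferentiable_of_differentiableAt fun τ => ?_
  exact ((differentiableAt_of_mdifferentiable mdifferentiable_gThree τ).mul
    ((differentiableAt_of_mdifferentiable mdifferentiable_dedekindEta τ).pow 12)).div_const _

theorem mdifferentiable_cuspNumY {N : ℕ} (hN : 2 ≤ N) (α : SL(2, ℤ)) : MDiff (cuspNumY N α) := by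
  refine mdifferentiable_of_differentiableAt fun τ => ?_
  exact ((differentiableAt_of_mdifferentiable
    (mdifferentiable_torsionDerivP (by omega) (bottomRow_ne hN α)) τ).mul
    ((differentiableAt_of_mdifferentiable mdifferentiable_dedekindEta τ).pow 18)).div_const _

theorem tendsto_cuspNumV (α : SL(2, ℤ)) : Tendsto (cuspNumV α) atImInfty (𝓝 0) := by
  have h := (tendsto_gThree.mul (tendsto_dedekindEta.pow 12)).div_const (etaChar α ^ 2)
  simpa using! h

theorem tendsto_cuspNumY {N : ℕ} (hN : 2 ≤ N) (α : SL(2, ℤ)) :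
    Tendsto (cuspNumY N α) atImInfty (𝓝 0) := by
  obtain ⟨l, hl⟩ := tendsto_torsionDerivP (N := N) (by omega) (bottomRow α)
  have h := (hl.mul (tendsto_dedekindEta.pow 18)).div_const (etaChar α)
  simpa using! h

theorem affinePoint_eq_cuspPoint_of_ne {N : ℕ} (hN : 2 ≤ N) {α : SL(2, ℤ)} {τ : ℍ}
    (h : cuspDenominator N α τ ≠ 0) :
    affinePoint (vFun (α • τ)) (xFun 0 (1 / (N : ℚ)) (α • τ)) (yFun 0 (1 / (N : ℚ)) (α • τ)) =
      cuspPoint (cuspNumV α τ / cuspDenominator N α τ) (cuspNumY N α τ / cuspDenominator N α τ)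
        (discr τ / cuspDenominator N α τ) := by
  have hx : xFun 0 (1 / (N : ℚ)) (α • τ) ≠ 0 := by
    rw [xFun_smul_eq]
    exact div_ne_zero h (discr_ne_zero τ)
  rw [affinePoint_eq_cuspPoint hx, vFun_div_xFun, yFun_div_xFun hN, one_div_xFun]

/-- The homogeneous coordinates near the cusp `α(∞)` as functions of the local parameter. -/
def cuspLift (N : ℕ) (α : SL(2, ℤ)) (h : ℝ) (q : ℂ) : Fin 4 → ℂ :=
  ![Periodic.cuspFunction h ((fun τ => cuspNumV α τ / cuspDenominator N α τ) ∘ ofComplex) q, 1,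
    Periodic.cuspFunction h ((fun τ => cuspNumY N α τ / cuspDenominator N α τ) ∘ ofComplex) q,
    Periodic.cuspFunction h ((fun τ => discr τ / cuspDenominator N α τ) ∘ ofComplex) q]

theorem analyticAt_cuspLift {N : ℕ} (hN : 0 < N) (h4 : 4 ∣ N) (α : SL(2, ℤ)) :
    AnalyticAt ℂ (cuspLift N α (cuspWidth (Gamma14 N) α)) 0 ∧
      cuspLift N α (cuspWidth (Gamma14 N) α) 0 = ![0, 1, 0, 0] := by
  have hN2 : 2 ≤ N := by have := Nat.le_of_dvd hN h4; omega
  have hh : (0 : ℝ) < cuspWidth (Gamma14 N) α := mod_cast (cuspWidth_spec hN h4 α).1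
  have hc (τ : ℍ) := coordinates_smul_vadd hN h4 α τ
  simp only [coordinates, Prod.mk.injEq] at hc
  have hV := analyticAt_cuspFunction_div hN2 α (mdifferentiable_cuspNumV α) (tendsto_cuspNumV α) hh
    fun τ => by rw [← vFun_div_xFun, ← vFun_div_xFun, (hc τ).1, (hc τ).2.1]
  have hY := analyticAt_cuspFunction_div hN2 α (mdifferentiable_cuspNumY hN2 α)
    (tendsto_cuspNumY hN2 α) hh
    fun τ => by rw [← yFun_div_xFun hN2, ← yFun_div_xFun hN2, (hc τ).2.2, (hc τ).2.1]
  have hZ := analyticAt_cuspFunction_div hN2 α mdifferentiable_discr tendsto_discr hh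
    fun τ => by rw [← one_div_xFun, ← one_div_xFun, (hc τ).2.1]
  constructor
  · refine analyticAt_pi_iff
      (f := fun i q => cuspLift N α (cuspWidth (Gamma14 N) α) q i) |>.mpr fun i => ?_
    fin_cases i
    · exact hV.1
    · exact analyticAt_const
    · exact hY.1
    · exact hZ.1
  · rw [cuspLift, hV.2, hY.2, hZ.2]

/-! ### The map to projective space -/

/-- The map `ℍ* → ℙ³(ℂ)`. -/
def extendedMap (N : ℕ) : ExtendedUpperHalfPlane → P3
  | .ofUpper τ =>
    affinePoint (vFun τ) (xFun 0 (1 / (N : ℚ)) τ) (yFun 0 (1 / (N : ℚ)) τ)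
  | .cusp _ => cuspPoint 0 0 0

theorem extendedMap_ofUpper (N : ℕ) (τ : ℍ) : extendedMap N (.ofUpper τ) =
    affinePoint (coordinates N τ).1 (coordinates N τ).2.1 (coordinates N τ).2.2 := rfl

theorem continuous_extendedMap {N : ℕ} (hN : 2 ≤ N) : Continuous (extendedMap N) := by
  refine continuous_def.mpr fun O hO => ⟨?_, fun α hα => ?_⟩
  · exact hO.preimage (continuous_affinePoint.comp (continuous_coordinates hN))
  · have h0 : cuspPoint 0 0 0 ∈ O := hα
    have hlim := (tendsto_div_cuspDenominator hN α (tendsto_cuspNumV α)).prodMk_nhds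
      ((tendsto_div_cuspDenominator hN α (tendsto_cuspNumY hN α)).prodMk_nhds
        (tendsto_div_cuspDenominator hN α tendsto_discr))
    have hev := ((continuous_cuspPoint.tendsto _).comp hlim).eventually (hO.mem_nhds h0)
    obtain ⟨A, hA⟩ := (atImInfty_mem _).mp (hev.and (eventually_cuspDenominator_ne_zero hN α))
    refine ⟨A, fun τ hτ => ?_⟩
    obtain ⟨h1, h2⟩ := hA τ hτ.le
    change affinePoint _ _ _ ∈ O
    rw [affinePoint_eq_cuspPoint_of_ne hN h2]
    exact h1

theorem ofUpper_smul (γ : SL(2, ℤ)) (τ : ℍ) :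
    γ • ExtendedUpperHalfPlane.ofUpper τ = .ofUpper (γ • τ) := rfl

theorem extendedMap_smul {N : ℕ} (hN : 2 ≤ N) {γ : SL(2, ℤ)} (hγ : γ ∈ Gamma14 N)
    (p : ExtendedUpperHalfPlane) : extendedMap N (γ • p) = extendedMap N p := by
  cases p with
  | ofUpper τ => rw [ofUpper_smul, extendedMap_ofUpper, coordinates_smul_of_mem hN hγ,
      extendedMap_ofUpper]
  | cusp c => rfl

/-- The map `Γ_{1,4}(N) \ ℍ* → ℙ³(ℂ)`. -/
def curveMap {N : ℕ} (hN : 2 ≤ N) : ModularCurve (Gamma14 N) → P3 :=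
  Quotient.lift (extendedMap N) fun p q h => by
    obtain ⟨γ, rfl⟩ := MulAction.orbitRel_apply.mp h
    exact extendedMap_smul hN γ.2 q

theorem curveMap_proj {N : ℕ} (hN : 2 ≤ N) (p : ExtendedUpperHalfPlane) :
    curveMap hN (proj (Gamma14 N) p) = extendedMap N p := rfl

theorem continuous_curveMap {N : ℕ} (hN : 2 ≤ N) : Continuous (curveMap hN) :=
  (continuous_extendedMap hN).quotient_lift _

theorem curveMap_mem_surface {N : ℕ} (hN : 2 ≤ N) (p : ModularCurve (Gamma14 N)) :
    curveMap hN p ∈ surface := by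
  induction p using Quotient.inductionOn with
  | h p =>
    cases p with
    | ofUpper τ => exact (mk_mem_surface _ _).mpr (surfaceEquation_coordinates hN τ)
    | cusp c =>
      refine (mk_mem_surface _ _).mpr ?_
      simp [SurfaceEquation]

theorem isLiftAt_upperParam {N : ℕ} (hN : 2 ≤ N) (τ : ℍ) :
    IsLiftAt (affineLift N) (curveMap hN ∘ upperParam (Gamma14 N)) τ :=
  ⟨analyticAt_affineLift hN τ, .of_forall fun _ => ⟨fun h => one_ne_zero (congrFun h 3), rfl⟩⟩

theorem isLiftAt_cuspParam {N : ℕ} (hN : 2 ≤ N) (hN0 : 0 < N) (h4 : 4 ∣ N) (α : SL(2, ℤ)) :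
    IsLiftAt (cuspLift N α (cuspWidth (Gamma14 N) α)) (curveMap hN ∘ cuspParam (Gamma14 N) α) 0 := by
  obtain ⟨hA, h0⟩ := analyticAt_cuspLift hN0 h4 α
  have hh : (0 : ℝ) < cuspWidth (Gamma14 N) α := mod_cast (cuspWidth_spec hN0 h4 α).1
  refine ⟨hA, ?_⟩
  have hev := eventually_nhdsWithin_iff.mp ((Periodic.invQParam_tendsto hh).eventually
    (tendsto_comap_im_ofComplex.eventually (eventually_cuspDenominator_ne_zero hN α)))
  filter_upwards [hev] with q hq
  refine ⟨fun h => one_ne_zero (congrFun h 1), ?_⟩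
  rcases eq_or_ne q 0 with rfl | hq0
  · simp only [h0]
    rw [Function.comp_apply, cuspParam, if_pos rfl]
    rfl
  · have h1 := hq hq0
    rw [Function.comp_apply, cuspParam, if_neg hq0, curveMap_proj]
    refine (affinePoint_eq_cuspPoint_of_ne hN h1).trans ?_
    simp only [cuspLift, Periodic.cuspFunction_eq_of_nonzero _ _ hq0]
    rfl

theorem isHolomorphic_curveMap {N : ℕ} (hN : 2 ≤ N) (hN0 : 0 < N) (h4 : 4 ∣ N) :
    IsHolomorphic (Gamma14 N) (curveMap hN) :=
  ⟨continuous_curveMap hN, fun τ => ⟨_, isLiftAt_upperParam hN τ⟩,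
    fun α => ⟨_, isLiftAt_cuspParam hN hN0 h4 α⟩⟩

end Cusps

section Embedding

open Filter

open UpperHalfPlane hiding I

/-! ### The embedding -/

theorem proj_smul {N : ℕ} {γ : SL(2, ℤ)} (hγ : γ ∈ Gamma14 N) (τ : ℍ) :
    proj (Gamma14 N) (.ofUpper (γ • τ)) = proj (Gamma14 N) (.ofUpper τ) :=
  Quotient.sound (MulAction.orbitRel_apply.mpr ⟨⟨γ, hγ⟩, rfl⟩)

theorem continuous_proj (Γ : Subgroup SL(2, ℤ)) : Continuous (proj Γ) := continuous_coinduced_rng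

theorem continuous_proj_ofUpper (Γ : Subgroup SL(2, ℤ)) :
    Continuous fun τ : ℍ => proj Γ (.ofUpper τ) :=
  (continuous_proj Γ).comp (continuous_def.mpr fun _ hU => hU.1)

theorem invariants_smul_ne_zero_iff (γ : SL(2, ℤ)) (τ : ℍ) :
    gTwo (γ • τ) * gThree (γ • τ) ≠ 0 ↔ gTwo τ * gThree τ ≠ 0 := by
  rw [gTwo_smul, gThree_smul]
  simp [autFactor_ne_zero]

theorem proj_mem_compl_exceptionalLocus_iff (Γ : Subgroup SL(2, ℤ)) (τ : ℍ) :
    proj Γ (.ofUpper τ) ∈ (exceptionalLocus Γ)ᶜ ↔ gTwo τ * gThree τ ≠ 0 := by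
  rw [Set.mem_compl_iff, not_iff_comm, not_not, ← ofUpper_mem_exceptionalPoints_iff]
  constructor
  · exact fun h => ⟨_, h, rfl⟩
  · rintro ⟨q, hq, h⟩
    obtain ⟨γ, hγ⟩ := MulAction.orbitRel_apply.mp (Quotient.exact h)
    cases q with
    | cusp c => cases hγ
    | ofUpper τ' =>
      rw [ofUpper_mem_exceptionalPoints_iff] at hq ⊢
      obtain rfl : (γ : SL(2, ℤ)) • τ = τ' := ExtendedUpperHalfPlane.ofUpper.inj hγ
      exact not_not.mp (mt (invariants_smul_ne_zero_iff _ _).mpr (not_not.mpr hq))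

theorem proj_cusp_mem_exceptionalLocus (Γ : Subgroup SL(2, ℤ)) (c : OnePoint ℚ) :
    proj Γ (.cusp c) ∈ exceptionalLocus Γ :=
  ⟨_, Or.inl ⟨c, rfl⟩, rfl⟩

theorem exists_ofUpper_of_mem_compl {Γ : Subgroup SL(2, ℤ)} {p : ModularCurve Γ}
    (hp : p ∈ (exceptionalLocus Γ)ᶜ) :
    ∃ τ : ℍ, p = proj Γ (.ofUpper τ) ∧ gTwo τ * gThree τ ≠ 0 := by
  induction p using Quotient.inductionOn with
  | h q =>
    cases q with
    | cusp c => exact absurd (proj_cusp_mem_exceptionalLocus Γ c) hp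
    | ofUpper τ => exact ⟨τ, rfl, (proj_mem_compl_exceptionalLocus_iff Γ τ).mp hp⟩

theorem isOpen_compl_exceptionalLocus (Γ : Subgroup SL(2, ℤ)) : IsOpen (exceptionalLocus Γ)ᶜ := by
  refine isOpen_coinduced.mpr ⟨?_, fun α hα => ?_⟩
  · have : {τ : ℍ | gTwo τ * gThree τ ≠ 0} =
        ExtendedUpperHalfPlane.ofUpper ⁻¹' (proj Γ ⁻¹' (exceptionalLocus Γ)ᶜ) := by
      ext τ
      exact (proj_mem_compl_exceptionalLocus_iff Γ τ).symm
    refine this ▸ isOpen_ne_fun ?_ continuous_const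
    exact mdifferentiable_gTwo.continuous.mul mdifferentiable_gThree.continuous
  · exact absurd (proj_cusp_mem_exceptionalLocus Γ _) hα

/-- Γ(N) is normal of finite index and contained in Γ_{1,4}(N). -/
theorem exists_finite_representatives (N : ℕ) (hN : 0 < N) (h4 : 4 ∣ N) :
    ∃ R : Set SL(2, ℤ), R.Finite ∧ ∀ γ : SL(2, ℤ), ∃ g ∈ Gamma14 N, ∃ δ ∈ R, γ = g * δ := by
  have : NeZero N := ⟨hN.ne'⟩
  have hn := CongruenceSubgroup.Gamma_normal (N := N)
  refine ⟨Set.range fun q : SL(2, ℤ) ⧸ CongruenceSubgroup.Gamma N => q.out, Set.finite_range _,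
    fun γ => ?_⟩
  set δ := (γ : SL(2, ℤ) ⧸ CongruenceSubgroup.Gamma N).out with hδ
  have h1 : δ⁻¹ * γ ∈ CongruenceSubgroup.Gamma N :=
    QuotientGroup.eq.mp (QuotientGroup.out_eq' _)
  exact ⟨γ * δ⁻¹, Gamma_le_Gamma14 h4 (hn.mem_comm h1), δ, ⟨_, rfl⟩,
    (inv_mul_cancel_right γ δ).symm⟩

theorem proj_eq_of_coordinates_eq {N : ℕ} (hN : 0 < N) (h4 : 4 ∣ N) {τ₁ τ₂ : ℍ}
    (h₁ : gTwo τ₁ * gThree τ₁ ≠ 0) (h₂ : gTwo τ₂ * gThree τ₂ ≠ 0)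
    (h : coordinates N τ₁ = coordinates N τ₂) :
    proj (Gamma14 N) (.ofUpper τ₁) = proj (Gamma14 N) (.ofUpper τ₂) := by
  simp only [coordinates, Prod.mk.injEq] at h
  obtain ⟨γ, hγ, rfl⟩ := exists_mem_Gamma14_smul hN h4 h₁ h₂ h.1 h.2.1 h.2.2
  exact (proj_smul hγ τ₁).symm

/-- Continuity of the inverse at τ₀. If τ has coordinates near those of τ₀, openness of v gives τ'
near τ₀ with v(τ') = v(τ), so modulo Γ_{1,4}(N) the point τ is δτ' with δ from a finite set, and
each δ can be treated separately. -/
theorem eventually_proj_mem {N : ℕ} (hN : 0 < N) (h4 : 4 ∣ N) {τ₀ : ℍ}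
    (h₀ : gTwo τ₀ * gThree τ₀ ≠ 0) {U : Set (ModularCurve (Gamma14 N))}
    (hU : U ∈ 𝓝 (proj (Gamma14 N) (.ofUpper τ₀))) :
    ∀ᶠ w in 𝓝 (coordinates N τ₀), ∀ τ : ℍ, gTwo τ * gThree τ ≠ 0 → coordinates N τ = w →
      proj (Gamma14 N) (.ofUpper τ) ∈ U := by
  have hN2 : 2 ≤ N := by have := Nat.le_of_dvd hN h4; omega
  obtain ⟨R, hR, hrep⟩ := exists_finite_representatives N hN h4
  have hlocal : ∀ δ ∈ R, ∀ᶠ p : ℍ × (ℂ × ℂ × ℂ) in 𝓝 τ₀ ×ˢ 𝓝 (coordinates N τ₀),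
      coordinates N (δ • p.1) = p.2 → proj (Gamma14 N) (.ofUpper (δ • p.1)) ∈ U := by
    intro δ _
    have hδ : Continuous fun τ : ℍ => δ • τ :=
      continuous_const_smul (Matrix.SpecialLinearGroup.mapGL ℝ δ)
    -- Either δτ₀ and τ₀ have the same class, and then δτ' stays in U by continuity; or their
    -- coordinates differ, and then those of δτ' cannot equal a point close to the coordinates of
    -- τ₀.
    by_cases hc : coordinates N (δ • τ₀) = coordinates N τ₀
    · have h1 := proj_eq_of_coordinates_eq hN h4 ((invariants_smul_ne_zero_iff δ τ₀).mpr h₀) h₀ hc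
      rw [← h1] at hU
      have h2 : ∀ᶠ τ in 𝓝 τ₀, proj (Gamma14 N) (.ofUpper (δ • τ)) ∈ U :=
        ((continuous_proj_ofUpper (Gamma14 N)).comp hδ).continuousAt.eventually hU
      filter_upwards [h2.prod_inl _] with p hp _ using hp
    · have h1 : Tendsto (fun p : ℍ × (ℂ × ℂ × ℂ) => (coordinates N (δ • p.1), p.2))
          (𝓝 τ₀ ×ˢ 𝓝 (coordinates N τ₀)) (𝓝 (coordinates N (δ • τ₀), coordinates N τ₀)) := by
        exact ((((continuous_coordinates hN2).comp hδ).tendsto τ₀).comp tendsto_fst).prodMk_nhds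
          tendsto_snd
      have h2 : ∀ᶠ p : (ℂ × ℂ × ℂ) × (ℂ × ℂ × ℂ) in
          𝓝 (coordinates N (δ • τ₀), coordinates N τ₀), p.1 ≠ p.2 :=
        (isOpen_ne_fun continuous_fst continuous_snd).mem_nhds hc
      filter_upwards [h1.eventually h2] with p hp hp' using absurd hp' hp
  have hall := (eventually_all_finite hR).mpr hlocal
  have hnonexc : ∀ᶠ τ in 𝓝 τ₀, gTwo τ * gThree τ ≠ 0 :=
    (mdifferentiable_gTwo.continuous.mul mdifferentiable_gThree.continuous).continuousAt.eventually
      (isOpen_ne.mem_nhds h₀)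
  obtain ⟨V, hV, O, hO, hVO⟩ := mem_prod_iff.mp hall
  have hV' : vFun '' (V ∩ {τ | gTwo τ * gThree τ ≠ 0}) ∈ 𝓝 (vFun τ₀) := by
    rw [← map_vFun_nhds (mul_ne_zero_iff.mp h₀).1]
    exact image_mem_map (inter_mem hV hnonexc)
  have hfst : ∀ᶠ w in 𝓝 (coordinates N τ₀), w.1 ∈ vFun '' (V ∩ {τ | gTwo τ * gThree τ ≠ 0}) :=
    (continuous_fst.tendsto (coordinates N τ₀)) hV'
  filter_upwards [hO, hfst] with w hwO hwV τ hτ hw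
  obtain ⟨τ', ⟨hτV, hτ'⟩, hv⟩ := hwV
  have hv' : vFun τ' = vFun τ := by rw [hv, ← hw]; rfl
  obtain ⟨γ, rfl⟩ := exists_smul_of_vFun_eq hτ' hτ hv'
  obtain ⟨g, hg, δ, hδ, rfl⟩ := hrep γ
  rw [mul_smul] at hw ⊢
  rw [proj_smul hg]
  rw [coordinates_smul_of_mem hN2 hg] at hw
  exact hVO (Set.mk_mem_prod hτV hwO) δ hδ hw

theorem isEmbedding_curveMap {N : ℕ} (hN : 2 ≤ N) (hN0 : 0 < N) (h4 : 4 ∣ N) :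
    Topology.IsEmbedding ((exceptionalLocus (Gamma14 N))ᶜ.domRestrict (curveMap hN)) := by
  have hcont : Continuous ((exceptionalLocus (Gamma14 N))ᶜ.domRestrict (curveMap hN)) :=
    (continuous_curveMap hN).comp continuous_subtype_val
  refine ⟨Topology.isInducing_iff_nhds.mpr fun p => le_antisymm hcont.continuousAt.le_comap ?_, ?_⟩
  · obtain ⟨p, hp⟩ := p
    obtain ⟨τ₀, rfl, h₀⟩ := exists_ofUpper_of_mem_compl hp
    intro U hU
    rw [nhds_subtype, mem_comap] at hU
    obtain ⟨U', hU', hUU'⟩ := hU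
    have hev := comap_affinePoint_nhds_le _ (eventually_proj_mem hN0 h4 h₀ hU')
    obtain ⟨O, hO, hOU⟩ := mem_comap.mp hev
    refine mem_comap.mpr ⟨O, hO, fun q hq => hUU' ?_⟩
    obtain ⟨q, hq'⟩ := q
    obtain ⟨τ, rfl, hτ⟩ := exists_ofUpper_of_mem_compl hq'
    exact hOU (a := coordinates N τ) hq τ hτ rfl
  · rintro ⟨p, hp⟩ ⟨q, hq⟩ hpq
    obtain ⟨τ₁, rfl, h₁⟩ := exists_ofUpper_of_mem_compl hp
    obtain ⟨τ₂, rfl, h₂⟩ := exists_ofUpper_of_mem_compl hq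
    refine Subtype.ext (proj_eq_of_coordinates_eq hN0 h4 h₁ h₂ ?_)
    obtain ⟨a, ha⟩ := (Projectivization.mk_eq_mk_iff' ℂ _ _ _ _).mp hpq
    have e3 := congrFun ha 3
    -- Both representatives end in 1, so the scalar relating them is 1.
    obtain rfl : a = 1 := by simpa using e3
    rw [one_smul] at ha
    have e0 := congrFun ha 0
    have e1 := congrFun ha 1
    have e2 := congrFun ha 2
    simp at e0 e1 e2
    simp [coordinates, e0, e1, e2]

theorem isHolomorphicEmbeddingOn_curveMap {N : ℕ} (hN : 2 ≤ N) (hN0 : 0 < N) (h4 : 4 ∣ N) :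
    IsHolomorphicEmbeddingOn (Gamma14 N) (curveMap hN) (exceptionalLocus (Gamma14 N))ᶜ := by
  refine ⟨isOpen_compl_exceptionalLocus _, isEmbedding_curveMap hN hN0 h4, fun τ hτ => ?_,
    fun α hα => absurd (proj_cusp_mem_exceptionalLocus _ _) hα⟩
  have h := (mul_ne_zero_iff.mp ((proj_mem_compl_exceptionalLocus_iff _ τ).mp hτ)).1
  exact ⟨_, isLiftAt_upperParam hN τ, linearIndependent_affineLift hN h⟩

end Embedding

end ModularSurface

end

theorem proposition3p2 (N : ℕ) (hN : 0 < N) (h4 : 4 ∣ N) :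
    ∃ ι : ModularCurve (Gamma14 N) → P3,
      IsHolomorphic (Gamma14 N) ι ∧
      (∀ p : ModularCurve (Gamma14 N), ι p ∈ surface) ∧
      (∀ τ : UpperHalfPlane,
        ι (proj (Gamma14 N) (ExtendedUpperHalfPlane.ofUpper τ)) =
          affinePoint (vFun τ) (xFun 0 (1 / (N : ℚ)) τ) (yFun 0 (1 / (N : ℚ)) τ)) ∧
      IsHolomorphicEmbeddingOn (Gamma14 N) ι (exceptionalLocus (Gamma14 N))ᶜ := by
  have hN2 : 2 ≤ N := le_trans (by norm_num) (Nat.le_of_dvd hN h4)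
  exact ⟨curveMap hN2, isHolomorphic_curveMap hN2 hN h4, curveMap_mem_surface hN2,
    fun τ => rfl, isHolomorphicEmbeddingOn_curveMap hN2 hN h4⟩
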